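/- **Setting.** Let $\mathbb H_{\rm s},\mathbb H_{\rm e}$ be complex Hilbert spaces (of any dimension) and let the set of times be a linear order with least element $t_0$ (discrete or continuous). The dynamics of an open quantum system consists of unitaries $\hat U_{t_0}^t$ on $\mathbb H_{\rm s}\otimes\mathbb H_{\rm e}$ for $t\ge t_0$, with $\hat U_{t_0}^{t_0}=1$, and an initial environment state $\rho_{\rm e}$ (a positive operator of unit trace). Write $\hat U_{t_1}^{t_2}=\hat U_{t_0}^{t_2}\hat U_{t_0}^{t_1\dagger}$, and let $\mathcal E_{t_0}^t X={\rm Tr}_{\rm e}[\hat U_{t_0}^t(X\otimes\rho_{\rm e})\hat U_{t_0}^{t\dagger}]$ be the dynamical map. *Past–future independence (PFI):* for each time $t$ there is a factorization $\mathbb H_{\rm e}=\mathbb P_t\otimes\mathbb F_t$ (past and future subsystems) and for all $t_0\le t_1\le t_2$ a space $\mathbb E_{t_1}^{t_2}$ such that, as subsystems of the environment, $\mathbb P_{t_2}=\mathbb P_{t_1}\otimes\mathbb E_{t_1}^{t_2}$ and $\mathbb F_{t_1}=\mathbb E_{t_1}^{t_2}\otimes\mathbb F_{t_2}$, so that $\mathbb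 H_{\rm e}=\mathbb P_{t_1}\otimes\mathbb E_{t_1}^{t_2}\otimes\mathbb F_{t_2}$; with respect to this factorization, $\rho_{\rm e}$ is a product of three states, and $\hat U_{t_1}^{t_2}=\hat U({\rm p}_1)\otimes\hat U({\rm s},{\rm e}_1^2)\otimes\hat U({\rm f}_2)$ with unitaries on $\mathbb P_{t_1}$, $\mathbb H_{\rm s}\otimes\mathbb E_{t_1}^{t_2}$ and $\mathbb F_{t_2}$. *Pure unravellings.* Given a pure state $\hat\pi$ of the system and times $t_0<t_1<\dots<t_n$, a measurement scheme prescribes a measurement on the environment at each of $t_0,\dots,t_n$ (a family, labelled by the results, of completely positive maps in Kraus form whose sum is trace preserving), which may depend on the earlier results. It is a *pure unravelling* for $\hat\pi$ and these times if the initial measurement leaves $\rho_{\rm e}$ unchanged on average and if, for each $j=1,\dots,n$, the system state at $t_j$ conditional on any record $(r_0,\dots,r_j)$ of non-zero probability is pure, and the average of these conditional states over all records is $\mathcal E_{t_0}^{t_j}\hat\pi$. It induces an ensemble (a discrete probability distribution) of trajectories of conditional system states at the times $t_0,\dots,t_n$. The dynamics satisfies *PU* if a pure unravelling exists for every pure $\hat\pi$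 and every finite sequence of times. It satisfies *MPU* (many pure unravellings) if it satisfies PU and there is a pure state $\hat\pi$, with $\mathcal E_{t_0}^{s}\hat\pi$ not pure for some time $s$, such that for every finite sequence of times $t_0<\dots<t_n$ for which some $\mathcal E_{t_0}^{t_j}\hat\pi$ is not pure, there are infinitely many pure unravellings for $\hat\pi$ and these times which induce pairwise distinct ensembles of trajectories. *Non-trivial* dynamics: some pure system state $\hat\pi$ and some time $t$ satisfy that $\mathcal E_{t_0}^t\hat\pi$ is not pure. **Theorem.** (1) Every dynamics that satisfies PFI satisfies PU, and every non-trivial dynamics that satisfies PFI satisfies MPU. (2) The converse fails: for every set of times as above without a greatest element, there is a dynamics that satisfies MPU but not PFI. -/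

import Mathlib

open scoped TensorProduct InnerProductSpace

noncomputable section

namespace OQS

universe u v w

/-! ### Hilbert-space tensor products -/

/-- The Hilbert-space tensor product: the completion of the algebraic tensor product with respect
to the inner product determined by `⟪a ⊗ b, a' ⊗ b'⟫ = ⟪a, a'⟫ * ⟪b, b'⟫`. -/
abbrev HilbertTensor (A : Type u) (B : Type v) [NormedAddCommGroup A] [InnerProductSpace ℂ A]
    [NormedAddCommGroup B] [InnerProductSpace ℂ B] : Type (max u v) :=
  UniformSpace.Completion (A ⊗[ℂ] B)

section Tensor

variable {A A' : Type u} {B B' : Type v}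
  [NormedAddCommGroup A] [InnerProductSpace ℂ A] [NormedAddCommGroup A'] [InnerProductSpace ℂ A']
  [NormedAddCommGroup B] [InnerProductSpace ℂ B] [NormedAddCommGroup B'] [InnerProductSpace ℂ B']

/-- The product vector `a ⊗ b`. -/
def htmul (a : A) (b : B) : HilbertTensor A B := ((a ⊗ₜ[ℂ] b : A ⊗[ℂ] B) : HilbertTensor A B)

/-- The bounded linear map `a ↦ a ⊗ b`. -/
def tmulRight (A : Type u) [NormedAddCommGroup A] [InnerProductSpace ℂ A] (b : B) :
    A →L[ℂ] HilbertTensor A B :=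
  UniformSpace.Completion.toComplL ∘L (TensorProduct.mkL ℂ A B).flip b

/-- The bounded linear map `b ↦ a ⊗ b`. -/
def tmulLeft (B : Type v) [NormedAddCommGroup B] [InnerProductSpace ℂ B] (a : A) :
    B →L[ℂ] HilbertTensor A B :=
  UniformSpace.Completion.toComplL ∘L TensorProduct.mkL ℂ A B a

/-- The tensor product `f ⊗ g` of bounded operators. -/
def tensorOp (f : A →L[ℂ] A') (g : B →L[ℂ] B') : HilbertTensor A B →L[ℂ] HilbertTensor A' B' :=
  (UniformSpace.Completion.toComplL ∘L TensorProduct.mapL f g).extend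
    (UniformSpace.Completion.toComplL : (A ⊗[ℂ] B) →L[ℂ] HilbertTensor A B)

theorem tmulRight_apply (a : A) (b : B) : tmulRight A b a = htmul a b := rfl

theorem tmulLeft_apply (a : A) (b : B) : tmulLeft B a b = htmul a b := rfl

theorem tensorOp_htmul (f : A →L[ℂ] A') (g : B →L[ℂ] B') (a : A) (b : B) :
    tensorOp f g (htmul a b) = htmul (f a) (g b) :=
  ContinuousLinearMap.extend_eq (UniformSpace.Completion.toComplL ∘L TensorProduct.mapL f g)
    UniformSpace.Completion.denseRange_coe
    (UniformSpace.Completion.isUniformInducing_coe _) (a ⊗ₜ[ℂ] b)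

end Tensor

/-! ### States, traces, partial traces -/

section States

variable {H : Type u} [NormedAddCommGroup H] [InnerProductSpace ℂ H] [CompleteSpace H]

/-- The index set of a fixed orthonormal (Hilbert) basis of `H`. -/
def basisSet (H : Type u) [NormedAddCommGroup H] [InnerProductSpace ℂ H] [CompleteSpace H] :
    Set H := (exists_hilbertBasis ℂ H).choose

/-- A fixed orthonormal (Hilbert) basis of `H`, used to compute traces. -/
def basis (H : Type u) [NormedAddCommGroup H] [InnerProductSpace ℂ H] [CompleteSpace H] :
    HilbertBasis (basisSet H) ℂ H := (exists_hilbertBasis ℂ H).choose_spec.choose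

/-- The trace `Tr X = ∑ᵢ ⟪eᵢ, X eᵢ⟫` (of a trace-class operator). -/
def trace (X : H →L[ℂ] H) : ℂ := ∑' i, ⟪basis H i, X (basis H i)⟫_ℂ

/-- A (possibly mixed) state: a positive operator of unit trace. -/
def IsState (ρ : H →L[ℂ] H) : Prop := ρ.IsPositive ∧ trace ρ = 1

/-- The operator `|ψ⟩⟨ψ|`. -/
def ketbra (ψ : H) : H →L[ℂ] H := InnerProductSpace.rankOne ℂ ψ ψ

/-- A pure state: a rank-one projector `|ψ⟩⟨ψ|` with `‖ψ‖ = 1`. -/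
def IsPure (X : H →L[ℂ] H) : Prop := ∃ ψ : H, ‖ψ‖ = 1 ∧ X = ketbra ψ

/-- The partial trace over the second factor, `Tr_B X = ∑ᵢ (1 ⊗ ⟨eᵢ|) X (1 ⊗ |eᵢ⟩)`
(of a trace-class operator; the sum then converges absolutely in operator norm). -/
def partialTrace {A : Type u} {B : Type v} [NormedAddCommGroup A] [InnerProductSpace ℂ A]
    [CompleteSpace A] [NormedAddCommGroup B] [InnerProductSpace ℂ B] [CompleteSpace B]
    (X : HilbertTensor A B →L[ℂ] HilbertTensor A B) : A →L[ℂ] A :=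
  ∑' i, ContinuousLinearMap.adjoint (tmulRight A (basis B i)) ∘L X ∘L tmulRight A (basis B i)

/-- The unitary map `X ↦ W X W†`. -/
def unitaryConj (W : H ≃ₗᵢ[ℂ] H) (X : H →L[ℂ] H) : H →L[ℂ] H :=
  (W : H →L[ℂ] H) ∘L X ∘L (W.symm : H →L[ℂ] H)

/-- The completely positive map `X ↦ ∑ₖ Kₖ X Kₖ†` with Kraus operators `Kₖ`
(on a trace-class `X` with `∑ₖ Kₖ† Kₖ ≤ 1`, the sum converges absolutely in operator norm). -/
def krausMap {κ : Type v} (K : κ → H →L[ℂ] H) (X : H →L[ℂ] H) : H →L[ℂ] H :=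
  ∑' k, K k ∘L X ∘L ContinuousLinearMap.adjoint (K k)

end States

/-! ### Open quantum systems -/

/-- The dynamics of an open quantum system: the system--environment unitaries `Û_{t₀}^t`, `t ≥ t₀`,
on `Hs ⊗ He`, together with the initial environment state `ρₑ(t₀)`. The set `T` of times is a
linear order whose least element `⊥` is the initial time `t₀`; it may be discrete or
continuous. -/
structure OpenSystem (T : Type w) [LinearOrder T] [OrderBot T]
    (Hs : Type u) [NormedAddCommGroup Hs] [InnerProductSpace ℂ Hs] [CompleteSpace Hs]
    (He : Type v) [NormedAddCommGroup He] [InnerProductSpace ℂ He] [CompleteSpace He] where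
  /-- `U t` is `Û_{t₀}^t`. -/
  U : T → (HilbertTensor Hs He ≃ₗᵢ[ℂ] HilbertTensor Hs He)
  U_bot : U ⊥ = LinearIsometryEquiv.refl ℂ (HilbertTensor Hs He)
  /-- `ρe` is `ρₑ(t₀)`. -/
  ρe : He →L[ℂ] He
  isState : IsState ρe

/-- A measurement with results in `R`: the result `r` corresponds to the operation
(completely positive trace-nonincreasing map) with Kraus operators `K r k`, and
`∑_{r,k} (K r k)† (K r k) = 1`, i.e. the sum of all the operations is trace preserving.
(Vanishing operations `K r = 0` are allowed, so that one set of labels `R` serves measurements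
with different numbers of results.) -/
structure Measurement (H : Type v) [NormedAddCommGroup H] [InnerProductSpace ℂ H]
    (R : Type v) where
  κ : Type v
  K : R → κ → H →L[ℂ] H
  complete : ∀ x : H, HasSum (fun p : R × κ => ‖K p.1 p.2 x‖ ^ 2) (‖x‖ ^ 2)

/-- An (adaptive) measurement scheme: a record is the list of the results obtained so far, with the
most recent one first, and `meas past` is the measurement carried out at time `t_j` if
`past = [r_{j-1}, …, r_0]`; in particular `meas []` is the initial measurement at `t₀`. -/
structure MeasurementScheme (H : Type v) [NormedAddCommGroup H] [InnerProductSpace ℂ H] where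
  R : Type v
  meas : List R → Measurement H R

namespace OpenSystem

variable {T : Type w} [LinearOrder T] [OrderBot T]
  {Hs : Type u} [NormedAddCommGroup Hs] [InnerProductSpace ℂ Hs] [CompleteSpace Hs]
  {He : Type v} [NormedAddCommGroup He] [InnerProductSpace ℂ He] [CompleteSpace He]

/-- `Û_{t₁}^{t₂} = Û_{t₀}^{t₂} (Û_{t₀}^{t₁})†`. -/
def evol (D : OpenSystem T Hs He) (t₁ t₂ : T) : HilbertTensor Hs He ≃ₗᵢ[ℂ] HilbertTensor Hs He :=
  (D.U t₁).symm.trans (D.U t₂)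

/-- The dynamical map `X ↦ Trₑ[Û (X ⊗ ρₑ(t₀)) Û†]`, with `Û = Û_{t₀}^t`. -/
def dynMap (D : OpenSystem T Hs He) (t : T) (X : Hs →L[ℂ] Hs) : Hs →L[ℂ] Hs :=
  partialTrace (unitaryConj (D.U t) (tensorOp X D.ρe))

/-- The dynamics is non-trivial if some initially pure state of the system is mixed at
some time. -/
def NonTrivial (D : OpenSystem T Hs He) : Prop :=
  ∃ ψ : Hs, ‖ψ‖ = 1 ∧ ∃ t : T, ¬ IsPure (D.dynMap t (ketbra ψ))

/-! ### Past--future independence -/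

/-- A past--future decomposition of the dynamics: for all `t₀ ≤ t₁ ≤ t₂`, the environment is the
tensor product of the past `P t₁`, the current part `E t₁ t₂` and the future `F t₂`. -/
structure PastFutureDecomposition (D : OpenSystem T Hs He) where
  P : T → Type v
  E : T → T → Type v
  F : T → Type v
  [normP : ∀ t, NormedAddCommGroup (P t)]
  [innerP : ∀ t, InnerProductSpace ℂ (P t)]
  [completeP : ∀ t, CompleteSpace (P t)]
  [normE : ∀ t₁ t₂, NormedAddCommGroup (E t₁ t₂)]
  [innerE : ∀ t₁ t₂, InnerProductSpace ℂ (E t₁ t₂)]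
  [completeE : ∀ t₁ t₂, CompleteSpace (E t₁ t₂)]
  [normF : ∀ t, NormedAddCommGroup (F t)]
  [innerF : ∀ t, InnerProductSpace ℂ (F t)]
  [completeF : ∀ t, CompleteSpace (F t)]
  /-- `He = P_t ⊗ F_t`. -/
  join : ∀ t, HilbertTensor (P t) (F t) ≃ₗᵢ[ℂ] He
  /-- `P_{t₂} = P_{t₁} ⊗ E_{t₁}^{t₂}`: the current part becomes part of the past. -/
  joinPast : ∀ t₁ t₂, t₁ ≤ t₂ → HilbertTensor (P t₁) (E t₁ t₂) ≃ₗᵢ[ℂ] P t₂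
  /-- `F_{t₁} = E_{t₁}^{t₂} ⊗ F_{t₂}`. -/
  joinFuture : ∀ t₁ t₂, t₁ ≤ t₂ → HilbertTensor (E t₁ t₂) (F t₂) ≃ₗᵢ[ℂ] F t₁
  /-- The factor `P_{t₁}` of `He = (P_{t₁} ⊗ E_{t₁}^{t₂}) ⊗ F_{t₂}` is the same subsystem of the
  environment as the factor `P_{t₁}` of `He = P_{t₁} ⊗ F_{t₁}`. -/
  coherent : ∀ t₁ t₂ (h : t₁ ≤ t₂) (p : P t₁) (c : E t₁ t₂) (f : F t₂),
    join t₂ (htmul (joinPast t₁ t₂ h (htmul p c)) f) =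
      join t₁ (htmul p (joinFuture t₁ t₂ h (htmul c f)))
  /-- The initial environment state factorizes as `ρ_{p₁} ⊗ ρ_{e₁²} ⊗ ρ_{f₂}`. -/
  state_factorizes : ∀ t₁ t₂ (h : t₁ ≤ t₂),
    ∃ (ρp : P t₁ →L[ℂ] P t₁) (ρc : E t₁ t₂ →L[ℂ] E t₁ t₂) (ρf : F t₂ →L[ℂ] F t₂),
      IsState ρp ∧ IsState ρc ∧ IsState ρf ∧
      ∀ (p : P t₁) (c : E t₁ t₂) (f : F t₂),
        D.ρe (join t₂ (htmul (joinPast t₁ t₂ h (htmul p c)) f)) =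
          join t₂ (htmul (joinPast t₁ t₂ h (htmul (ρp p) (ρc c))) (ρf f))
  /-- `Û_{t₁}^{t₂} = Û(p₁) ⊗ Û(s,e₁²) ⊗ Û(f₂)` on `Hs ⊗ He = P_{t₁} ⊗ (Hs ⊗ E_{t₁}^{t₂}) ⊗ F_{t₂}`.
  Here `p, f, x ↦ p ⊗ x ⊗ f`, for `x ∈ Hs ⊗ E_{t₁}^{t₂}`, is written as the operator
  `1 ⊗ (c ↦ p ⊗ c ⊗ f)` from `Hs ⊗ E_{t₁}^{t₂}` to `Hs ⊗ He`, applied to `x`. -/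
  evol_factorizes : ∀ t₁ t₂ (h : t₁ ≤ t₂),
    ∃ (Up : P t₁ ≃ₗᵢ[ℂ] P t₁)
      (Usc : HilbertTensor Hs (E t₁ t₂) ≃ₗᵢ[ℂ] HilbertTensor Hs (E t₁ t₂))
      (Uf : F t₂ ≃ₗᵢ[ℂ] F t₂),
      ∀ (p : P t₁) (f : F t₂) (x : HilbertTensor Hs (E t₁ t₂)),
        let emb : P t₁ → F t₂ → (HilbertTensor Hs (E t₁ t₂) →L[ℂ] HilbertTensor Hs He) :=
          fun p f => tensorOp (ContinuousLinearMap.id ℂ Hs)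
            ((join t₂ : HilbertTensor (P t₂) (F t₂) →L[ℂ] He) ∘L tmulRight (P t₂) f ∘L
              (joinPast t₁ t₂ h : HilbertTensor (P t₁) (E t₁ t₂) →L[ℂ] P t₂) ∘L
                tmulLeft (E t₁ t₂) p)
        D.evol t₁ t₂ (emb p f x) = emb (Up p) (Uf f) (Usc x)

/-- Past--future independence. -/
def PFI (D : OpenSystem T Hs He) : Prop := Nonempty (PastFutureDecomposition D)

/-! ### Pure unravellings -/

/-- `t 0, t 1, …, t n` is a finite sequence of times `t₀ < t₁ < ⋯ < t_n` starting at the initial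
time (the values of `t` beyond `n` are irrelevant). -/
def IsTimeSequence (n : ℕ) (t : ℕ → T) : Prop := t 0 = ⊥ ∧ ∀ i < n, t i < t (i + 1)

section Scheme

variable (D : OpenSystem T Hs He) (ψ : Hs) (t : ℕ → T) (S : MeasurementScheme He)

/-- The effect on the joint state of obtaining the result `r` when the measurement prescribed by
the scheme after the record `past` acts on the environment (unnormalized). -/
def afterResult (past : List S.R) (r : S.R)
    (σ : HilbertTensor Hs He →L[ℂ] HilbertTensor Hs He) :
    HilbertTensor Hs He →L[ℂ] HilbertTensor Hs He :=
  krausMap (fun k => tensorOp (ContinuousLinearMap.id ℂ Hs) ((S.meas past).K r k)) σ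

/-- The unnormalized joint state at time `t_j`, just before the measurement at that time,
given the record `[r_{j-1}, …, r_0]`, for the initial system state `|ψ⟩⟨ψ|`. -/
def preState : List S.R → (HilbertTensor Hs He →L[ℂ] HilbertTensor Hs He)
  | [] => tensorOp (ketbra ψ) D.ρe
  | r :: past => unitaryConj (D.evol (t past.length) (t (past.length + 1)))
      (afterResult S past r (preState past))

/-- The unnormalized system state at time `t_j`, just after the measurement at that time,
given the record `[r_j, …, r_0]`. -/
def reducedState : List S.R → (Hs →L[ℂ] Hs)
  | [] => ketbra ψ
  | r :: past => partialTrace (afterResult S past r (D.preState ψ t S past))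

/-- The probability of a record. -/
def prob (l : List S.R) : ℝ := (trace (D.reducedState ψ t S l)).re

/-- The conditional system state given a record (of non-zero probability). -/
def condState (l : List S.R) : Hs →L[ℂ] Hs :=
  ((D.prob ψ t S l : ℂ))⁻¹ • D.reducedState ψ t S l

/-- The quantum trajectory for the record `[r_n, …, r_0]`: the list of the conditional system
states at the times `t_n, …, t_0`. -/
def trajectory : List S.R → List (Hs →L[ℂ] Hs)
  | [] => []
  | r :: past => D.condState ψ t S (r :: past) :: trajectory past

/-- The ensemble of quantum trajectories over `t₀ < ⋯ < t_n` induced by a scheme, as a (discrete)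
probability distribution on trajectories: the total probability of all the records that give rise
to a trajectory. It does not depend on how the measurement results are labelled. -/
def trajectoryLaw (n : ℕ) (Υ : List (Hs →L[ℂ] Hs)) : ℝ :=
  ∑' l : {l : List S.R // l.length = n + 1 ∧ D.trajectory ψ t S l = Υ}, D.prob ψ t S l.1

/-- The measurement scheme is a pure unravelling of the dynamics, for the initial system state
`|ψ⟩⟨ψ|` and the times `t₀ < t₁ < ⋯ < t_n`: on average the initial measurement leaves `ρₑ(t₀)`
unchanged and, at each time `t_j`, the conditional system states are pure and they average to the
state given by the dynamical map. -/
def IsPureUnravelling (n : ℕ) : Prop :=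
  HasSum (fun r : S.R => krausMap ((S.meas []).K r) D.ρe) D.ρe ∧
  ∀ j, 1 ≤ j → j ≤ n →
    (∀ l : List S.R, l.length = j + 1 → D.prob ψ t S l ≠ 0 → IsPure (D.condState ψ t S l)) ∧
    HasSum (fun l : {l : List S.R // l.length = j + 1} =>
        (D.prob ψ t S l.1 : ℂ) • D.condState ψ t S l.1)
      (D.dynMap (t j) (ketbra ψ))

end Scheme

/-- Existence of a pure unravelling (PU), for every pure initial system state and every finite
sequence of times. -/
def PU (D : OpenSystem T Hs He) : Prop :=
  ∀ ψ : Hs, ‖ψ‖ = 1 → ∀ (n : ℕ) (t : ℕ → T), IsTimeSequence n t →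
    ∃ S : MeasurementScheme He, D.IsPureUnravelling ψ t S n

/-- Existence of many pure unravellings (MPU): PU holds and, for some pure initial system state
which does not remain pure, there are infinitely many pure unravellings with pairwise distinct
ensembles of trajectories, for every finite sequence of times at which it does not remain pure.
(If the state is pure at all the times `t₁, …, t_n`, then only one ensemble of trajectories is
possible.) -/
def MPU (D : OpenSystem T Hs He) : Prop :=
  D.PU ∧ ∃ ψ : Hs, ‖ψ‖ = 1 ∧ (∃ s : T, ¬ IsPure (D.dynMap s (ketbra ψ))) ∧
    ∀ (n : ℕ) (t : ℕ → T), IsTimeSequence n t →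
      (∃ j ≤ n, ¬ IsPure (D.dynMap (t j) (ketbra ψ))) →
      {law : List (Hs →L[ℂ] Hs) → ℝ | ∃ S : MeasurementScheme He,
        D.IsPureUnravelling ψ t S n ∧ D.trajectoryLaw ψ t S n = law}.Infinite

end OpenSystem

end OQS

end

/-!
Both parts rest on one kind of measurement scheme: at each time the environment is read out in a frame
of vectors and then prepared afresh in a random pure state `z_c`, with Kraus operators
`|z_c⟩⟨b_{a,g}|` (`reprepare`). After each result the joint state is a product `s ⊗ z_c`
(`Repreparation.afterResult_preState`), so that only system vectors have to be followed. The scheme is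
a pure unravelling if three conditions hold (`Repreparation.isPureUnravelling`): the first
preparation represents the initial environment state; the unrecorded index `g` of the read-out is
not correlated with the system; and starting afresh from `s ⊗ z_c` at one time gives, on average,
the correct system state at the next one. A `RepreparationFamily` provides such data for all times.

Trace-class operators are handled through ensembles: `X = ∑ᵢ |vᵢ⟩⟨vᵢ|` with `∑ᵢ ‖vᵢ‖² < ∞`
(`IsEnsemble`). Ensembles pass through all the maps of the theory, and an operator with an ensemble
is determined by its quadratic form `x ↦ ∑ᵢ |⟪x, vᵢ⟫|²` (`IsEnsemble.of_moments`), which is computed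
in `ℝ≥0∞`, so that sums may be interchanged freely.

*Past–future independence implies PU.* The read-out is in a product basis of `P_t ⊗ F_t`, of which
only the result in `P_t` is recorded. For the next step, from `τ` to `τ'`, the environment must be
prepared in the state that it would have without the system. Since `U(⊥,τ) = U(τ,τ')⁻¹ U(⊥,τ')`
acts as a tensor factor both on `F_τ = E ⊗ F_τ'` and on `F_τ'`, its action on `F_τ` is a product `X ⊗ Y`
(`exists_future_product`). Products of square roots of the three factors of the initial
state, transported by `X` and `Y`, therefore give suitable product vectors (`exists_prepVec`), and the
dynamics is divisible (`average_prepVec`).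

*Many unravellings.* Consider the first step at which the state becomes mixed. A conditional state
after this step is proportional to `f(w, v)`, where `f` is sesquilinear, `v` labels the vector
prepared in `E` and `w` the vector found in `P_τ'`; both may be chosen freely. As the average state
is mixed, the values of `f` are not all proportional, and then they contain a whole line
`u₁ + θ u₂`, `θ ∈ ℝ`, with independent `u₁` and `u₂` (`exists_line_of_not_collinear`). So uncountably
many pure states occur in the trajectories of some pure unravelling, whereas each
unravelling has only countably many trajectories: there are infinitely many ensembles
(`infinite_laws`).

*The converse fails.* A system qubit controls a flip (`X`) of the environment qubit at the time `a`
and a phase gate (`Z`) on it at a later time `b`. The first gate dephases the system and the second one does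
nothing more to it, so that re-preparing the environment in its initial state is
harmless, and read-outs in different bases after the first gate give many unravellings. But a qubit
has no non-trivial tensor factorization: under past–future independence either the past or the future
at the time `a` would be trivial, and one of the two gates could not create entanglement
(`evol_product_or`), though both of them do.
-/

noncomputable section

namespace OQS

universe u v w

open ContinuousLinearMap

set_option linter.unusedSectionVars false

/-! ### Calculus in Hilbert-space tensor products -/

section TensorCalculus

variable {A A' : Type u} {B B' : Type v}
  [NormedAddCommGroup A] [InnerProductSpace ℂ A] [NormedAddCommGroup A'] [InnerProductSpace ℂ A']
  [NormedAddCommGroup B] [InnerProductSpace ℂ B] [NormedAddCommGroup B'] [InnerProductSpace ℂ B']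

theorem inner_htmul (a a' : A) (b b' : B) :
    ⟪htmul a b, htmul a' b'⟫_ℂ = ⟪a, a'⟫_ℂ * ⟪b, b'⟫_ℂ := by
  unfold htmul
  rw [UniformSpace.Completion.inner_coe, TensorProduct.inner_tmul]

theorem norm_htmul (a : A) (b : B) : ‖htmul a b‖ = ‖a‖ * ‖b‖ := by
  unfold htmul
  rw [UniformSpace.Completion.norm_coe, TensorProduct.norm_tmul]

theorem enorm_htmul (a : A) (b : B) : ‖htmul a b‖ₑ = ‖a‖ₑ * ‖b‖ₑ := by
  simp only [← ofReal_norm, norm_htmul, ENNReal.ofReal_mul (norm_nonneg _)]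

theorem htmul_add (a : A) (b b' : B) : htmul a (b + b') = htmul a b + htmul a b' :=
  map_add (tmulLeft B a) b b'

theorem add_htmul (a a' : A) (b : B) : htmul (a + a') b = htmul a b + htmul a' b :=
  map_add (tmulRight A b) a a'

theorem htmul_smul (c : ℂ) (a : A) (b : B) : htmul a (c • b) = c • htmul a b :=
  map_smul (tmulLeft B a) c b

theorem smul_htmul (c : ℂ) (a : A) (b : B) : htmul (c • a) b = c • htmul a b :=
  map_smul (tmulRight A b) c a

/-- Bounded operators on a Hilbert-space tensor product that agree on product vectors agree. -/
theorem ext_htmul {C : Type*} [NormedAddCommGroup C] [NormedSpace ℂ C]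
    {f g : HilbertTensor A B →L[ℂ] C} (h : ∀ a b, f (htmul a b) = g (htmul a b)) : f = g := by
  ext x
  refine UniformSpace.Completion.induction_on (p := fun x => f x = g x) x
    (isClosed_eq f.continuous g.continuous) fun y => ?_
  induction y using TensorProduct.induction_on with
  | zero => rw [UniformSpace.Completion.coe_zero, map_zero, map_zero]
  | tmul a b => exact h a b
  | add y z hy hz => rw [UniformSpace.Completion.coe_add, map_add, map_add, hy, hz]

/-- A vector of a Hilbert-space tensor product is determined by its inner products with product
vectors. -/
theorem eq_of_inner_htmul {x y : HilbertTensor A B}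
    (h : ∀ a b, ⟪htmul a b, x⟫_ℂ = ⟪htmul a b, y⟫_ℂ) : x = y := by
  have : innerSL ℂ x = innerSL ℂ y := ext_htmul fun a b => by
    rw [innerSL_apply_apply, innerSL_apply_apply, ← inner_conj_symm, h, inner_conj_symm]
  exact ext_inner_right ℂ fun z => congrArg (fun f => f z) this

theorem tensorOp_comp {A'' : Type u} {B'' : Type v} [NormedAddCommGroup A'']
    [InnerProductSpace ℂ A''] [NormedAddCommGroup B''] [InnerProductSpace ℂ B'']
    (f' : A' →L[ℂ] A'') (f : A →L[ℂ] A') (g' : B' →L[ℂ] B'') (g : B →L[ℂ] B') :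
    tensorOp f' g' ∘L tensorOp f g = tensorOp (f' ∘L f) (g' ∘L g) :=
  ext_htmul fun a b => by simp [tensorOp_htmul]

variable [CompleteSpace A] [CompleteSpace A'] [CompleteSpace B] [CompleteSpace B']

theorem adjoint_tensorOp (f : A →L[ℂ] A') (g : B →L[ℂ] B') :
    adjoint (tensorOp f g) = tensorOp (adjoint f) (adjoint g) := by
  refine ext_htmul fun a b => eq_of_inner_htmul fun a' b' => ?_
  rw [adjoint_inner_right, tensorOp_htmul, tensorOp_htmul, inner_htmul, inner_htmul,
    adjoint_inner_right, adjoint_inner_right]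

/-- Contraction of the first factor with `⟨a|`: the map `⟨a| ⊗ 1`. -/
def ctrL (B : Type v) [NormedAddCommGroup B] [InnerProductSpace ℂ B] [CompleteSpace B] (a : A) :
    HilbertTensor A B →L[ℂ] B := adjoint (tmulLeft B a)

/-- Contraction of the second factor with `⟨b|`: the map `1 ⊗ ⟨b|`. -/
def ctrR (A : Type u) [NormedAddCommGroup A] [InnerProductSpace ℂ A] [CompleteSpace A] (b : B) :
    HilbertTensor A B →L[ℂ] A := adjoint (tmulRight A b)

theorem inner_ctrL (a : A) (b : B) (x : HilbertTensor A B) :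
    ⟪b, ctrL B a x⟫_ℂ = ⟪htmul a b, x⟫_ℂ := by
  rw [ctrL, adjoint_inner_right, tmulLeft_apply]

theorem inner_ctrR (a : A) (b : B) (x : HilbertTensor A B) :
    ⟪a, ctrR A b x⟫_ℂ = ⟪htmul a b, x⟫_ℂ := by
  rw [ctrR, adjoint_inner_right, tmulRight_apply]

theorem ctrL_htmul (a a' : A) (b : B) : ctrL B a (htmul a' b) = ⟪a, a'⟫_ℂ • b :=
  ext_inner_left ℂ fun c => by rw [inner_ctrL, inner_htmul, inner_smul_right]

theorem ctrR_htmul (a : A) (b b' : B) : ctrR A b (htmul a b') = ⟪b, b'⟫_ℂ • a :=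
  ext_inner_left ℂ fun c => by rw [inner_ctrR, inner_htmul, inner_smul_right, mul_comm]

theorem ctrL_tensorOp (a : A) (g : B →L[ℂ] B') (x : HilbertTensor A B) :
    ctrL B' a (tensorOp (ContinuousLinearMap.id ℂ A) g x) = g (ctrL B a x) := by
  have : ctrL B' a ∘L tensorOp (ContinuousLinearMap.id ℂ A) g = g ∘L ctrL B a :=
    ext_htmul fun a b => by simp [tensorOp_htmul, ctrL_htmul]
  exact congrArg (fun f => f x) this

/-- `⟨b + c b'| = ⟨b| + c̄ ⟨b'|`. -/
theorem ctrR_add_smul (b b' : B) (c : ℂ) (x : HilbertTensor A B) :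
    ctrR A (b + c • b') x = ctrR A b x + (starRingEnd ℂ) c • ctrR A b' x :=
  ext_inner_left ℂ fun a => by
    rw [inner_ctrR, htmul_add, htmul_smul, inner_add_left, inner_smul_left, inner_add_right,
      inner_smul_right, inner_ctrR, inner_ctrR]

theorem ctrR_smul (b : B) (c : ℂ) (x : HilbertTensor A B) :
    ctrR A (c • b) x = (starRingEnd ℂ) c • ctrR A b x :=
  ext_inner_left ℂ fun a => by
    rw [inner_ctrR, htmul_smul, inner_smul_left, inner_smul_right, inner_ctrR]

end TensorCalculus

/-! ### Parseval frames in extended nonnegative reals -/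

section Parseval

variable {H : Type u} [NormedAddCommGroup H] [InnerProductSpace ℂ H]

theorem enorm_sq {E : Type*} [SeminormedAddCommGroup E] (x : E) :
    ‖x‖ₑ ^ 2 = ENNReal.ofReal (‖x‖ ^ 2) := by
  rw [← ofReal_norm, ENNReal.ofReal_pow (norm_nonneg _)]

theorem enorm_inner_comm (x y : H) : ‖⟪x, y⟫_ℂ‖ₑ = ‖⟪y, x⟫_ℂ‖ₑ := by
  rw [← ofReal_norm, ← ofReal_norm, norm_inner_symm]

theorem hasSum_norm_sq_iff {E : Type*} [SeminormedAddCommGroup E] {ι : Type*} {f : ι → E} {a : ℝ}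
    (ha : 0 ≤ a) : HasSum (fun i => ‖f i‖ ^ 2) a ↔ ∑' i, ‖f i‖ₑ ^ 2 = ENNReal.ofReal a := by
  simp only [enorm_sq]
  constructor
  · intro h
    rw [← h.tsum_eq, ENNReal.ofReal_tsum_of_nonneg (fun i => by positivity) h.summable]
  · intro h
    have hs : Summable fun i => ‖f i‖ ^ 2 := by
      have := ENNReal.summable_toReal (h.trans_ne ENNReal.ofReal_ne_top)
      simpa [ENNReal.toReal_ofReal] using this
    rw [← ENNReal.ofReal_tsum_of_nonneg (fun i => by positivity) hs,
      ENNReal.ofReal_eq_ofReal_iff (tsum_nonneg fun i => by positivity) ha] at h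
    exact h ▸ hs.hasSum

/-- Parseval's identity. -/
theorem tsum_enorm_inner_basis {ι : Type*} (b : HilbertBasis ι ℂ H) (x : H) :
    ∑' i, ‖⟪b i, x⟫_ℂ‖ₑ ^ 2 = ‖x‖ₑ ^ 2 := by
  rw [enorm_sq, ← hasSum_norm_sq_iff (by positivity)]
  have h := (b.hasSum_inner_mul_inner x x).mapL Complex.reCLM
  rw [Complex.reCLM_apply, ← RCLike.re_to_complex, inner_self_eq_norm_sq] at h
  refine h.congr_fun fun i => ?_
  rw [← inner_conj_symm x, Complex.reCLM_apply, ← Complex.normSq_eq_conj_mul_self,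
    Complex.ofReal_re, Complex.normSq_eq_norm_sq]

theorem tsum_prod_eq {α β : Type*} (f : α × β → ENNReal) :
    ∑' p, f p = ∑' a, ∑' b, f (a, b) := ENNReal.tsum_prod'

theorem exists_basis_mem [CompleteSpace H] {x : H} (hx : ‖x‖ = 1) :
    ∃ (w : Set H) (b : HilbertBasis w ℂ H) (i : w), b i = x := by
  have : Orthonormal ℂ (Subtype.val : ({x} : Set H) → H) := by
    refine ⟨fun i => by rw [i.2, hx], fun i j hij => absurd (Subsingleton.elim i j) hij⟩
  obtain ⟨w, b, hw, hb⟩ := this.exists_hilbertBasis_extension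
  exact ⟨w, b, ⟨x, hw rfl⟩, by rw [hb]⟩

end Parseval

section TensorBasis

variable {A : Type u} {B : Type v}
  [NormedAddCommGroup A] [InnerProductSpace ℂ A] [NormedAddCommGroup B] [InnerProductSpace ℂ B]
  [CompleteSpace A] [CompleteSpace B] {ι κ : Type*}

theorem tsum_enorm_inner_htmul_basis (b : HilbertBasis κ ℂ B) (x : A) (Ω : HilbertTensor A B) :
    ∑' k, ‖⟪htmul x (b k), Ω⟫_ℂ‖ₑ ^ 2 = ‖ctrL B x Ω‖ₑ ^ 2 := by
  simp only [← inner_ctrL, tsum_enorm_inner_basis]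

/-- The tensor product of two Hilbert bases. -/
def tensorBasis (a : HilbertBasis ι ℂ A) (b : HilbertBasis κ ℂ B) :
    HilbertBasis (ι × κ) ℂ (HilbertTensor A B) :=
  HilbertBasis.mkOfOrthogonalEqBot (v := fun p : ι × κ => htmul (a p.1) (b p.2))
    (by
      classical
      rw [orthonormal_iff_ite]
      intro p q
      rw [inner_htmul, orthonormal_iff_ite.mp a.orthonormal, orthonormal_iff_ite.mp b.orthonormal]
      simp only [Prod.ext_iff, ite_and, ite_mul, one_mul, zero_mul])
    (by
      rw [Submodule.eq_bot_iff]
      intro Ω hΩ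
      have h0 : ∀ i k, ⟪htmul (a i) (b k), Ω⟫_ℂ = 0 := fun i k =>
        hΩ _ (Submodule.subset_span ⟨(i, k), rfl⟩)
      have h1 : ∀ i y, ⟪htmul (a i) y, Ω⟫_ℂ = 0 := fun i y => by
        have : ctrL B (a i) Ω = 0 := by
          rw [← enorm_eq_zero, ← pow_eq_zero_iff two_ne_zero, ← tsum_enorm_inner_htmul_basis b]
          simp [h0]
        rw [← inner_ctrL, this, inner_zero_right]
      refine eq_of_inner_htmul fun x y => ?_
      have : ctrR A y Ω = 0 := by
        rw [← enorm_eq_zero, ← pow_eq_zero_iff two_ne_zero, ← tsum_enorm_inner_basis a]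
        simp [inner_ctrR, h1]
      rw [← inner_ctrR, this, inner_zero_right, inner_zero_right])

theorem tensorBasis_apply (a : HilbertBasis ι ℂ A) (b : HilbertBasis κ ℂ B) (p : ι × κ) :
    tensorBasis a b p = htmul (a p.1) (b p.2) := by
  rw [tensorBasis, HilbertBasis.coe_mkOfOrthogonalEqBot]

/-- The image of a Hilbert basis under a unitary. -/
def mapBasis {H H' : Type*} [NormedAddCommGroup H] [InnerProductSpace ℂ H]
    [NormedAddCommGroup H'] [InnerProductSpace ℂ H'] (b : HilbertBasis ι ℂ H) (W : H ≃ₗᵢ[ℂ] H') :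
    HilbertBasis ι ℂ H' := HilbertBasis.ofRepr (W.symm.trans b.repr)

theorem mapBasis_apply {H H' : Type*} [NormedAddCommGroup H] [InnerProductSpace ℂ H]
    [NormedAddCommGroup H'] [InnerProductSpace ℂ H'] (b : HilbertBasis ι ℂ H) (W : H ≃ₗᵢ[ℂ] H')
    (i : ι) : mapBasis b W i = W (b i) := by
  classical
  rw [← HilbertBasis.repr_symm_single, ← HilbertBasis.repr_symm_single]
  rfl

end TensorBasis

/-! ### Pure-state ensembles of positive trace-class operators -/

section Ensembles

variable {H : Type*} [NormedAddCommGroup H] [InnerProductSpace ℂ H] [CompleteSpace H]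
  {H' : Type*} [NormedAddCommGroup H'] [InnerProductSpace ℂ H'] [CompleteSpace H']
  {ι κ : Type*}

/-- `X = ∑ᵢ |vᵢ⟩⟨vᵢ|` with `∑ᵢ ‖vᵢ‖² < ∞`: a family of unnormalized vectors representing the positive
trace-class operator `X`. -/
def IsEnsemble (X : H →L[ℂ] H) (v : ι → H) : Prop :=
  ∑' i, ‖v i‖ₑ ^ 2 ≠ ⊤ ∧ HasSum (fun i => ketbra (v i)) X

theorem ketbra_apply (v x : H) : ketbra v x = ⟪v, x⟫_ℂ • v := rfl

theorem norm_ketbra (v : H) : ‖ketbra v‖ = ‖v‖ ^ 2 := by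
  rw [ketbra, InnerProductSpace.norm_rankOne, sq]

theorem inner_ketbra (v x : H) : ⟪x, ketbra v x⟫_ℂ = ((‖⟪x, v⟫_ℂ‖ ^ 2 : ℝ) : ℂ) := by
  rw [ketbra_apply, inner_smul_right, ← inner_conj_symm v x, ← Complex.normSq_eq_conj_mul_self,
    Complex.normSq_eq_norm_sq]

theorem conj_ketbra (K : H →L[ℂ] H') (v : H) :
    K ∘L ketbra v ∘L adjoint K = ketbra (K v) := by
  ext x
  simp [ketbra_apply, adjoint_inner_right]

theorem ketbra_smul (c : ℂ) (v : H) : ketbra (c • v) = ((‖c‖ ^ 2 : ℝ) : ℂ) • ketbra v := by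
  ext x
  rw [ketbra_apply, smul_apply, ketbra_apply, inner_smul_left, smul_smul, smul_smul,
    ← Complex.normSq_eq_norm_sq, Complex.normSq_eq_conj_mul_self]
  ring_nf

/-- Two families with the same second moments have the same second moments after any bounded
operator. -/
theorem tsum_enorm_map_eq {v : ι → H} {w : κ → H}
    (h : ∀ x, ∑' j, ‖⟪x, w j⟫_ℂ‖ₑ ^ 2 = ∑' i, ‖⟪x, v i⟫_ℂ‖ₑ ^ 2) (K : H →L[ℂ] H') :
    ∑' j, ‖K (w j)‖ₑ ^ 2 = ∑' i, ‖K (v i)‖ₑ ^ 2 := by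
  simp only [← tsum_enorm_inner_basis (basis H')]
  rw [ENNReal.tsum_comm, ENNReal.tsum_comm (α := ι)]
  simp only [← adjoint_inner_left, h]

theorem summable_ketbra {v : ι → H} (h : ∑' i, ‖v i‖ₑ ^ 2 ≠ ⊤) :
    Summable fun i => ketbra (v i) := by
  refine Summable.of_norm ?_
  have := ENNReal.summable_toReal h
  simpa [norm_ketbra] using this

namespace IsEnsemble

theorem inner_eq {X : H →L[ℂ] H} {v : ι → H} (h : IsEnsemble X v) (x : H) :
    ⟪x, X x⟫_ℂ = ((∑' i, ‖⟪x, v i⟫_ℂ‖ₑ ^ 2).toReal : ℂ) := by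
  have h1 : HasSum (fun i => ⟪x, ketbra (v i) x⟫_ℂ) ⟪x, X x⟫_ℂ :=
    h.2.mapL (innerSL ℂ x ∘L (ContinuousLinearMap.apply ℂ H x))
  simp only [inner_ketbra] at h1
  rw [← h1.tsum_eq, ← Complex.ofReal_tsum, ENNReal.tsum_toReal_eq]
  · simp
  · intro i
    simp

theorem tsum_inner_ne_top {X : H →L[ℂ] H} {v : ι → H} (h : IsEnsemble X v) (x : H) :
    ∑' i, ‖⟪x, v i⟫_ℂ‖ₑ ^ 2 ≠ ⊤ := by
  refine ne_top_of_le_ne_top (b := ‖x‖ₑ ^ 2 * ∑' i, ‖v i‖ₑ ^ 2)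
    (ENNReal.mul_ne_top (by simp) h.1) ?_
  rw [← ENNReal.tsum_mul_left]
  refine ENNReal.tsum_le_tsum fun i => ?_
  rw [← mul_pow]
  gcongr
  simp only [← ofReal_norm]
  rw [← ENNReal.ofReal_mul (norm_nonneg _)]
  exact ENNReal.ofReal_le_ofReal (norm_inner_le_norm _ _)

theorem enorm_inner_eq {X : H →L[ℂ] H} {v : ι → H} (h : IsEnsemble X v) (x : H) :
    ∑' i, ‖⟪x, v i⟫_ℂ‖ₑ ^ 2 = ‖⟪x, X x⟫_ℂ‖ₑ := by
  rw [h.inner_eq, ← ofReal_norm, Complex.norm_of_nonneg ENNReal.toReal_nonneg,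
    ENNReal.ofReal_toReal (h.tsum_inner_ne_top x)]

/-- An ensemble may be replaced by any family with the same second moments. -/
theorem of_moments {X : H →L[ℂ] H} {v : ι → H} (h : IsEnsemble X v) {w : κ → H}
    (hw : ∀ x, ∑' j, ‖⟪x, w j⟫_ℂ‖ₑ ^ 2 = ∑' i, ‖⟪x, v i⟫_ℂ‖ₑ ^ 2) : IsEnsemble X w := by
  have h1 : ∑' j, ‖w j‖ₑ ^ 2 ≠ ⊤ := by
    have := tsum_enorm_map_eq hw (ContinuousLinearMap.id ℂ H)
    simp only [ContinuousLinearMap.id_apply] at this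
    rw [this]
    exact h.1
  obtain ⟨Y, hY⟩ := summable_ketbra h1
  have hY' : IsEnsemble Y w := ⟨h1, hY⟩
  have : Y = X := by
    refine ContinuousLinearMap.coe_injective ((ext_inner_map _ _).1 fun x => ?_)
    rw [← inner_conj_symm, ← inner_conj_symm (X.toLinearMap x)]
    congr 1
    simp only [coe_coe]
    rw [h.inner_eq, hY'.inner_eq, hw]
  exact this ▸ hY'

theorem moments_eq {X : H →L[ℂ] H} {v : ι → H} (h : IsEnsemble X v) {w : κ → H}
    (hw : IsEnsemble X w) (x : H) :
    ∑' j, ‖⟪x, w j⟫_ℂ‖ₑ ^ 2 = ∑' i, ‖⟪x, v i⟫_ℂ‖ₑ ^ 2 := by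
  rw [h.enorm_inner_eq, hw.enorm_inner_eq]

theorem single (v : H) : IsEnsemble (ketbra v) (fun _ : PUnit.{w+1} => v) :=
  ⟨by simp, by simp⟩

theorem unique {X Y : H →L[ℂ] H} {v : ι → H} (h : IsEnsemble X v) (h' : IsEnsemble Y v) : X = Y :=
  h.2.unique h'.2

theorem hasSum_conj {X : H →L[ℂ] H} {v : ι → H} (h : IsEnsemble X v) (K : H →L[ℂ] H') :
    HasSum (fun i => ketbra (K (v i))) (K ∘L X ∘L adjoint K) := by
  have := h.2.mapL ((compL ℂ H' H H' K) ∘L ((compL ℂ H' H H).flip (adjoint K)))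
  simpa [conj_ketbra] using this

theorem conj {X : H →L[ℂ] H} {v : ι → H} (h : IsEnsemble X v) (K : H →L[ℂ] H') :
    IsEnsemble (K ∘L X ∘L adjoint K) (fun i => K (v i)) := by
  refine ⟨?_, h.hasSum_conj K⟩
  refine ne_top_of_le_ne_top (b := ‖K‖ₑ ^ 2 * ∑' i, ‖v i‖ₑ ^ 2)
    (ENNReal.mul_ne_top (by simp) h.1) ?_
  rw [← ENNReal.tsum_mul_left]
  refine ENNReal.tsum_le_tsum fun i => ?_
  rw [← mul_pow]
  gcongr
  exact K.le_opENorm _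

/-- The image of an ensemble under a completely positive, trace-nonincreasing map. -/
theorem kraus {X : H →L[ℂ] H} {v : ι → H} (h : IsEnsemble X v) (K : κ → H →L[ℂ] H')
    (hK : ∀ x, ∑' k, ‖K k x‖ₑ ^ 2 ≤ ‖x‖ₑ ^ 2) :
    IsEnsemble (∑' k, K k ∘L X ∘L adjoint (K k)) (fun p : κ × ι => K p.1 (v p.2)) := by
  have h1 : ∑' p : κ × ι, ‖K p.1 (v p.2)‖ₑ ^ 2 ≠ ⊤ := by
    rw [tsum_prod_eq, ENNReal.tsum_comm]
    exact ne_top_of_le_ne_top h.1 (ENNReal.tsum_le_tsum fun i => hK _)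
  refine ⟨h1, ?_⟩
  have h2 := summable_ketbra h1
  rw [(h2.hasSum.prod_fiberwise fun k => h.hasSum_conj (K k)).tsum_eq]
  exact h2.hasSum

theorem unitaryConj {X : H →L[ℂ] H} {v : ι → H} (h : IsEnsemble X v) (W : H ≃ₗᵢ[ℂ] H) :
    IsEnsemble (unitaryConj W X) (fun i => W (v i)) := by
  have := h.conj (W : H →L[ℂ] H)
  rwa [LinearIsometryEquiv.adjoint_eq_symm] at this

theorem trace_eq {X : H →L[ℂ] H} {v : ι → H} (h : IsEnsemble X v) :
    trace X = ((∑' i, ‖v i‖ₑ ^ 2).toReal : ℂ) := by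
  unfold trace
  have h1 : ∑' i, ‖v i‖ₑ ^ 2 = ∑' k, ∑' i, ‖⟪basis H k, v i⟫_ℂ‖ₑ ^ 2 := by
    rw [ENNReal.tsum_comm]
    simp only [tsum_enorm_inner_basis]
  simp only [h.inner_eq]
  rw [h1, ENNReal.tsum_toReal_eq (fun k => h.tsum_inner_ne_top _), Complex.ofReal_tsum]

/-- An operator with an ensemble in a single ray, and of unit trace, is a pure state. -/
theorem isPure {X : H →L[ℂ] H} {v : ι → H} (h : IsEnsemble X v) (h1 : ∑' i, ‖v i‖ₑ ^ 2 = 1)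
    {x : H} {c : ι → ℂ} (hv : ∀ i, v i = c i • x) : IsPure X := by
  have h2 : HasSum (fun i => ‖v i‖ ^ 2) 1 :=
    (hasSum_norm_sq_iff zero_le_one).2 (by rw [h1, ENNReal.ofReal_one])
  simp only [hv, norm_smul, mul_pow] at h2
  have hx : ‖x‖ ^ 2 ≠ 0 := by
    intro hx
    simp only [hx, mul_zero] at h2
    exact zero_ne_one (hasSum_zero.unique h2)
  have h3 : HasSum (fun i => ‖c i‖ ^ 2) ((‖x‖ ^ 2)⁻¹) := by
    have := h2.mul_right (‖x‖ ^ 2)⁻¹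
    simpa [mul_assoc, mul_inv_cancel₀ hx] using this
  have h4 : X = (((‖x‖ ^ 2)⁻¹ : ℝ) : ℂ) • ketbra x := by
    refine h.2.unique ?_
    simp only [hv, ketbra_smul]
    exact (h3.mapL Complex.ofRealCLM).smul_const (ketbra x)
  have hx' : ‖x‖ ≠ 0 := fun h => hx (by simp [h])
  refine ⟨((‖x‖⁻¹ : ℝ) : ℂ) • x, ?_, ?_⟩
  · rw [norm_smul, Complex.norm_real, norm_inv, norm_norm, inv_mul_cancel₀ hx']
  · rw [h4, ketbra_smul, Complex.norm_real, norm_inv, norm_norm, inv_pow]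

/-- The members of an ensemble of a pure state are all proportional to its state vector. -/
theorem mem_span_of_ketbra {x : H} {v : ι → H} (h : IsEnsemble (ketbra x) v) (hx : ‖x‖ = 1)
    (i : ι) : v i = ⟪x, v i⟫_ℂ • x := by
  have h1 : ∀ y, ⟪y, x⟫_ℂ = 0 → ⟪y, v i⟫_ℂ = 0 := by
    intro y hy
    have := h.enorm_inner_eq y
    rw [ketbra_apply, inner_smul_right, hy, mul_zero, enorm_zero, ENNReal.tsum_eq_zero] at this
    simpa using this i
  have h2 : ⟪v i - ⟪x, v i⟫_ℂ • x, x⟫_ℂ = 0 := by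
    rw [inner_sub_left, inner_smul_left, inner_self_eq_norm_sq_to_K, hx, inner_conj_symm]
    simp
  have h3 := h1 _ h2
  rw [← sub_eq_zero, ← inner_self_eq_zero (𝕜 := ℂ)]
  rw [inner_sub_right, inner_smul_right, h2, h3]
  simp

end IsEnsemble

theorem IsState.exists_sqrt {ρ : H →L[ℂ] H} (hρ : IsState ρ) :
    ∃ S : H →L[ℂ] H, (∀ x y, ⟪S x, y⟫_ℂ = ⟪x, S y⟫_ℂ) ∧ ∀ x, S (S x) = ρ x := by
  have h0 := (nonneg_iff_isPositive _).2 hρ.1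
  have hsa : adjoint (CFC.sqrt ρ) = CFC.sqrt ρ :=
    ((nonneg_iff_isPositive _).1 (CFC.sqrt_nonneg ρ)).isSelfAdjoint
  have hsq : CFC.sqrt ρ ∘L CFC.sqrt ρ = ρ := CFC.sqrt_mul_sqrt_self ρ h0
  exact ⟨CFC.sqrt ρ, fun x y => by rw [← adjoint_inner_right, hsa],
    fun x => congrArg (fun f => f x) hsq⟩

/-- If `S` is a self-adjoint square root of the state `ρ`, then the vectors `S bᵢ` are an ensemble of
`ρ`, for every orthonormal basis `b`. -/
theorem IsState.isEnsemble_sqrt {ρ S : H →L[ℂ] H} (hρ : IsState ρ)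
    (h1 : ∀ x y, ⟪S x, y⟫_ℂ = ⟪x, S y⟫_ℂ) (h2 : ∀ x, S (S x) = ρ x) (b : HilbertBasis κ ℂ H) :
    IsEnsemble ρ (fun k => S (b k)) ∧ ∑' k, ‖S (b k)‖ₑ ^ 2 = 1 := by
  have h3 : ∀ x, ⟪x, ρ x⟫_ℂ = ((‖S x‖ ^ 2 : ℝ) : ℂ) := fun x => by
    rw [← h2, ← h1, inner_self_eq_norm_sq_to_K]
    norm_cast
  have h4 : ∑' k, ‖S (basis H k)‖ₑ ^ 2 = 1 := by
    have ht := hρ.2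
    unfold trace at ht
    simp only [h3] at ht
    rw [← Complex.ofReal_tsum] at ht
    norm_cast at ht
    -- a divergent series would have the junk value `0`, which is not `1`
    have hs : Summable fun k => ‖S (basis H k)‖ ^ 2 := by
      by_contra hs
      rw [tsum_eq_zero_of_not_summable hs] at ht
      exact zero_ne_one ht
    rw [(hasSum_norm_sq_iff zero_le_one).1 (ht ▸ hs.hasSum), ENNReal.ofReal_one]
  have h6 : ∑' k, ‖S (b k)‖ₑ ^ 2 = 1 := by
    rw [← h4]
    simpa using tsum_enorm_map_eq (v := fun k => S (basis H k)) (w := fun k => S (b k))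
      (fun x => by
        simp only [enorm_inner_comm x, h1, tsum_enorm_inner_basis]) (ContinuousLinearMap.id ℂ H)
  refine ⟨⟨by simp [h6], ?_⟩, h6⟩
  obtain ⟨Y, hY⟩ := summable_ketbra (v := fun k => S (b k)) (by simp [h6])
  have hY' : IsEnsemble Y (fun k => S (b k)) := ⟨by simp [h6], hY⟩
  have : Y = ρ := by
    refine ContinuousLinearMap.coe_injective ((ext_inner_map _ _).1 fun x => ?_)
    rw [← inner_conj_symm, ← inner_conj_symm (ρ.toLinearMap x)]
    congr 1
    simp only [coe_coe]
    rw [hY'.inner_eq, h3]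
    simp only [enorm_inner_comm x, h1, tsum_enorm_inner_basis]
    simp
  exact this ▸ hY

theorem IsState.exists_norm_eq_one {ρ : H →L[ℂ] H} (hρ : IsState ρ) : ∃ x : H, ‖x‖ = 1 := by
  obtain ⟨S, h1, h2⟩ := hρ.exists_sqrt
  have h3 := (hρ.isEnsemble_sqrt h1 h2 (basis H)).2
  have h4 : ∃ i : basisSet H, True := by
    by_contra! h
    have : IsEmpty (basisSet H) := ⟨fun i => (h i).elim⟩
    simp at h3
  exact h4.elim fun i _ => ⟨basis H i, (basis H).orthonormal.1 i⟩

end Ensembles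

section TensorEnsembles

variable {A : Type u} {B : Type v}
  [NormedAddCommGroup A] [InnerProductSpace ℂ A] [NormedAddCommGroup B] [InnerProductSpace ℂ B]
  [CompleteSpace A] [CompleteSpace B] {ι κ : Type*}

theorem tsum_enorm_ctrR_basis (b : HilbertBasis κ ℂ B) (Ω : HilbertTensor A B) :
    ∑' k, ‖ctrR A (b k) Ω‖ₑ ^ 2 = ‖Ω‖ₑ ^ 2 := by
  simp only [← tsum_enorm_inner_basis (basis A), inner_ctrR]
  rw [ENNReal.tsum_comm, ← tsum_prod_eq (fun p => ‖⟪htmul (basis A p.1) (b p.2), Ω⟫_ℂ‖ₑ ^ 2),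
    ← tsum_enorm_inner_basis (tensorBasis (basis A) b)]
  simp only [tensorBasis_apply]

/-- A Parseval frame of the second factor contracts isometrically. -/
theorem tsum_enorm_ctrR_frame {f : κ → B} (hf : ∀ x, ∑' k, ‖⟪f k, x⟫_ℂ‖ₑ ^ 2 = ‖x‖ₑ ^ 2)
    (Ω : HilbertTensor A B) : ∑' k, ‖ctrR A (f k) Ω‖ₑ ^ 2 = ‖Ω‖ₑ ^ 2 := by
  rw [← tsum_enorm_ctrR_basis (basis B)]
  simp only [← tsum_enorm_inner_basis (basis A), inner_ctrR]
  rw [ENNReal.tsum_comm, ENNReal.tsum_comm (α := basisSet B)]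
  simp only [← inner_ctrL, hf, tsum_enorm_inner_basis]

theorem IsEnsemble.partialTrace {X : HilbertTensor A B →L[ℂ] HilbertTensor A B}
    {v : ι → HilbertTensor A B} (h : IsEnsemble X v) :
    IsEnsemble (partialTrace X) (fun p : basisSet B × ι => ctrR A (basis B p.1) (v p.2)) := by
  have := h.kraus (fun k => ctrR A (basis B k)) (fun x => (tsum_enorm_ctrR_basis _ x).le)
  simp only [ctrR, adjoint_adjoint] at this
  exact this

theorem tsum_enorm_inner_ctrR (x : A) (v : ι → HilbertTensor A B) :
    ∑' p : basisSet B × ι, ‖⟪x, ctrR A (basis B p.1) (v p.2)⟫_ℂ‖ₑ ^ 2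
      = ∑' i, ‖ctrL B x (v i)‖ₑ ^ 2 := by
  rw [tsum_prod_eq, ENNReal.tsum_comm]
  simp only [inner_ctrR, tsum_enorm_inner_htmul_basis]

theorem IsEnsemble.tensor_ketbra {ρ : B →L[ℂ] B} {z : ι → B} (h : IsEnsemble ρ z) (ψ : A) :
    IsEnsemble (tensorOp (ketbra ψ) ρ) (fun i => htmul ψ (z i)) := by
  have : tensorOp (ketbra ψ) ρ = tmulLeft B ψ ∘L ρ ∘L adjoint (tmulLeft B ψ) := by
    refine ext_htmul fun a b => ?_
    have : adjoint (tmulLeft B ψ) (htmul a b) = ⟪ψ, a⟫_ℂ • b := ctrL_htmul ψ a b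
    simp only [tensorOp_htmul, comp_apply, this, ketbra_apply, map_smul, smul_htmul,
      tmulLeft_apply]
  rw [this]
  exact h.conj (tmulLeft B ψ)

end TensorEnsembles

/-! ### Measurements that read out and re-prepare the environment -/

section Repreparation

/-- A rank-one measurement, given by a Parseval frame `b a g` of which only the label `a` is
recorded. -/
structure Readout (H : Type v) [NormedAddCommGroup H] [InnerProductSpace ℂ H] (A : Type v) where
  G : Type v
  b : A → G → H
  parseval : ∀ x, ∑' p : A × G, ‖⟪b p.1 p.2, x⟫_ℂ‖ₑ ^ 2 = ‖x‖ₑ ^ 2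

variable {Hs : Type u} [NormedAddCommGroup Hs] [InnerProductSpace ℂ Hs] [CompleteSpace Hs]
  {He : Type v} [NormedAddCommGroup He] [InnerProductSpace ℂ He] [CompleteSpace He]

theorem tensorOp_rankOne (z b : He) (Ω : HilbertTensor Hs He) :
    tensorOp (ContinuousLinearMap.id ℂ Hs) (InnerProductSpace.rankOne ℂ z b) Ω
      = htmul (ctrR Hs b Ω) z := by
  have : tensorOp (ContinuousLinearMap.id ℂ Hs) (InnerProductSpace.rankOne ℂ z b)
      = tmulRight Hs z ∘L ctrR Hs b :=
    ext_htmul fun s e => by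
      simp [tensorOp_htmul, ctrR_htmul, tmulRight_apply, htmul_smul]
  exact congrArg (fun f => f Ω) this

variable {A ι : Type v}

/-- The measurement with Kraus operators `|z_c⟩⟨b_{a,g}|`, where `(a, c)` is the result: the
environment is read out in the frame `b` and then prepared in the random state `z_c`. -/
def reprepare (B : Readout He A) (z : ι → He) (hz : ∑' c, ‖z c‖ₑ ^ 2 = 1) :
    Measurement He (A × ι) where
  κ := B.G
  K r g := InnerProductSpace.rankOne ℂ (z r.2) (B.b r.1 g)
  complete x := by
    rw [hasSum_norm_sq_iff (by positivity), ← enorm_sq]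
    simp only [InnerProductSpace.rankOne_apply, enorm_smul, mul_pow]
    rw [tsum_prod_eq, tsum_prod_eq]
    simp only [ENNReal.tsum_mul_right]
    simp only [ENNReal.tsum_mul_left, hz, mul_one]
    rw [← tsum_prod_eq (fun p : A × B.G => ‖⟪B.b p.1 p.2, x⟫_ℂ‖ₑ ^ 2), B.parseval]

/-- The measurement scheme that at time `t_j` reads out in the frame `B j` and prepares `z j`. -/
abbrev repreparationScheme (B : ℕ → Readout He A) (z : ℕ → ι → He)
    (hz : ∀ j, ∑' c, ‖z j c‖ₑ ^ 2 = 1) : MeasurementScheme He where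
  R := A × ι
  meas past := reprepare (B past.length) (z past.length) (hz past.length)

theorem Readout.tsum_ctrR_le (B : Readout He A) (a : A) (Ω : HilbertTensor Hs He) :
    ∑' g, ‖ctrR Hs (B.b a g) Ω‖ₑ ^ 2 ≤ ‖Ω‖ₑ ^ 2 := by
  rw [← tsum_enorm_ctrR_frame B.parseval Ω, tsum_prod_eq]
  exact ENNReal.le_tsum (f := fun a => ∑' g, ‖ctrR Hs (B.b a g) Ω‖ₑ ^ 2) a

theorem Readout.tsum_inner_htmul (B : Readout He A) (x : Hs) (Ω : HilbertTensor Hs He) :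
    ∑' a, ∑' g, ‖⟪htmul x (B.b a g), Ω⟫_ℂ‖ₑ ^ 2 = ‖ctrL He x Ω‖ₑ ^ 2 := by
  simp only [← inner_ctrL]
  rw [← tsum_prod_eq (fun p : A × B.G => ‖⟪B.b p.1 p.2, ctrL He x Ω⟫_ℂ‖ₑ ^ 2), B.parseval]

theorem enorm_ofReal_norm {E : Type*} [SeminormedAddCommGroup E] (x : E) :
    ‖((‖x‖ : ℝ) : ℂ)‖ₑ = ‖x‖ₑ := by
  rw [← ofReal_norm, Complex.norm_real, norm_norm, ofReal_norm]

theorem enorm_sq_le_one {z : ι → He} (hz : ∑' c, ‖z c‖ₑ ^ 2 = 1) (c : ι) : ‖z c‖ₑ ^ 2 ≤ 1 :=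
  hz ▸ ENNReal.le_tsum c

/-- If the vectors obtained by contraction with the frame vectors of label `a` have the second
moments of a single vector `s`, then the result `(a, c)` leaves the joint state `s ⊗ z_c`. -/
theorem afterResult_eq_ketbra {B : ℕ → Readout He A} {z : ℕ → ι → He}
    {hz : ∀ j, ∑' c, ‖z j c‖ₑ ^ 2 = 1} {κ : Type*} (l : List (A × ι)) (a : A) (c : ι)
    {σ : HilbertTensor Hs He →L[ℂ] HilbertTensor Hs He} {Ω : κ → HilbertTensor Hs He}
    (hσ : IsEnsemble σ Ω) {s : Hs}
    (hs : ∀ x, ∑' g, ∑' i, ‖⟪htmul x ((B l.length).b a g), Ω i⟫_ℂ‖ₑ ^ 2 = ‖⟪x, s⟫_ℂ‖ₑ ^ 2) :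
    OpenSystem.afterResult (repreparationScheme B z hz) l (a, c) σ
      = ketbra (htmul s (z l.length c)) := by
  have h1 := hσ.kraus (fun g => tensorOp (ContinuousLinearMap.id ℂ Hs)
    (InnerProductSpace.rankOne ℂ (z l.length c) ((B l.length).b a g))) (fun Ω => by
      simp only [tensorOp_rankOne, enorm_htmul, mul_pow, ENNReal.tsum_mul_right]
      calc _ ≤ ‖Ω‖ₑ ^ 2 * 1 :=
            mul_le_mul' (Readout.tsum_ctrR_le _ _ _) (enorm_sq_le_one (hz _) c)
        _ = _ := mul_one _)
  refine (h1.of_moments (w := fun _ : PUnit.{1} => htmul s (z l.length c)) fun Ξ => ?_).unique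
    (IsEnsemble.single _)
  simp only [tensorOp_rankOne, ← inner_ctrR, enorm_inner_comm Ξ]
  rw [tsum_prod_eq]
  have h2 := hs (ctrR Hs (z l.length c) Ξ)
  simp only [← inner_ctrR, enorm_inner_comm (ctrR Hs (z l.length c) Ξ)] at h2
  simpa using h2.symm

/-- The data of pure unravellings of `D` for the times `t₀, …, t_n`: at `t_j` the environment is read
out in the frame `B j` and prepared in the ensemble `z j`. The result `a'` at `t_{j+1}`, after
`z j c` has been prepared at `t_j`, changes the system vector `s` to `L j c a' s`. -/
structure Repreparation {T : Type w} [LinearOrder T] [OrderBot T] (D : OpenSystem T Hs He)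
    (n : ℕ) (t : ℕ → T) where
  A : Type v
  ι : Type v
  B : ℕ → Readout He A
  z : ℕ → ι → He
  L : ℕ → ι → A → Hs → Hs
  tsum_z : ∀ j, ∑' c, ‖z j c‖ₑ ^ 2 = 1
  /-- The initial ensemble represents the initial environment state. -/
  init : IsEnsemble D.ρe (z 0)
  /-- The part of the read-out that is not recorded does not correlate with the system. -/
  pure : ∀ j < n, ∀ c a' s x,
    ∑' g, ‖⟪htmul x ((B (j + 1)).b a' g), D.evol (t j) (t (j + 1)) (htmul s (z j c))⟫_ℂ‖ₑ ^ 2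
      = ‖⟪x, L j c a' s⟫_ℂ‖ₑ ^ 2
  /-- The dynamical map is divisible: between `t_j` and `t_{j+1}` the system evolves as if the
  environment had been newly prepared at `t_j`. -/
  average : ∀ j < n, ∀ ψ : Hs, ‖ψ‖ = 1 → ∀ {κ : Type v} (s : κ → Hs),
    IsEnsemble (D.dynMap (t j) (ketbra ψ)) s →
    ∀ x, ∑' k, ∑' c, ‖ctrL He x (D.evol (t j) (t (j + 1)) (htmul (s k) (z j c)))‖ₑ ^ 2
      = ‖⟪x, D.dynMap (t (j + 1)) (ketbra ψ) x⟫_ℂ‖ₑ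

variable {T : Type w} [LinearOrder T] [OrderBot T] {D : OpenSystem T Hs He}

theorem isEnsemble_dynMap {κ : Type*} {z : κ → He} (hz : IsEnsemble D.ρe z) (τ : T) (ψ : Hs) :
    IsEnsemble (D.dynMap τ (ketbra ψ))
      (fun p : basisSet He × κ => ctrR Hs (basis He p.1) (D.U τ (htmul ψ (z p.2)))) :=
  ((hz.tensor_ketbra ψ).unitaryConj (D.U τ)).partialTrace

theorem enorm_inner_dynMap {κ : Type*} {z : κ → He} (hz : IsEnsemble D.ρe z) (τ : T) (ψ x : Hs) :
    ‖⟪x, D.dynMap τ (ketbra ψ) x⟫_ℂ‖ₑ = ∑' c, ‖ctrL He x (D.U τ (htmul ψ (z c)))‖ₑ ^ 2 := by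
  rw [← (isEnsemble_dynMap hz τ ψ).enorm_inner_eq,
    tsum_enorm_inner_ctrR x (fun c => D.U τ (htmul ψ (z c)))]

theorem tsum_isEnsemble_dynMap {κ κ' : Type*} {z : κ → He} (hz : IsEnsemble D.ρe z)
    (h1 : ∑' c, ‖z c‖ₑ ^ 2 = 1) {τ : T} {ψ : Hs} (hψ : ‖ψ‖ = 1) {s : κ' → Hs}
    (hs : IsEnsemble (D.dynMap τ (ketbra ψ)) s) : ∑' k, ‖s k‖ₑ ^ 2 = 1 := by
  have := tsum_enorm_map_eq (fun x => (isEnsemble_dynMap hz τ ψ).moments_eq hs x)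
    (ContinuousLinearMap.id ℂ Hs)
  simp only [ContinuousLinearMap.id_apply] at this
  rw [this, tsum_prod_eq, ENNReal.tsum_comm]
  simp only [tsum_enorm_ctrR_basis]
  have h2 : ∀ c, ‖D.U τ (htmul ψ (z c))‖ₑ = ‖z c‖ₑ := fun c => by
    rw [← ofReal_norm, LinearIsometryEquiv.norm_map, norm_htmul, hψ, one_mul, ofReal_norm]
  simp only [h2, h1]

theorem dynMap_bot {κ : Type*} {z : κ → He} (hz : IsEnsemble D.ρe z)
    (h1 : ∑' c, ‖z c‖ₑ ^ 2 = 1) (ψ : Hs) : D.dynMap ⊥ (ketbra ψ) = ketbra ψ := by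
  refine ((isEnsemble_dynMap hz ⊥ ψ).of_moments (w := fun _ : PUnit.{1} => ψ) fun x => ?_).unique
    (IsEnsemble.single ψ)
  rw [(isEnsemble_dynMap hz ⊥ ψ).enorm_inner_eq, enorm_inner_dynMap hz, D.U_bot]
  simp [ctrL_htmul, enorm_smul, mul_pow, ENNReal.tsum_mul_left, h1]

/-- Records of length `j + 1` consist of the last result and a record of length `j`. -/
def recordEquiv (R : Type v) (j : ℕ) :
    {l : List R // l.length = j + 1} ≃ R × {l : List R // l.length = j} where
  toFun l := (l.1.head (List.ne_nil_of_length_eq_add_one l.2), ⟨l.1.tail, by simp [l.2]⟩)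
  invFun p := ⟨p.1 :: p.2.1, by simp [p.2.2]⟩
  left_inv l := by simp
  right_inv p := by simp

theorem tsum_record_succ {R : Type v} (j : ℕ) (f : List R → ENNReal) :
    ∑' l : {l : List R // l.length = j + 1}, f l.1
      = ∑' r, ∑' l : {l : List R // l.length = j}, f (r :: l.1) := by
  rw [← (recordEquiv R j).symm.tsum_eq, tsum_prod_eq]
  rfl

theorem tsum_record_zero {R : Type v} (f : List R → ENNReal) :
    ∑' l : {l : List R // l.length = 0}, f l.1 = f [] := by
  have : ∀ l : {l : List R // l.length = 0}, l = ⟨[], rfl⟩ := fun l =>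
    Subtype.ext (List.eq_nil_of_length_eq_zero l.2)
  rw [tsum_eq_single ⟨[], rfl⟩ fun l hl => absurd (this l) hl]

namespace Repreparation

variable {n : ℕ} {t : ℕ → T} (M : Repreparation D n t)

/-- The measurement scheme given by the data. -/
abbrev scheme : MeasurementScheme He := repreparationScheme M.B M.z M.tsum_z

/-- The probability of the result `a` of the initial read-out. -/
def initProb (a : M.A) : ENNReal := ∑' g, ∑' c, ‖⟪(M.B 0).b a g, M.z 0 c⟫_ℂ‖ₑ ^ 2

/-- The unnormalized system vector after the record `l` and the further read-out result `a`, if the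
norm of the prepared environment vector is not counted. -/
def vec (ψ : Hs) : List (M.A × M.ι) → M.A → Hs
  | [], a => ((Real.sqrt (M.initProb a).toReal : ℝ) : ℂ) • ψ
  | (a, c) :: l, a' => M.L l.length c a' (vec ψ l a)

theorem tsum_initProb : ∑' a, M.initProb a = 1 := by
  unfold initProb
  rw [← tsum_prod_eq (fun p : M.A × (M.B 0).G => ∑' c, ‖⟪(M.B 0).b p.1 p.2, M.z 0 c⟫_ℂ‖ₑ ^ 2),
    ENNReal.tsum_comm]
  simp only [(M.B 0).parseval, M.tsum_z]

theorem initProb_eq (a : M.A) : ‖((Real.sqrt (M.initProb a).toReal : ℝ) : ℂ)‖ₑ ^ 2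
    = M.initProb a := by
  have h : M.initProb a ≠ ⊤ :=
    ne_top_of_le_ne_top ENNReal.one_ne_top (M.tsum_initProb ▸ ENNReal.le_tsum a)
  rw [enorm_sq, Complex.norm_real, Real.norm_of_nonneg (Real.sqrt_nonneg _),
    Real.sq_sqrt ENNReal.toReal_nonneg, ENNReal.ofReal_toReal h]

/-- After every record the joint state is a product vector. -/
theorem afterResult_preState (ψ : Hs) (l : List (M.A × M.ι)) (hl : l.length ≤ n) (a : M.A)
    (c : M.ι) : OpenSystem.afterResult M.scheme l (a, c) (D.preState ψ t M.scheme l)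
      = ketbra (htmul (M.vec ψ l a) (M.z l.length c)) := by
  induction l generalizing a c with
  | nil =>
    refine afterResult_eq_ketbra [] a c (M.init.tensor_ketbra ψ) fun x => ?_
    simp only [inner_htmul, vec, inner_smul_right, enorm_mul, mul_pow, M.initProb_eq,
      ENNReal.tsum_mul_left, List.length_nil]
    rw [mul_comm]
    rfl
  | cons r l ih =>
    obtain ⟨a', c'⟩ := r
    have hl' : l.length < n := by simpa using hl
    have h1 := ih hl'.le a' c'
    have h2 : D.preState ψ t M.scheme ((a', c') :: l) = unitaryConj
        (D.evol (t l.length) (t (l.length + 1)))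
        (ketbra (htmul (M.vec ψ l a') (M.z l.length c'))) := by
      rw [← h1]
      rfl
    rw [h2]
    refine afterResult_eq_ketbra ((a', c') :: l) a c
      ((IsEnsemble.single.{0} _).unitaryConj _) fun x => ?_
    refine Eq.trans (tsum_congr fun g => ?_) (M.pure l.length hl' c' a (M.vec ψ l a') x)
    rw [tsum_fintype, Fintype.sum_unique]
    rfl

/-- The unnormalized system vector after a record. -/
def resultVec (ψ : Hs) : List (M.A × M.ι) → Hs
  | [] => ψ
  | (a, c) :: l => ((‖M.z l.length c‖ : ℝ) : ℂ) • M.vec ψ l a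

theorem reducedState_eq (ψ : Hs) (l : List (M.A × M.ι)) (hl : l.length ≤ n + 1) :
    D.reducedState ψ t M.scheme l = ketbra (M.resultVec ψ l) := by
  cases l with
  | nil => rfl
  | cons r l =>
    obtain ⟨a, c⟩ := r
    have h1 : D.reducedState ψ t M.scheme ((a, c) :: l)
        = partialTrace (ketbra (htmul (M.vec ψ l a) (M.z l.length c))) := by
      rw [← M.afterResult_preState ψ l (by simpa using hl)]
      rfl
    rw [h1]
    have h2 := (IsEnsemble.single.{0} (htmul (M.vec ψ l a) (M.z l.length c))).partialTrace
    refine (h2.of_moments (w := fun _ : PUnit.{1} => M.resultVec ψ ((a, c) :: l))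
      fun x => ?_).unique (IsEnsemble.single _)
    rw [tsum_enorm_inner_ctrR x (fun _ => htmul (M.vec ψ l a) (M.z l.length c))]
    simp [resultVec, ctrL_htmul, enorm_smul, mul_pow, mul_comm, enorm_ofReal_norm]

theorem prob_eq (ψ : Hs) (l : List (M.A × M.ι)) (hl : l.length ≤ n + 1) :
    D.prob ψ t M.scheme l = ‖M.resultVec ψ l‖ ^ 2 := by
  unfold OpenSystem.prob
  rw [M.reducedState_eq ψ l hl, (IsEnsemble.single.{0} (M.resultVec ψ l)).trace_eq,
    Complex.ofReal_re]
  simp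

theorem condState_eq (ψ : Hs) (l : List (M.A × M.ι)) (hl : l.length ≤ n + 1) :
    D.condState ψ t M.scheme l
      = ketbra (((‖M.resultVec ψ l‖⁻¹ : ℝ) : ℂ) • M.resultVec ψ l) := by
  unfold OpenSystem.condState
  rw [M.prob_eq ψ l hl, M.reducedState_eq ψ l hl, ketbra_smul]
  congr 1
  rw [Complex.norm_real, norm_inv, norm_norm, inv_pow]
  push_cast
  rfl

theorem isEnsemble_vec {ψ : Hs} (hψ : ‖ψ‖ = 1) (h0 : t 0 = ⊥) (j : ℕ) (hj : j ≤ n) :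
    IsEnsemble (D.dynMap (t j) (ketbra ψ))
      (fun p : {l : List (M.A × M.ι) // l.length = j} × M.A => M.vec ψ p.1.1 p.2) := by
  induction j with
  | zero =>
    rw [h0, dynMap_bot M.init (M.tsum_z 0)]
    refine (IsEnsemble.single.{0} ψ).of_moments fun x => ?_
    rw [tsum_prod_eq]
    rw [tsum_record_zero (fun l => ∑' a, ‖⟪x, M.vec ψ l a⟫_ℂ‖ₑ ^ 2)]
    simp [vec, mul_pow, M.initProb_eq, ENNReal.tsum_mul_right, M.tsum_initProb]
  | succ j ih =>
    refine (isEnsemble_dynMap M.init _ ψ).of_moments fun x => ?_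
    rw [(isEnsemble_dynMap M.init _ ψ).enorm_inner_eq,
      ← M.average j hj ψ hψ _ (ih (Nat.le_of_lt hj)) x, tsum_prod_eq, tsum_prod_eq,
      tsum_record_succ j (fun l => ∑' a, ‖⟪x, M.vec ψ l a⟫_ℂ‖ₑ ^ 2), tsum_prod_eq]
    have h1 : ∀ (a : M.A) (c : M.ι) (l : {l : List (M.A × M.ι) // l.length = j}),
        ∑' a', ‖⟪x, M.vec ψ ((a, c) :: l.1) a'⟫_ℂ‖ₑ ^ 2
          = ‖ctrL He x (D.evol (t j) (t (j + 1)) (htmul (M.vec ψ l.1 a) (M.z j c)))‖ₑ ^ 2 := by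
      rintro a c ⟨l, hl⟩
      subst hl
      rw [← (M.B (l.length + 1)).tsum_inner_htmul]
      simp only [M.pure l.length hj]
      rfl
    simp only [h1]
    rw [ENNReal.tsum_comm (α := {l : List (M.A × M.ι) // l.length = j})]
    exact tsum_congr fun a => ENNReal.tsum_comm

theorem isEnsemble_resultVec {ψ : Hs} (hψ : ‖ψ‖ = 1) (h0 : t 0 = ⊥) (j : ℕ) (hj : j ≤ n) :
    IsEnsemble (D.dynMap (t j) (ketbra ψ))
      (fun l : {l : List (M.A × M.ι) // l.length = j + 1} => M.resultVec ψ l.1) := by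
  refine (M.isEnsemble_vec hψ h0 j hj).of_moments fun x => ?_
  rw [tsum_record_succ j (fun l => ‖⟪x, M.resultVec ψ l⟫_ℂ‖ₑ ^ 2), tsum_prod_eq, tsum_prod_eq,
    ENNReal.tsum_comm (β := M.A)]
  refine tsum_congr fun a => ?_
  rw [ENNReal.tsum_comm]
  refine tsum_congr fun l => ?_
  simp [resultVec, mul_pow, ENNReal.tsum_mul_right, enorm_ofReal_norm, l.2,
    M.tsum_z]

theorem isPureUnravelling {ψ : Hs} (hψ : ‖ψ‖ = 1) (h0 : t 0 = ⊥) :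
    D.IsPureUnravelling ψ t M.scheme n := by
  refine ⟨?_, fun j _ hj => ⟨fun l hl hp => ?_, ?_⟩⟩
  · have h1 : ∀ r : M.A × M.ι, IsEnsemble (krausMap ((M.scheme.meas []).K r) D.ρe)
        (fun p : (M.B 0).G × M.ι => ⟪(M.B 0).b r.1 p.1, M.z 0 p.2⟫_ℂ • M.z 0 r.2) := by
      rintro ⟨a, c⟩
      refine M.init.kraus (fun g : (M.B 0).G =>
        InnerProductSpace.rankOne ℂ (M.z 0 c) ((M.B 0).b a g)) fun x => ?_
      simp only [InnerProductSpace.rankOne_apply, enorm_smul, mul_pow, ENNReal.tsum_mul_right]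
      calc _ ≤ ‖x‖ₑ ^ 2 * 1 := by
            refine mul_le_mul' ?_ (enorm_sq_le_one (M.tsum_z 0) c)
            rw [← (M.B 0).parseval x, tsum_prod_eq]
            exact ENNReal.le_tsum (f := fun a => ∑' g, ‖⟪(M.B 0).b a g, x⟫_ℂ‖ₑ ^ 2) a
        _ = _ := mul_one _
    have h2 : IsEnsemble D.ρe (fun q : (M.A × M.ι) × ((M.B 0).G × M.ι) =>
        ⟪(M.B 0).b q.1.1 q.2.1, M.z 0 q.2.2⟫_ℂ • M.z 0 q.1.2) := by
      refine M.init.of_moments fun x => ?_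
      simp only [inner_smul_right, enorm_mul, mul_pow]
      rw [tsum_prod_eq, tsum_prod_eq, ENNReal.tsum_comm]
      refine tsum_congr fun c => ?_
      simp only [ENNReal.tsum_mul_right]
      have h3 : ∀ a, ∑' p : (M.B 0).G × M.ι, ‖⟪(M.B 0).b a p.1, M.z 0 p.2⟫_ℂ‖ₑ ^ 2
          = M.initProb a := fun a => tsum_prod_eq _
      simp only [h3, M.tsum_initProb, one_mul]
    exact h2.2.prod_fiberwise fun r => (h1 r).2
  · have hl' : l.length ≤ n + 1 := by omega
    rw [M.prob_eq ψ l hl'] at hp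
    have h1 : M.resultVec ψ l ≠ 0 := fun h => hp (by simp [h])
    refine ⟨_, ?_, M.condState_eq ψ l hl'⟩
    rw [norm_smul, Complex.norm_real, norm_inv, norm_norm, inv_mul_cancel₀ (norm_ne_zero_iff.2 h1)]
  · refine (M.isEnsemble_resultVec hψ h0 j hj).2.congr_fun fun l => ?_
    have hl' : l.1.length ≤ n + 1 := by have := l.2; omega
    rw [OpenSystem.condState, M.prob_eq ψ l.1 hl', M.reducedState_eq ψ l.1 hl', smul_smul]
    by_cases h : M.resultVec ψ l.1 = 0
    · simp [h, ketbra]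
    · rw [mul_inv_cancel₀ (by simpa using h), one_smul]

end Repreparation

end Repreparation

/-! ### Uncountably many reachable states give infinitely many ensembles -/

section Laws

variable {Hs : Type u} [NormedAddCommGroup Hs] [InnerProductSpace ℂ Hs] [CompleteSpace Hs]
  {He : Type v} [NormedAddCommGroup He] [InnerProductSpace ℂ He] [CompleteSpace He]
  {T : Type w} [LinearOrder T] [OrderBot T] {D : OpenSystem T Hs He}

theorem trajectory_drop (ψ : Hs) (t : ℕ → T) (S : MeasurementScheme He) (k : ℕ) (l : List S.R) :
    (D.trajectory ψ t S l).drop k = D.trajectory ψ t S (l.drop k) := by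
  induction k generalizing l with
  | zero => simp
  | succ k ih =>
    cases l with
    | nil => rfl
    | cons r l => exact ih l

/-- The ensemble of trajectories of a pure unravelling is a discrete distribution. -/
theorem countable_support_trajectoryLaw {ψ : Hs} {n : ℕ} {t : ℕ → T} {S : MeasurementScheme He}
    (h : D.IsPureUnravelling ψ t S n) (hn : 1 ≤ n) :
    {Υ | D.trajectoryLaw ψ t S n Υ ≠ 0}.Countable := by
  obtain ⟨hp, hs⟩ := h.2 n hn le_rfl
  have h1 := hs.summable.countable_support
  refine (h1.image fun l => D.trajectory ψ t S l.1).mono fun Υ hΥ => ?_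
  have h2 : ∃ l : {l : List S.R // l.length = n + 1 ∧ D.trajectory ψ t S l = Υ},
      D.prob ψ t S l.1 ≠ 0 := by
    by_contra! h3
    exact hΥ (by simp [OpenSystem.trajectoryLaw, h3])
  obtain ⟨⟨l, hl, hl'⟩, hpl⟩ := h2
  refine ⟨⟨l, hl⟩, ?_, hl'⟩
  obtain ⟨φ, hφ, h3⟩ := hp l hl hpl
  have h4 : ketbra φ ≠ 0 := fun h => by
    have := norm_ketbra φ
    rw [h, hφ] at this
    simp at this
  simp only [Function.mem_support]
  rw [h3]
  exact smul_ne_zero (by exact_mod_cast hpl) h4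

/-- The pure state `|u⟩⟨u| / ‖u‖²` of an unnormalized vector `u` (and `0` for `u = 0`). -/
def normState (u : Hs) : Hs →L[ℂ] Hs := (((‖u‖ ^ 2 : ℝ) : ℂ))⁻¹ • ketbra u

theorem normState_smul (c : ℂ) (hc : c ≠ 0) (u : Hs) : normState (c • u) = normState u := by
  unfold normState
  rw [ketbra_smul, smul_smul, norm_smul, mul_pow]
  congr 1
  have : ((‖c‖ ^ 2 : ℝ) : ℂ) ≠ 0 := by simpa using hc
  push_cast at this ⊢
  rw [mul_inv, mul_right_comm, inv_mul_cancel₀ this, one_mul]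

theorem normState_line_injective {u₁ u₂ : Hs} (h : LinearIndependent ℂ ![u₁, u₂]) :
    Function.Injective fun θ : ℝ => normState (u₁ + (θ : ℂ) • u₂) := by
  have hne : ∀ θ : ℝ, u₁ + (θ : ℂ) • u₂ ≠ 0 := fun θ h0 => by
    have := (LinearIndependent.pair_iff.1 h) 1 θ (by simpa using h0)
    simp at this
  intro θ θ' heq
  have h1 := congrArg (fun X => X (u₁ + (θ : ℂ) • u₂)) heq
  simp only [normState, smul_apply, ketbra_apply, smul_smul] at h1
  rw [inner_self_eq_norm_sq_to_K] at h1
  have h2 : (((‖u₁ + (θ : ℂ) • u₂‖ ^ 2 : ℝ) : ℂ)) ≠ 0 := by simpa using hne θ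
  have h3 : (((‖u₁ + (θ : ℂ) • u₂‖ ^ 2 : ℝ) : ℂ))⁻¹ * ((‖u₁ + (θ : ℂ) • u₂‖ : ℝ) : ℂ) ^ 2 = 1 := by
    rw [← Complex.ofReal_pow]
    exact inv_mul_cancel₀ h2
  rw [RCLike.ofReal_eq_complex_ofReal, h3, one_smul] at h1
  generalize (((‖u₁ + (θ' : ℂ) • u₂‖ ^ 2 : ℝ) : ℂ))⁻¹
    * ⟪u₁ + (θ' : ℂ) • u₂, u₁ + (θ : ℂ) • u₂⟫_ℂ = γ at h1
  have h4 := (LinearIndependent.pair_iff.1 h) (1 - γ) (θ - γ * θ') (by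
    rw [sub_smul, sub_smul, one_smul, mul_smul]
    rw [smul_add] at h1
    rw [← sub_eq_zero] at h1
    rw [← h1]
    abel)
  have h5 : γ = 1 := (sub_eq_zero.1 h4.1).symm
  have h6 := sub_eq_zero.1 h4.2
  rw [h5, one_mul] at h6
  exact_mod_cast h6

theorem normState_eq_of_moments {v u : Hs} {c : ℂ} (hc : c ≠ 0)
    (h : ∀ x, ‖⟪x, v⟫_ℂ‖ₑ ^ 2 = ‖⟪x, c • u⟫_ℂ‖ₑ ^ 2) :
    normState v = normState u ∧ ‖v‖ₑ = ‖c • u‖ₑ := by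
  have h1 : ketbra v = ketbra (c • u) :=
    (IsEnsemble.single.{0} v).unique
      ((IsEnsemble.single.{0} (c • u)).of_moments fun x => by simpa using h x)
  have h2 : ‖v‖ ^ 2 = ‖c • u‖ ^ 2 := by rw [← norm_ketbra, h1, norm_ketbra]
  refine ⟨?_, ?_⟩
  · rw [← normState_smul c hc u, normState, h1, h2, normState]
  · rw [← ofReal_norm, ← ofReal_norm, (sq_eq_sq₀ (norm_nonneg _) (norm_nonneg _)).1 h2]

namespace Repreparation

variable {n : ℕ} {t : ℕ → T} (M : Repreparation D n t)

theorem trajectoryLaw_ne_zero {ψ : Hs} (hψ : ‖ψ‖ = 1) (h0 : t 0 = ⊥) (l : List (M.A × M.ι))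
    (hl : l.length = n + 1) (h : M.resultVec ψ l ≠ 0) :
    D.trajectoryLaw ψ t M.scheme n (D.trajectory ψ t M.scheme l) ≠ 0 := by
  have h1 := M.isEnsemble_resultVec hψ h0 n le_rfl
  have h2 : Summable fun l : {l : List (M.A × M.ι) // l.length = n + 1} =>
      D.prob ψ t M.scheme l.1 := by
    have := ENNReal.summable_toReal h1.1
    refine this.congr fun l => ?_
    rw [M.prob_eq ψ l.1 l.2.le]
    simp
  have h3 := h2.comp_injective (i := fun k : {k : List (M.A × M.ι) // k.length = n + 1 ∧
      D.trajectory ψ t M.scheme k = D.trajectory ψ t M.scheme l} =>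
      (⟨k.1, k.2.1⟩ : {l : List (M.A × M.ι) // l.length = n + 1})) (fun a b hab => by
        have := congrArg Subtype.val hab
        exact Subtype.ext this)
  refine (h3.tsum_pos (fun k => ?_) ⟨l, hl, rfl⟩ ?_).ne'
  · simp only [Function.comp]
    rw [M.prob_eq ψ k.1 k.2.1.le]
    positivity
  · simp only [Function.comp]
    rw [M.prob_eq ψ l hl.le]
    have := norm_pos_iff.2 h
    positivity

theorem exists_z_ne_zero (j : ℕ) : ∃ c, M.z j c ≠ 0 := by
  by_contra! h
  have := M.tsum_z j
  simp [h] at this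

theorem exists_vec_cons_ne_zero (ψ : Hs) (l : List (M.A × M.ι)) (hl : l.length < n) (a : M.A)
    (c : M.ι) (h : M.resultVec ψ ((a, c) :: l) ≠ 0) : ∃ a', M.vec ψ ((a, c) :: l) a' ≠ 0 := by
  by_contra! h1
  have h2 : ∀ x, ‖ctrL He x (D.evol (t l.length) (t (l.length + 1))
      (htmul (M.vec ψ l a) (M.z l.length c)))‖ₑ ^ 2 = 0 := fun x => by
    rw [← (M.B (l.length + 1)).tsum_inner_htmul]
    simp only [M.pure l.length hl]
    simp only [vec] at h1
    simp [h1]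
  have h3 : htmul (M.vec ψ l a) (M.z l.length c) = 0 := by
    rw [← (D.evol (t l.length) (t (l.length + 1))).map_eq_zero_iff]
    refine eq_of_inner_htmul fun x y => ?_
    have := h2 x
    simp only [pow_eq_zero_iff two_ne_zero, enorm_eq_zero] at this
    rw [← inner_ctrL, this, inner_zero_right, inner_zero_right]
  have h4 := norm_htmul (M.vec ψ l a) (M.z l.length c)
  rw [h3, norm_zero] at h4
  simp only [resultVec] at h
  rcases mul_eq_zero.1 h4.symm with h5 | h5
  · exact h (by rw [norm_eq_zero.1 h5, smul_zero])
  · exact h (by rw [h5]; simp)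

theorem resultVec_ne_zero (ψ : Hs) (l : List (M.A × M.ι)) (a : M.A) (c : M.ι)
    (h : M.vec ψ l a ≠ 0) (hc : M.z l.length c ≠ 0) : M.resultVec ψ ((a, c) :: l) ≠ 0 :=
  smul_ne_zero (by simpa using hc) h

/-- Every record of non-zero probability can be continued. -/
theorem exists_extension (ψ : Hs) (l : List (M.A × M.ι)) (hl0 : l ≠ []) (k : ℕ)
    (hl : l.length + k = n + 1) (h : M.resultVec ψ l ≠ 0) :
    ∃ l' : List (M.A × M.ι), l'.length = n + 1 ∧ l'.drop k = l ∧ M.resultVec ψ l' ≠ 0 := by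
  induction k generalizing l with
  | zero => exact ⟨l, hl, rfl, h⟩
  | succ k ih =>
    obtain ⟨⟨a, c⟩, l, rfl⟩ := List.exists_cons_of_ne_nil hl0
    simp only [List.length_cons] at hl
    obtain ⟨a', ha'⟩ := M.exists_vec_cons_ne_zero ψ l (by omega) a c h
    obtain ⟨c', hc'⟩ := M.exists_z_ne_zero ((a, c) :: l).length
    obtain ⟨l', h1, h2, h3⟩ := ih ((a', c') :: (a, c) :: l) (by simp)
      (by simp only [List.length_cons]; omega)
      (M.resultVec_ne_zero ψ _ a' c' ha' hc')
    refine ⟨l', h1, ?_, h3⟩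
    rw [← List.drop_drop, h2]
    rfl

end Repreparation

/-- If the state at `t_j` is the pure state `s`, and the conditional states that different
`Repreparation`s can produce from it at `t_{j+1}` include all those on a real line of vectors, then
there are infinitely many ensembles of trajectories: finitely many would give only countably many
trajectories, and so only countably many states at `t_{j+1}`. -/
theorem infinite_laws {ψ s : Hs} (hψ : ‖ψ‖ = 1) (hs1 : ‖s‖ = 1) {n : ℕ} {t : ℕ → T} (h0 : t 0 = ⊥)
    {j : ℕ} (hj : j < n) (hs : D.dynMap (t j) (ketbra ψ) = ketbra s) {u₁ u₂ : Hs}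
    (hu : LinearIndependent ℂ ![u₁, u₂])
    (h : ∀ θ : ℝ, ∃ (M : Repreparation D n t) (c : M.ι) (a : M.A) (κ : ℂ), κ ≠ 0 ∧ ∀ x,
      ∑' g, ‖⟪htmul x ((M.B (j + 1)).b a g), D.evol (t j) (t (j + 1)) (htmul s (M.z j c))⟫_ℂ‖ₑ ^ 2
        = ‖⟪x, κ • (u₁ + (θ : ℂ) • u₂)⟫_ℂ‖ₑ ^ 2) :
    {law : List (Hs →L[ℂ] Hs) → ℝ | ∃ S : MeasurementScheme He,
        D.IsPureUnravelling ψ t S n ∧ D.trajectoryLaw ψ t S n = law}.Infinite := by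
  intro hfin
  have h1 : (⋃ law ∈ {law : List (Hs →L[ℂ] Hs) → ℝ | ∃ S : MeasurementScheme He,
        D.IsPureUnravelling ψ t S n ∧ D.trajectoryLaw ψ t S n = law},
      {Υ | law Υ ≠ 0}).Countable := by
    refine hfin.countable.biUnion ?_
    rintro law ⟨S, hS, rfl⟩
    exact countable_support_trajectoryLaw hS (by omega)
  -- trajectories list the latest state first, so this is the state at `t_{j+1}`
  have h2 := h1.image fun Υ => (Υ.drop (n - (j + 1))).head?
  have h3 := h2.preimage (f := fun θ : ℝ => some (normState (u₁ + (θ : ℂ) • u₂)))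
    ((Option.some_injective _).comp (normState_line_injective hu))
  refine Cardinal.not_countable_real (h3.mono fun θ _ => ?_)
  obtain ⟨M, c, a, κ, hκ, hM⟩ := h θ
  have hne : u₁ + (θ : ℂ) • u₂ ≠ 0 := fun h0 => by
    have := (LinearIndependent.pair_iff.1 hu) 1 θ (by simpa using h0)
    simp at this
  have h4 := M.isEnsemble_vec hψ h0 j hj.le
  have h5 := tsum_isEnsemble_dynMap M.init (M.tsum_z 0) hψ h4
  rw [hs] at h4
  have h6 : ∃ p : {l : List (M.A × M.ι) // l.length = j} × M.A, M.vec ψ p.1.1 p.2 ≠ 0 := by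
    by_contra! h6
    simp [h6] at h5
  -- some record up to `t_j` occurs, and it leaves the state `s`
  obtain ⟨⟨⟨l, hl⟩, a₀⟩, hv⟩ := h6
  have h7 := h4.mem_span_of_ketbra hs1 ⟨⟨l, hl⟩, a₀⟩
  simp only at h7 hv
  subst hl
  set μ := ⟪s, M.vec ψ l a₀⟫_ℂ
  have hμ : μ ≠ 0 := fun h => hv (by rw [h7, h, zero_smul])
  have h8 : ∀ x, ‖⟪x, M.vec ψ ((a₀, c) :: l) a⟫_ℂ‖ₑ ^ 2
      = ‖⟪x, (μ * κ) • (u₁ + (θ : ℂ) • u₂)⟫_ℂ‖ₑ ^ 2 := fun x => by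
    have : M.vec ψ ((a₀, c) :: l) a = M.L l.length c a (M.vec ψ l a₀) := rfl
    rw [this, ← M.pure l.length hj, h7, mul_smul, inner_smul_right x _ μ, enorm_mul, mul_pow,
      ← hM, ← ENNReal.tsum_mul_left]
    refine tsum_congr fun g => ?_
    rw [smul_htmul, map_smul, inner_smul_right, enorm_mul, mul_pow]
  obtain ⟨h9, h10⟩ := normState_eq_of_moments (mul_ne_zero hμ hκ) h8
  have h11 : M.vec ψ ((a₀, c) :: l) a ≠ 0 := by
    rw [← enorm_ne_zero, h10, enorm_ne_zero]
    exact smul_ne_zero (mul_ne_zero hμ hκ) hne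
  obtain ⟨c', hc'⟩ := M.exists_z_ne_zero ((a₀, c) :: l).length
  obtain ⟨l', hl', hdrop, hl0⟩ := M.exists_extension ψ ((a, c') :: (a₀, c) :: l) (by simp)
    (n - (l.length + 1)) (by simp only [List.length_cons]; omega)
    (M.resultVec_ne_zero ψ _ a c' h11 hc')
  refine ⟨D.trajectory ψ t M.scheme l', Set.mem_biUnion (x := D.trajectoryLaw ψ t M.scheme n)
    ⟨M.scheme, M.isPureUnravelling hψ h0, rfl⟩ (M.trajectoryLaw_ne_zero hψ h0 l' hl' hl0), ?_⟩
  simp only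
  rw [trajectory_drop, hdrop]
  simp only [OpenSystem.trajectory, List.head?_cons]
  congr 1
  have h12 : ((a, c') :: (a₀, c) :: l).length ≤ n + 1 := by simp only [List.length_cons]; omega
  rw [OpenSystem.condState, M.prob_eq ψ _ h12, M.reducedState_eq ψ _ h12, ← h9]
  refine Eq.trans ?_ (normState_smul
    ((‖M.z ((a₀, c) :: l).length c'‖ : ℝ) : ℂ) (by simpa using hc') _)
  rfl

end Laws

/-! ### Families of read-outs and preparations -/

section Family

variable {Hs : Type u} [NormedAddCommGroup Hs] [InnerProductSpace ℂ Hs] [CompleteSpace Hs]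
  {He : Type v} [NormedAddCommGroup He] [InnerProductSpace ℂ He] [CompleteSpace He]
  {T : Type w} [LinearOrder T] [OrderBot T]

/-- Read-outs of the environment for each time and preparations for each pair of times, any choice
of which, for a given finite sequence of times, gives a pure unravelling. -/
structure RepreparationFamily (D : OpenSystem T Hs He) where
  /-- The admissible read-outs at a time. -/
  IsReadout : T → ∀ {A : Type v}, Readout He A → Prop
  /-- The admissible preparations at a first time, in view of the evolution up to a second time. -/
  IsPrep : T → T → ∀ {ι : Type v}, (ι → He) → Prop
  exists_readout : ∀ τ, ∃ (A : Type v) (B : Readout He A), IsReadout τ B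
  exists_prep : ∀ τ τ', τ ≤ τ' → ∃ (ι : Type v) (z : ι → He), IsPrep τ τ' z
  tsum_eq : ∀ {τ τ'} {ι : Type v} {z : ι → He}, IsPrep τ τ' z → ∑' c, ‖z c‖ₑ ^ 2 = 1
  init : ∀ {τ} {ι : Type v} {z : ι → He}, IsPrep ⊥ τ z → IsEnsemble D.ρe z
  /-- As in `Repreparation.pure`. -/
  pure : ∀ {τ τ'}, τ ≤ τ' → ∀ {ι A : Type v} {z : ι → He} {B : Readout He A}, IsPrep τ τ' z →
    IsReadout τ' B → ∀ c a, ∃ L : Hs → Hs, ∀ s x,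
      ∑' g, ‖⟪htmul x (B.b a g), D.evol τ τ' (htmul s (z c))⟫_ℂ‖ₑ ^ 2 = ‖⟪x, L s⟫_ℂ‖ₑ ^ 2
  /-- As in `Repreparation.average`. -/
  average : ∀ {τ τ'}, τ ≤ τ' → ∀ {ι : Type v} {z : ι → He}, IsPrep τ τ' z → ∀ ψ : Hs, ‖ψ‖ = 1 →
    ∀ {κ : Type v} (s : κ → Hs), IsEnsemble (D.dynMap τ (ketbra ψ)) s →
    ∀ x, ∑' k, ∑' c, ‖ctrL He x (D.evol τ τ' (htmul (s k) (z c)))‖ₑ ^ 2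
      = ‖⟪x, D.dynMap τ' (ketbra ψ) x⟫_ℂ‖ₑ

theorem tsum_extend {α β V : Type*} {g : α → β} (hg : Function.Injective g) (f : α → V) (e : β → V)
    (F : V → ENNReal) (he : ∀ b, F (e b) = 0) :
    ∑' b, F (Function.extend g f e b) = ∑' a, F (f a) := by
  rw [← hg.tsum_eq (f := fun b => F (Function.extend g f e b))]
  · simp only [hg.extend_apply]
  · intro b hb
    by_contra h
    have h' : ¬∃ a, g a = b := h
    exact hb (by simp only [Function.extend_apply' _ _ _ h', he])

/-- A read-out whose labels are made part of a larger set; the additional labels never occur. -/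
def Readout.extend {A : ℕ → Type v} {j : ℕ} (B : Readout He (A j)) : Readout He (Σ j, A j) where
  G := B.G
  b := Function.extend (Sigma.mk j) B.b 0
  parseval x := by
    rw [tsum_prod_eq, tsum_extend (sigma_mk_injective) B.b 0
      (fun f => ∑' g, ‖⟪f g, x⟫_ℂ‖ₑ ^ 2) (fun _ => by simp), ← B.parseval x, tsum_prod_eq]

/-- Step-wise data, with labels in types that depend on the step, give a `Repreparation`. -/
theorem exists_repreparation_of_steps {D : OpenSystem T Hs He} {n : ℕ} {t : ℕ → T}
    {A ι : ℕ → Type v} (B : ∀ j, Readout He (A j)) (z : ∀ j, ι j → He)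
    (hz : ∀ j, ∑' c, ‖z j c‖ₑ ^ 2 = 1) (init : IsEnsemble D.ρe (z 0))
    (pure : ∀ j < n, ∀ c a, ∃ L : Hs → Hs, ∀ s x,
      ∑' g, ‖⟪htmul x ((B (j + 1)).b a g), D.evol (t j) (t (j + 1)) (htmul s (z j c))⟫_ℂ‖ₑ ^ 2
        = ‖⟪x, L s⟫_ℂ‖ₑ ^ 2)
    (average : ∀ j < n, ∀ ψ : Hs, ‖ψ‖ = 1 →
      ∀ {κ : Type v} (s : κ → Hs), IsEnsemble (D.dynMap (t j) (ketbra ψ)) s →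
      ∀ x, ∑' k, ∑' c, ‖ctrL He x (D.evol (t j) (t (j + 1)) (htmul (s k) (z j c)))‖ₑ ^ 2
        = ‖⟪x, D.dynMap (t (j + 1)) (ketbra ψ) x⟫_ℂ‖ₑ) :
    ∃ M : Repreparation D n t, ∀ j (c : ι j) (a : A (j + 1)), ∃ (c' : M.ι) (a' : M.A),
      M.z j c' = z j c ∧ ∀ (x : Hs) (Ω : HilbertTensor Hs He),
         ∑' g, ‖⟪htmul x ((M.B (j + 1)).b a' g), Ω⟫_ℂ‖ₑ ^ 2
        = ∑' g, ‖⟪htmul x ((B (j + 1)).b a g), Ω⟫_ℂ‖ₑ ^ 2 := by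
  have hsum : ∀ j {F : He → ENNReal}, F 0 = 0 →
      ∑' c, F (Function.extend (Sigma.mk j) (z j) 0 c) = ∑' c, F (z j c) := fun j F hF =>
    tsum_extend sigma_mk_injective (z j) 0 F fun _ => hF
  have hL : ∀ j (c : Σ j, ι j) (a : Σ j, A j), ∃ L : Hs → Hs, j < n → ∀ s x,
      ∑' g, ‖⟪htmul x ((B (j + 1)).extend.b a g),
        D.evol (t j) (t (j + 1)) (htmul s (Function.extend (Sigma.mk j) (z j) 0 c))⟫_ℂ‖ₑ ^ 2
        = ‖⟪x, L s⟫_ℂ‖ₑ ^ 2 := by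
    intro j c a
    by_cases hj : j < n
    · by_cases hc : ∃ c', Sigma.mk j c' = c
      · by_cases ha : ∃ a', Sigma.mk (j + 1) a' = a
        · obtain ⟨c, rfl⟩ := hc
          obtain ⟨a, rfl⟩ := ha
          obtain ⟨L, hL⟩ := pure j hj c a
          refine ⟨L, fun _ s x => ?_⟩
          rw [sigma_mk_injective.extend_apply, ← hL]
          unfold Readout.extend
          simp only [sigma_mk_injective.extend_apply]
        · refine ⟨0, fun _ s x => ?_⟩
          unfold Readout.extend
          simp only [Function.extend_apply' _ _ _ ha, Pi.zero_apply, inner_zero_right, enorm_zero]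
          simp [← tmulLeft_apply]
      · refine ⟨0, fun _ s x => ?_⟩
        simp only [Function.extend_apply' _ _ _ hc, Pi.zero_apply, inner_zero_right, enorm_zero]
        simp [← tmulLeft_apply]
    · exact ⟨0, fun h => absurd h hj⟩
  choose L hL using hL
  refine ⟨{ A := Σ j, A j
            ι := Σ j, ι j
            B := fun j => (B j).extend
            z := fun j => Function.extend (Sigma.mk j) (z j) 0
            L := L
            tsum_z := fun j => by
              rw [hsum j (F := fun y => ‖y‖ₑ ^ 2) (by simp), hz]
            init := ?_
            pure := fun j hj c a s x => hL j c a hj s x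
            average := fun j hj ψ hψ κ s hs x => ?_ }, fun j c a => ⟨⟨j, c⟩, ⟨j + 1, a⟩, ?_, ?_⟩⟩
  · refine init.of_moments fun x => ?_
    rw [hsum 0 (F := fun y => ‖⟪x, y⟫_ℂ‖ₑ ^ 2) (by simp)]
  · rw [← average j hj ψ hψ s hs x]
    refine tsum_congr fun k => ?_
    rw [hsum j (F := fun y => ‖ctrL He x (D.evol (t j) (t (j + 1)) (htmul (s k) y))‖ₑ ^ 2)
      (by simp [← tmulLeft_apply])]
  · exact sigma_mk_injective.extend_apply _ _ _
  · intro x Ω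
    simp only [Readout.extend, sigma_mk_injective.extend_apply]

namespace RepreparationFamily

variable {D : OpenSystem T Hs He}

/-- The preparation and the read-out for one step can be prescribed. -/
theorem exists_repreparation (F : RepreparationFamily D) {n : ℕ} {t : ℕ → T}
    (ht : OpenSystem.IsTimeSequence n t) {j₀ : ℕ} (hj₀ : j₀ < n)
    {A₀ ι₀ : Type v} {B₀ : Readout He A₀} {z₀ : ι₀ → He}
    (hB₀ : F.IsReadout (t (j₀ + 1)) B₀) (hz₀ : F.IsPrep (t j₀) (t (j₀ + 1)) z₀) :
    ∃ M : Repreparation D n t, ∀ (c : ι₀) (a : A₀), ∃ (c' : M.ι) (a' : M.A),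
      M.z j₀ c' = z₀ c ∧ ∀ (x : Hs) (Ω : HilbertTensor Hs He),
         ∑' g, ‖⟪htmul x ((M.B (j₀ + 1)).b a' g), Ω⟫_ℂ‖ₑ ^ 2
        = ∑' g, ‖⟪htmul x (B₀.b a g), Ω⟫_ℂ‖ₑ ^ 2 := by
  -- beyond `n` the values of `t` are arbitrary, so they are replaced by `t n`
  have hle : ∀ j, t (min j n) ≤ t (min (j + 1) n) := fun j => by
    rcases lt_or_ge j n with h | h
    · rw [min_eq_left h.le, min_eq_left h]
      exact (ht.2 j h).le
    · rw [min_eq_right h, min_eq_right (by omega)]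
  have h1 : ∀ j, ∃ (A : Type v) (B : Readout He A), F.IsReadout (t (min j n)) B ∧
      (j = j₀ + 1 → ∀ a, ∃ a', ∀ x Ω, ∑' g, ‖⟪htmul (x : Hs) (B.b a' g), Ω⟫_ℂ‖ₑ ^ 2
        = ∑' g, ‖⟪htmul x (B₀.b a g), Ω⟫_ℂ‖ₑ ^ 2) := by
    intro j
    by_cases hj : j = j₀ + 1
    · refine ⟨A₀, B₀, ?_, fun _ a => ⟨a, fun _ _ => rfl⟩⟩
      rwa [hj, min_eq_left (by omega)]
    · obtain ⟨A, B, hB⟩ := F.exists_readout (t (min j n))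
      exact ⟨A, B, hB, fun h => absurd h hj⟩
  have h2 : ∀ j, ∃ (ι : Type v) (z : ι → He), F.IsPrep (t (min j n)) (t (min (j + 1) n)) z ∧
      (j = j₀ → ∀ c, ∃ c', z c' = z₀ c) := by
    intro j
    by_cases hj : j = j₀
    · refine ⟨ι₀, z₀, ?_, fun _ c => ⟨c, rfl⟩⟩
      rwa [hj, min_eq_left (by omega), min_eq_left (by omega)]
    · obtain ⟨ι, z, hz⟩ := F.exists_prep _ _ (hle j)
      exact ⟨ι, z, hz, fun h => absurd h hj⟩
  choose A B hB hB' using h1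
  choose ι z hz hz' using h2
  have hmin : ∀ j < n, min j n = j ∧ min (j + 1) n = j + 1 := fun j hj =>
    ⟨min_eq_left hj.le, min_eq_left hj⟩
  obtain ⟨M, hM⟩ := exists_repreparation_of_steps (D := D) (n := n) (t := t) B z
    (fun j => F.tsum_eq (hz j)) (F.init (τ := t (min 1 n)) (by
      have := hz 0
      rwa [Nat.zero_min, ht.1] at this))
    (fun j hj c a => by
      have h3 := F.pure (hle j) (hz j) (hB (j + 1)) c a
      rwa [(hmin j hj).1, (hmin j hj).2] at h3)
    (fun j hj ψ hψ κ s hs x => by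
      have h3 := F.average (hle j) (hz j) ψ hψ s
      rw [(hmin j hj).1, (hmin j hj).2] at h3
      exact h3 hs x)
  refine ⟨M, fun c a => ?_⟩
  obtain ⟨c₁, hc₁⟩ := hz' j₀ rfl c
  obtain ⟨a₁, ha₁⟩ := hB' (j₀ + 1) rfl a
  obtain ⟨c', a', hc', ha'⟩ := hM j₀ c₁ a₁
  exact ⟨c', a', hc'.trans hc₁, fun x Ω => (ha' x Ω).trans (ha₁ x Ω)⟩

theorem nonempty_repreparation_zero (F : RepreparationFamily D) (t : ℕ → T) :
    Nonempty (Repreparation D 0 t) := by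
  obtain ⟨A, B, -⟩ := F.exists_readout ⊥
  obtain ⟨ι, z, hz⟩ := F.exists_prep ⊥ ⊥ le_rfl
  obtain ⟨M, -⟩ := exists_repreparation_of_steps (D := D) (n := 0) (t := t) (fun _ => B)
    (fun _ => z) (fun _ => F.tsum_eq hz) (F.init hz) (fun j hj => absurd hj (Nat.not_lt_zero j))
    (fun j hj => absurd hj (Nat.not_lt_zero j))
  exact ⟨M⟩

theorem pu (F : RepreparationFamily D) : D.PU := by
  intro ψ hψ n t ht
  suffices Nonempty (Repreparation D n t) from
    this.elim fun M => ⟨M.scheme, M.isPureUnravelling hψ ht.1⟩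
  rcases Nat.eq_zero_or_pos n with rfl | hn
  · exact F.nonempty_repreparation_zero t
  · obtain ⟨A, B, hB⟩ := F.exists_readout (t (0 + 1))
    obtain ⟨ι, z, hz⟩ := F.exists_prep (t 0) (t (0 + 1)) (ht.2 0 hn).le
    obtain ⟨M, -⟩ := F.exists_repreparation ht hn hB hz
    exact ⟨M⟩

/-- If, whenever a pure state `s` evolves into a mixed state, suitable preparations and read-outs
lead to all states on a line of vectors, then there are many pure unravellings. -/
theorem mpu (F : RepreparationFamily D) {ψ : Hs} (hψ : ‖ψ‖ = 1)
    (hmix : ∃ τ, ¬ IsPure (D.dynMap τ (ketbra ψ)))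
    (h : ∀ τ τ', τ ≤ τ' → ∀ s, ‖s‖ = 1 → D.dynMap τ (ketbra ψ) = ketbra s →
      ¬ IsPure (D.dynMap τ' (ketbra ψ)) →
      ∃ u₁ u₂ : Hs, LinearIndependent ℂ ![u₁, u₂] ∧ ∀ θ : ℝ,
        ∃ (A ι : Type v) (B : Readout He A) (z : ι → He) (a : A) (c : ι) (κ : ℂ),
          F.IsReadout τ' B ∧ F.IsPrep τ τ' z ∧ κ ≠ 0 ∧
          ∀ x, ∑' g, ‖⟪htmul x (B.b a g), D.evol τ τ' (htmul s (z c))⟫_ℂ‖ₑ ^ 2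
            = ‖⟪x, κ • (u₁ + (θ : ℂ) • u₂)⟫_ℂ‖ₑ ^ 2) : D.MPU := by
  refine ⟨F.pu, ψ, hψ, hmix, fun n t ht hj => ?_⟩
  classical
  obtain ⟨hjn, hjp⟩ := Nat.find_spec hj
  -- the first time at which the state is mixed
  set j := Nat.find hj with hjdef
  have hpos : j ≠ 0 := by
    intro h0
    obtain ⟨ι, z, hz⟩ := F.exists_prep ⊥ ⊥ le_rfl
    rw [h0, ht.1, dynMap_bot (F.init hz) (F.tsum_eq hz)] at hjp
    exact hjp ⟨ψ, hψ, rfl⟩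
  obtain ⟨i, hi⟩ := Nat.exists_eq_succ_of_ne_zero hpos
  have hin : i < n := by omega
  have hpure : IsPure (D.dynMap (t i) (ketbra ψ)) := by
    by_contra hp
    exact Nat.find_min hj (m := i) (by omega) ⟨hin.le, hp⟩
  obtain ⟨s, hs1, hs⟩ := hpure
  rw [hi] at hjp
  obtain ⟨u₁, u₂, hu, hθ⟩ := h (t i) (t (i + 1)) (ht.2 i hin).le s hs1 hs hjp
  refine infinite_laws hψ hs1 ht.1 hin hs hu fun θ => ?_
  obtain ⟨A, ι, B, z, a, c, κ, hB, hz, hκ, hx⟩ := hθ θ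
  obtain ⟨M, hM⟩ := F.exists_repreparation ht hin hB hz
  obtain ⟨c', a', hc', ha'⟩ := hM c a
  refine ⟨M, c', a', κ, hκ, fun x => ?_⟩
  rw [ha', hc', hx]

end RepreparationFamily

end Family

/-! ### Past, current and future subsystems -/

section Factor

variable {Hs : Type u} [NormedAddCommGroup Hs] [InnerProductSpace ℂ Hs] [CompleteSpace Hs]
  {He P F : Type v} [NormedAddCommGroup He] [InnerProductSpace ℂ He] [CompleteSpace He]
  [NormedAddCommGroup P] [InnerProductSpace ℂ P] [CompleteSpace P]
  [NormedAddCommGroup F] [InnerProductSpace ℂ F] [CompleteSpace F]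

/-- For a factorization `J : P ⊗ F ≃ He` of the environment, the map `ω ↦ ω ⊗ f` from `Hs ⊗ P` to
`Hs ⊗ He`. -/
def embF (Hs : Type u) [NormedAddCommGroup Hs] [InnerProductSpace ℂ Hs] [CompleteSpace Hs]
    (J : HilbertTensor P F ≃ₗᵢ[ℂ] He) (f : F) : HilbertTensor Hs P →L[ℂ] HilbertTensor Hs He :=
  tensorOp (ContinuousLinearMap.id ℂ Hs) ((J : HilbertTensor P F →L[ℂ] He) ∘L tmulRight P f)

variable (J : HilbertTensor P F ≃ₗᵢ[ℂ] He)

theorem embF_htmul (f : F) (s : Hs) (p : P) :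
    embF Hs J f (htmul s p) = htmul s (J (htmul p f)) := by
  simp [embF, tensorOp_htmul, tmulRight_apply]

theorem embF_add (f f' : F) : embF Hs J (f + f') = embF Hs J f + embF Hs J f' :=
  ext_htmul fun s p => by simp [embF_htmul, htmul_add]

theorem embF_smul (c : ℂ) (f : F) : embF Hs J (c • f) = c • embF Hs J f :=
  ext_htmul fun s p => by simp [embF_htmul, htmul_smul]

theorem adjoint_embF_comp (f f' : F) : adjoint (embF Hs J f) ∘L embF Hs J f'
    = ⟪f, f'⟫_ℂ • ContinuousLinearMap.id ℂ (HilbertTensor Hs P) :=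
  ext_htmul fun s p => eq_of_inner_htmul fun s' p' => by
    simp only [comp_apply, adjoint_inner_right, embF_htmul, smul_apply, id_apply, inner_htmul,
      LinearIsometryEquiv.inner_map_map, inner_smul_right]
    ring

theorem inner_embF (f f' : F) (ω ω' : HilbertTensor Hs P) :
    ⟪embF Hs J f ω, embF Hs J f' ω'⟫_ℂ = ⟪f, f'⟫_ℂ * ⟪ω, ω'⟫_ℂ := by
  rw [← adjoint_inner_right, ← comp_apply, adjoint_embF_comp, smul_apply, id_apply,
    inner_smul_right]

theorem norm_embF (f : F) (ω : HilbertTensor Hs P) : ‖embF Hs J f ω‖ = ‖f‖ * ‖ω‖ := by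
  have h := inner_embF J f f ω ω
  simp only [inner_self_eq_norm_sq_to_K] at h
  norm_cast at h
  rw [← mul_pow] at h
  exact (sq_eq_sq₀ (norm_nonneg _) (by positivity)).1 h

theorem ctrL_embF (x : Hs) (f : F) (ω : HilbertTensor Hs P) :
    ctrL He x (embF Hs J f ω) = J (htmul (ctrL P x ω) f) := by
  rw [embF, ctrL_tensorOp]
  rfl

/-- The map `f ↦ ω ⊗ f` from `F` to `Hs ⊗ He`. -/
def embFLeft (ω : HilbertTensor Hs P) : F →L[ℂ] HilbertTensor Hs He :=
  LinearMap.mkContinuous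
    { toFun := fun f => embF Hs J f ω
      map_add' := fun f f' => by rw [embF_add, add_apply]
      map_smul' := fun c f => by rw [embF_smul, smul_apply, RingHom.id_apply] } ‖ω‖
    (fun f => by
      change ‖embF Hs J f ω‖ ≤ _
      rw [norm_embF, mul_comm])

theorem adjoint_embFLeft (ω ω' : HilbertTensor Hs P) (f : F) :
    adjoint (embFLeft J ω) (embF Hs J f ω') = ⟪ω, ω'⟫_ℂ • f :=
  ext_inner_left ℂ fun f' => by
    rw [adjoint_inner_right]
    change ⟪embF Hs J f' ω, _⟫_ℂ = _
    rw [inner_embF, inner_smul_right, mul_comm]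

/-- The read-out of a product basis of `P ⊗ F`, of which the result in `P` is recorded. -/
def basisReadout {α β : Type v} (a : HilbertBasis α ℂ P) (g : HilbertBasis β ℂ F) :
    Readout He α where
  G := β
  b i k := J (htmul (a i) (g k))
  parseval x := by
    rw [← tsum_enorm_inner_basis (mapBasis (tensorBasis a g) J) x]
    simp only [mapBasis_apply, tensorBasis_apply]

end Factor

section Step

variable {Hs : Type u} [NormedAddCommGroup Hs] [InnerProductSpace ℂ Hs] [CompleteSpace Hs]
  {He P₁ F₁ E P₂ F₂ : Type v}
  [NormedAddCommGroup He] [InnerProductSpace ℂ He] [CompleteSpace He]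
  [NormedAddCommGroup P₁] [InnerProductSpace ℂ P₁] [CompleteSpace P₁]
  [NormedAddCommGroup F₁] [InnerProductSpace ℂ F₁] [CompleteSpace F₁]
  [NormedAddCommGroup E] [InnerProductSpace ℂ E] [CompleteSpace E]
  [NormedAddCommGroup P₂] [InnerProductSpace ℂ P₂] [CompleteSpace P₂]
  [NormedAddCommGroup F₂] [InnerProductSpace ℂ F₂] [CompleteSpace F₂]
  {J₁ : HilbertTensor P₁ F₁ ≃ₗᵢ[ℂ] He} {J₂ : HilbertTensor P₂ F₂ ≃ₗᵢ[ℂ] He}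
  {jp : HilbertTensor P₁ E ≃ₗᵢ[ℂ] P₂} {jf : HilbertTensor E F₂ ≃ₗᵢ[ℂ] F₁}

/-- For a factorization `jp : P₁ ⊗ E ≃ P₂`, the map `y ↦ p ⊗ y` from `Hs ⊗ E` to `Hs ⊗ P₂`. -/
def embE (Hs : Type u) [NormedAddCommGroup Hs] [InnerProductSpace ℂ Hs] [CompleteSpace Hs]
    (jp : HilbertTensor P₁ E ≃ₗᵢ[ℂ] P₂) (p : P₁) : HilbertTensor Hs E →L[ℂ] HilbertTensor Hs P₂ :=
  tensorOp (ContinuousLinearMap.id ℂ Hs) ((jp : HilbertTensor P₁ E →L[ℂ] P₂) ∘L tmulLeft E p)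

theorem embE_htmul (p : P₁) (s : Hs) (c : E) :
    embE Hs jp p (htmul s c) = htmul s (jp (htmul p c)) := by
  simp [embE, tensorOp_htmul, tmulLeft_apply]

theorem ctrL_embE (x : Hs) (p : P₁) (y : HilbertTensor Hs E) :
    ctrL P₂ x (embE Hs jp p y) = jp (htmul p (ctrL E x y)) := by
  rw [embE, ctrL_tensorOp]
  rfl

/-- Vectors `p ⊗ y` with `p ∈ P₁`, `y ∈ Hs ⊗ E` generate `Hs ⊗ P₂`. -/
theorem ext_embE (jp : HilbertTensor P₁ E ≃ₗᵢ[ℂ] P₂) {C : Type*} [NormedAddCommGroup C]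
    [NormedSpace ℂ C] {f g : HilbertTensor Hs P₂ →L[ℂ] C}
    (h : ∀ p y, f (embE Hs jp p y) = g (embE Hs jp p y)) : f = g := by
  refine ext_htmul fun s q => ?_
  have : (f ∘L tmulLeft P₂ s) ∘L (jp : HilbertTensor P₁ E →L[ℂ] P₂)
      = (g ∘L tmulLeft P₂ s) ∘L (jp : HilbertTensor P₁ E →L[ℂ] P₂) :=
    ext_htmul fun p c => by
      have := h p (htmul s c)
      rw [embE_htmul] at this
      simpa [tmulLeft_apply] using this
  have h1 := congrArg (fun k => k (jp.symm q)) this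
  simpa [tmulLeft_apply] using h1

/-- A unitary of the form `U(p₁) ⊗ U(s,e) ⊗ U(f₂)` acts on `(Hs ⊗ P₂) ⊗ F₂` as a product. -/
theorem exists_coarse (W : HilbertTensor Hs He ≃ₗᵢ[ℂ] HilbertTensor Hs He)
    (Up : P₁ → P₁) (Usc : HilbertTensor Hs E → HilbertTensor Hs E) (Uf : F₂ ≃ₗᵢ[ℂ] F₂)
    (hW : ∀ p f y, W (embF Hs J₂ f (embE Hs jp p y))
      = embF Hs J₂ (Uf f) (embE Hs jp (Up p) (Usc y))) {f₀ : F₂} (hf₀ : ‖f₀‖ = 1) :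
    ∃ V : HilbertTensor Hs P₂ →L[ℂ] HilbertTensor Hs P₂,
      ∀ f ω, W (embF Hs J₂ f ω) = embF Hs J₂ (Uf f) (V ω) := by
  -- the action on `Hs ⊗ P₂` is obtained by fixing the vector `f₀` of `F₂`
  let V : HilbertTensor Hs P₂ →L[ℂ] HilbertTensor Hs P₂ :=
    adjoint (embF Hs J₂ (Uf f₀)) ∘L (W : HilbertTensor Hs He →L[ℂ] HilbertTensor Hs He) ∘L
      embF Hs J₂ f₀
  have hV : ∀ p y, V (embE Hs jp p y) = embE Hs jp (Up p) (Usc y) := fun p y => by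
    have h1 : V (embE Hs jp p y)
        = adjoint (embF Hs J₂ (Uf f₀)) (W (embF Hs J₂ f₀ (embE Hs jp p y))) := rfl
    rw [h1, hW, ← comp_apply, adjoint_embF_comp, inner_self_eq_norm_sq_to_K,
      LinearIsometryEquiv.norm_map, hf₀]
    simp
  refine ⟨V, fun f ω => ?_⟩
  have h2 : (W : HilbertTensor Hs He →L[ℂ] HilbertTensor Hs He) ∘L embF Hs J₂ f
      = embF Hs J₂ (Uf f) ∘L V := ext_embE jp fun p y => by
    simp [hW, hV]
  exact congrArg (fun k => k ω) h2

theorem embF_join (coh : ∀ p c f, J₂ (htmul (jp (htmul p c)) f) = J₁ (htmul p (jf (htmul c f))))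
    (c : E) (f : F₂) (s : Hs) (p : P₁) :
    embF Hs J₁ (jf (htmul c f)) (htmul s p) = embF Hs J₂ f (htmul s (jp (htmul p c))) := by
  rw [embF_htmul, embF_htmul, coh]

/-- If the unitaries `U(t₀, t₂)` and `U(t₁, t₂)⁻¹` act on `F₂` as a tensor factor, then the action of
`U(t₀, t₁) = U(t₁, t₂)⁻¹ U(t₀, t₂)` on `F₁ = E ⊗ F₂` is a product, too. -/
theorem exists_future_product
    (coh : ∀ p c f, J₂ (htmul (jp (htmul p c)) f) = J₁ (htmul p (jf (htmul c f))))
    {W₁ W₂ W : HilbertTensor Hs He ≃ₗᵢ[ℂ] HilbertTensor Hs He}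
    (hW : ∀ Ω, W₁ Ω = W (W₂ Ω)) {g : F₁ ≃ₗᵢ[ℂ] F₁} {g₂ g₃ : F₂ ≃ₗᵢ[ℂ] F₂}
    {V : HilbertTensor Hs P₁ →L[ℂ] HilbertTensor Hs P₁}
    {V₂ V₃ : HilbertTensor Hs P₂ →L[ℂ] HilbertTensor Hs P₂}
    (h₁ : ∀ f ω, W₁ (embF Hs J₁ f ω) = embF Hs J₁ (g f) (V ω))
    (h₂ : ∀ f ω, W₂ (embF Hs J₂ f ω) = embF Hs J₂ (g₂ f) (V₂ ω))
    (h₃ : ∀ f ω, W (embF Hs J₂ f ω) = embF Hs J₂ (g₃ f) (V₃ ω))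
    {s₀ : Hs} {p₀ : P₁} {f₀ : F₂} (hs₀ : ‖s₀‖ = 1) (hp₀ : ‖p₀‖ = 1) (hf₀ : ‖f₀‖ = 1) :
    ∃ X : E →L[ℂ] E, (∀ c, ‖X c‖ = ‖c‖) ∧
      ∀ c f, g (jf (htmul c f)) = jf (htmul (X c) (g₃ (g₂ f))) := by
  set ω₀ := V (htmul s₀ p₀) with hω₀
  -- contraction of `E ⊗ F₂ ∋ c ⊗ f` with `f₀`, after contraction of `Hs ⊗ P₁` with `ω₀`
  let κ : HilbertTensor Hs P₂ →L[ℂ] E := ctrR E f₀ ∘L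
    (jf.symm : F₁ →L[ℂ] HilbertTensor E F₂) ∘L adjoint (embFLeft J₁ ω₀) ∘L embF Hs J₂ f₀
  have hκ : ∀ s p c, κ (htmul s (jp (htmul p c))) = ⟪ω₀, htmul s p⟫_ℂ • c := fun s p c => by
    have h : κ (htmul s (jp (htmul p c))) = ctrR E f₀ (jf.symm (adjoint (embFLeft J₁ ω₀)
      (embF Hs J₂ f₀ (htmul s (jp (htmul p c)))))) := rfl
    rw [h, ← embF_join coh, adjoint_embFLeft, map_smul, LinearIsometryEquiv.symm_apply_apply,
      map_smul, ctrR_htmul, inner_self_eq_norm_sq_to_K, hf₀]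
    simp
  have hκ' : ∀ f η, adjoint (embFLeft J₁ ω₀) (embF Hs J₂ f η) = jf (htmul (κ η) f) := by
    intro f η
    have h : adjoint (embFLeft J₁ ω₀) ∘L embF Hs J₂ f
        = (jf : HilbertTensor E F₂ →L[ℂ] F₁) ∘L tmulRight E f ∘L κ := by
      refine ext_embE jp fun p y => ?_
      have h' : (adjoint (embFLeft J₁ ω₀) ∘L embF Hs J₂ f) ∘L embE Hs jp p
        = ((jf : HilbertTensor E F₂ →L[ℂ] F₁) ∘L tmulRight E f ∘L κ) ∘L embE Hs jp p := by
        refine ext_htmul fun s c => ?_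
        simp only [comp_apply, embE_htmul, hκ]
        rw [← embF_join coh, adjoint_embFLeft, map_smul, map_smul]
        rfl
      exact congrArg (fun k => k y) h'
    exact congrArg (fun k => k η) h
  let X : E →L[ℂ] E := κ ∘L V₃ ∘L V₂ ∘L tmulLeft P₂ s₀ ∘L
    (jp : HilbertTensor P₁ E →L[ℂ] P₂) ∘L tmulLeft E p₀
  -- contraction of both expressions for `W₁ (s₀ ⊗ p₀ ⊗ c ⊗ f)` with `ω₀`
  have hX : ∀ c f, ‖ω₀‖ ^ 2 • g (jf (htmul c f)) = jf (htmul (X c) (g₃ (g₂ f))) := by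
    intro c f
    have h4 : embF Hs J₁ (g (jf (htmul c f))) ω₀
        = embF Hs J₂ (g₃ (g₂ f)) (V₃ (V₂ (htmul s₀ (jp (htmul p₀ c))))) := by
      rw [hω₀, ← h₁, hW, embF_join coh, h₂, h₃]
    have h5 := congrArg (adjoint (embFLeft J₁ ω₀)) h4
    rw [adjoint_embFLeft, hκ', inner_self_eq_norm_sq_to_K] at h5
    rw [← Complex.coe_smul]
    push_cast
    exact h5
  have hω : ∀ f, ‖f‖ = ‖g f‖ * ‖ω₀‖ := fun f => by
    rw [← norm_embF J₁, hω₀, ← h₁, LinearIsometryEquiv.norm_map, norm_embF, norm_htmul, hs₀, hp₀]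
    simp
  have hω1 : ∀ c : E, c ≠ 0 → ‖ω₀‖ = 1 := fun c hc => by
    have h6 := hω (jf (htmul c f₀))
    simp only [LinearIsometryEquiv.norm_map, norm_htmul, hf₀, mul_one] at h6
    have h7 : ‖c‖ ≠ 0 := norm_ne_zero_iff.2 hc
    exact mul_left_cancel₀ h7 (by rw [← h6, mul_one])
  have hX' : ∀ c f, g (jf (htmul c f)) = jf (htmul (X c) (g₃ (g₂ f))) := fun c f => by
    by_cases hc : c = 0
    · subst hc
      simp [← tmulRight_apply]
    · rw [← hX, hω1 c hc]
      simp
  refine ⟨X, fun c => ?_, hX'⟩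
  have h8 := congrArg norm (hX' c f₀)
  simpa [norm_htmul, hf₀] using h8.symm

/-- Overlaps of `a ⊗ y ⊗ g` with `ω ⊗ c ⊗ f`, where `y ∈ Hs ⊗ E` and `ω ∈ Hs ⊗ P₁`. -/
theorem inner_embF_embE
    (coh : ∀ p c f, J₂ (htmul (jp (htmul p c)) f) = J₁ (htmul p (jf (htmul c f))))
    (a : P₁) (y : HilbertTensor Hs E) (g f : F₂) (c : E) (ω : HilbertTensor Hs P₁) :
    ⟪embF Hs J₂ g (embE Hs jp a y), embF Hs J₁ (jf (htmul c f)) ω⟫_ℂ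
      = ⟪g, f⟫_ℂ * ⟪y, htmul (ctrR Hs a ω) c⟫_ℂ := by
  have h : adjoint (embF Hs J₂ g ∘L embE Hs jp a) ∘L embF Hs J₁ (jf (htmul c f))
      = ⟪g, f⟫_ℂ • (tmulRight Hs c ∘L ctrR Hs a) :=
    ext_htmul fun s p => eq_of_inner_htmul fun s' c' => by
      rw [comp_apply, adjoint_inner_right, comp_apply, embE_htmul, embF_join coh, inner_embF,
        smul_apply, comp_apply, ctrR_htmul, tmulRight_apply, inner_smul_right, smul_htmul,
        inner_smul_right, inner_htmul, inner_htmul, LinearIsometryEquiv.inner_map_map, inner_htmul]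
      ring
  have h1 := congrArg (fun k => ⟪y, k ω⟫_ℂ) h
  simp only [comp_apply, smul_apply, inner_smul_right, tmulRight_apply] at h1
  rw [← h1, adjoint_inner_right]
  rfl

/-- The part of a vector `ω ∈ Hs ⊗ P₁` on `P₁` does not influence the further evolution of the system:
it acts as an ensemble of system vectors. -/
theorem enorm_ctrL_evol
    (coh : ∀ p c f, J₂ (htmul (jp (htmul p c)) f) = J₁ (htmul p (jf (htmul c f))))
    {W : HilbertTensor Hs He ≃ₗᵢ[ℂ] HilbertTensor Hs He} {Up : P₁ ≃ₗᵢ[ℂ] P₁}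
    {Usc : HilbertTensor Hs E ≃ₗᵢ[ℂ] HilbertTensor Hs E} {Uf : F₂ ≃ₗᵢ[ℂ] F₂}
    (hW : ∀ p f y, W (embF Hs J₂ f (embE Hs jp p y))
      = embF Hs J₂ (Uf f) (embE Hs jp (Up p) (Usc y)))
    {α : Type*} (a : HilbertBasis α ℂ P₁) (x : Hs) (c : E) (f : F₂) (ω : HilbertTensor Hs P₁) :
    ‖ctrL He x (W (embF Hs J₁ (jf (htmul c f)) ω))‖ₑ ^ 2
      = ‖f‖ₑ ^ 2 * ∑' i, ‖ctrL E x (Usc (htmul (ctrR Hs (a i) ω) c))‖ₑ ^ 2 := by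
  -- the basis consists of products and is adapted to `W`, so that `W` can be moved to the other side
  let b := mapBasis (tensorBasis (mapBasis (tensorBasis (mapBasis a Up) (basis E)) jp)
    (mapBasis (basis F₂) Uf)) J₂
  rw [← tsum_enorm_inner_htmul_basis b]
  have h1 : ∀ q, ⟪htmul x (b q), W (embF Hs J₁ (jf (htmul c f)) ω)⟫_ℂ
      = ⟪basis F₂ q.2, f⟫_ℂ
        * ⟪htmul x (basis E q.1.2), Usc (htmul (ctrR Hs (a q.1.1) ω) c)⟫_ℂ := by
    intro q
    have h2 : htmul x (b q) = W (embF Hs J₂ (basis F₂ q.2) (embE Hs jp (a q.1.1)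
        (Usc.symm (htmul x (basis E q.1.2))))) := by
      rw [hW, LinearIsometryEquiv.apply_symm_apply, embE_htmul, embF_htmul]
      simp [b, mapBasis_apply, tensorBasis_apply]
    rw [h2, LinearIsometryEquiv.inner_map_map, inner_embF_embE coh,
      ← LinearIsometryEquiv.inner_map_map Usc, LinearIsometryEquiv.apply_symm_apply]
  simp only [h1, enorm_mul, mul_pow]
  rw [tsum_prod_eq]
  simp only [ENNReal.tsum_mul_right, tsum_enorm_inner_basis]
  rw [ENNReal.tsum_mul_left, tsum_prod_eq]
  simp only [tsum_enorm_inner_htmul_basis]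

end Step

/-! ### Past–future independence gives a repreparation family -/

section Prep

variable {Hs : Type u} [NormedAddCommGroup Hs] [InnerProductSpace ℂ Hs] [CompleteSpace Hs]
  {He P₁ F₁ E P₂ F₂ : Type v}
  [NormedAddCommGroup He] [InnerProductSpace ℂ He] [CompleteSpace He]
  [NormedAddCommGroup P₁] [InnerProductSpace ℂ P₁] [CompleteSpace P₁]
  [NormedAddCommGroup F₁] [InnerProductSpace ℂ F₁] [CompleteSpace F₁]
  [NormedAddCommGroup E] [InnerProductSpace ℂ E] [CompleteSpace E]
  [NormedAddCommGroup P₂] [InnerProductSpace ℂ P₂] [CompleteSpace P₂]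
  [NormedAddCommGroup F₂] [InnerProductSpace ℂ F₂] [CompleteSpace F₂]
  {J₁ : HilbertTensor P₁ F₁ ≃ₗᵢ[ℂ] He} {J₂ : HilbertTensor P₂ F₂ ≃ₗᵢ[ℂ] He}
  {jp : HilbertTensor P₁ E ≃ₗᵢ[ℂ] P₂} {jf : HilbertTensor E F₂ ≃ₗᵢ[ℂ] F₁}

/-- The product vectors `p_i ⊗ v_c ⊗ y_f` of `He = P₁ ⊗ E ⊗ F₂`. -/
def prepVec (J₁ : HilbertTensor P₁ F₁ ≃ₗᵢ[ℂ] He) (jf : HilbertTensor E F₂ ≃ₗᵢ[ℂ] F₁)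
    {α β γ : Type*} (p : α → P₁) (v : β → E) (y : γ → F₂) (i : (α × β) × γ) : He :=
  J₁ (htmul (p i.1.1) (jf (htmul (v i.1.2) (y i.2))))

theorem tsum_triple {α β γ : Type*} (f : α → ENNReal) (g : β → ENNReal) (h : γ → ENNReal) :
    ∑' i : (α × β) × γ, f i.1.1 * g i.1.2 * h i.2 = (∑' a, f a) * (∑' b, g b) * ∑' c, h c := by
  rw [tsum_prod_eq]
  simp only [ENNReal.tsum_mul_left, ENNReal.tsum_mul_right]
  rw [tsum_prod_eq]
  simp only [ENNReal.tsum_mul_left, ENNReal.tsum_mul_right]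

theorem tsum_prepVec {α β γ : Type*} {p : α → P₁} {v : β → E} {y : γ → F₂}
    (hp : ∑' i, ‖p i‖ₑ ^ 2 = 1) (hv : ∑' i, ‖v i‖ₑ ^ 2 = 1) (hy : ∑' i, ‖y i‖ₑ ^ 2 = 1) :
    ∑' i, ‖prepVec J₁ jf p v y i‖ₑ ^ 2 = 1 := by
  have h : ∀ i, ‖prepVec J₁ jf p v y i‖ₑ ^ 2
      = ‖p i.1.1‖ₑ ^ 2 * ‖v i.1.2‖ₑ ^ 2 * ‖y i.2‖ₑ ^ 2 := fun i => by
    rw [prepVec, ← ofReal_norm, LinearIsometryEquiv.norm_map, ofReal_norm, enorm_htmul,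
      ← ofReal_norm (jf _), LinearIsometryEquiv.norm_map, ofReal_norm, enorm_htmul]
    ring
  simp only [h]
  rw [tsum_triple (fun i => ‖p i‖ₑ ^ 2) (fun i => ‖v i‖ₑ ^ 2) (fun i => ‖y i‖ₑ ^ 2), hp, hv, hy,
    one_mul, one_mul]

theorem symmetric_tensorOp {A : Type u} {B : Type v} [NormedAddCommGroup A]
    [InnerProductSpace ℂ A] [CompleteSpace A] [NormedAddCommGroup B] [InnerProductSpace ℂ B]
    [CompleteSpace B] {f : A →L[ℂ] A} {g : B →L[ℂ] B}
    (hf : ∀ x y, ⟪f x, y⟫_ℂ = ⟪x, f y⟫_ℂ) (hg : ∀ x y, ⟪g x, y⟫_ℂ = ⟪x, g y⟫_ℂ)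
    (x y : HilbertTensor A B) : ⟪tensorOp f g x, y⟫_ℂ = ⟪x, tensorOp f g y⟫_ℂ := by
  rw [← adjoint_inner_right, adjoint_tensorOp, ← (eq_adjoint_iff f f).2 hf,
    ← (eq_adjoint_iff g g).2 hg]

/-- If the state `ρ` is the product `ρp ⊗ ρc ⊗ ρf`, then products of the vectors of ensembles of the
factors are an ensemble of `ρ`. -/
theorem isEnsemble_prepVec
    (coh : ∀ p c f, J₂ (htmul (jp (htmul p c)) f) = J₁ (htmul p (jf (htmul c f))))
    {ρ : He →L[ℂ] He} {ρp Sp : P₁ →L[ℂ] P₁} {ρc Sc : E →L[ℂ] E} {ρf Sf : F₂ →L[ℂ] F₂}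
    (hρ : IsState ρ)
    (h : ∀ p c f, ρ (J₂ (htmul (jp (htmul p c)) f)) = J₂ (htmul (jp (htmul (ρp p) (ρc c))) (ρf f)))
    (hp : ∀ x y, ⟪Sp x, y⟫_ℂ = ⟪x, Sp y⟫_ℂ) (hp' : ∀ x, Sp (Sp x) = ρp x)
    (hc : ∀ x y, ⟪Sc x, y⟫_ℂ = ⟪x, Sc y⟫_ℂ) (hc' : ∀ x, Sc (Sc x) = ρc x)
    (hf : ∀ x y, ⟪Sf x, y⟫_ℂ = ⟪x, Sf y⟫_ℂ) (hf' : ∀ x, Sf (Sf x) = ρf x)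
    {α β γ : Type*} (a : HilbertBasis α ℂ P₁) (b : HilbertBasis β ℂ E) (g : HilbertBasis γ ℂ F₂) :
    IsEnsemble ρ
      (prepVec J₁ jf (fun i => Sp (a i)) (fun i => Sc (b i)) (fun i => Sf (g i))) := by
  let S' : P₂ →L[ℂ] P₂ := (jp : HilbertTensor P₁ E →L[ℂ] P₂) ∘L tensorOp Sp Sc ∘L
    (jp.symm : P₂ →L[ℂ] HilbertTensor P₁ E)
  let S : He →L[ℂ] He := (J₂ : HilbertTensor P₂ F₂ →L[ℂ] He) ∘L tensorOp S' Sf ∘L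
    (J₂.symm : He →L[ℂ] HilbertTensor P₂ F₂)
  have hS' : ∀ p c, S' (jp (htmul p c)) = jp (htmul (Sp p) (Sc c)) := fun p c => by
    simp [S', tensorOp_htmul]
  have hS : ∀ p c f, S (J₂ (htmul (jp (htmul p c)) f))
      = J₂ (htmul (jp (htmul (Sp p) (Sc c))) (Sf f)) :=
    fun p c f => by simp [S, tensorOp_htmul, hS']
  have hsym' : ∀ x y, ⟪S' x, y⟫_ℂ = ⟪x, S' y⟫_ℂ := fun x y => by
    have h1 := symmetric_tensorOp hp hc (jp.symm x) (jp.symm y)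
    rw [← LinearIsometryEquiv.inner_map_map jp, ← LinearIsometryEquiv.inner_map_map jp (jp.symm x),
      LinearIsometryEquiv.apply_symm_apply, LinearIsometryEquiv.apply_symm_apply] at h1
    exact h1
  have hsym : ∀ x y, ⟪S x, y⟫_ℂ = ⟪x, S y⟫_ℂ := fun x y => by
    have h1 := symmetric_tensorOp hsym' hf (J₂.symm x) (J₂.symm y)
    rw [← LinearIsometryEquiv.inner_map_map J₂, ← LinearIsometryEquiv.inner_map_map J₂ (J₂.symm x),
      LinearIsometryEquiv.apply_symm_apply, LinearIsometryEquiv.apply_symm_apply] at h1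
    exact h1
  have hsq : ∀ x, S (S x) = ρ x := fun x => by
    have h1 : (S ∘L S) ∘L (J₂ : HilbertTensor P₂ F₂ →L[ℂ] He)
        = ρ ∘L (J₂ : HilbertTensor P₂ F₂ →L[ℂ] He) := by
      refine ext_htmul fun q f => ?_
      have h2 : ((S ∘L S) ∘L (J₂ : HilbertTensor P₂ F₂ →L[ℂ] He)) ∘L tmulRight P₂ f ∘L
          (jp : HilbertTensor P₁ E →L[ℂ] P₂) = (ρ ∘L (J₂ : HilbertTensor P₂ F₂ →L[ℂ] He)) ∘L
          tmulRight P₂ f ∘L (jp : HilbertTensor P₁ E →L[ℂ] P₂) :=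
        ext_htmul fun p c => by
          change S (S (J₂ (htmul (jp (htmul p c)) f))) = ρ (J₂ (htmul (jp (htmul p c)) f))
          rw [hS, hS, h, hp', hc', hf']
      have h3 := congrArg (fun k => k (jp.symm q)) h2
      simpa [tmulRight_apply] using h3
    have h4 := congrArg (fun k => k (J₂.symm x)) h1
    simpa using h4
  have h5 := (hρ.isEnsemble_sqrt hsym hsq
    (mapBasis (tensorBasis (mapBasis (tensorBasis a b) jp) g) J₂)).1
  convert h5 using 1
  funext i
  simp only [mapBasis_apply, tensorBasis_apply, prepVec, ← coh, hS]

/-- Divisibility of the dynamics: preparing the environment anew at `t₁`, in the state that it would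
have if there were no system, does not change the average evolution of the system. Indeed, at `t₁`
the system is correlated only with `P₁`, and `P₁` does not influence it any more; on `E ⊗ F₂` the
evolution up to `t₁` acts as `X ⊗ Y`, which has been taken into account in the preparation. -/
theorem average_prepVec
    (coh : ∀ p c f, J₂ (htmul (jp (htmul p c)) f) = J₁ (htmul p (jf (htmul c f))))
    {W₁ W₂ W : HilbertTensor Hs He ≃ₗᵢ[ℂ] HilbertTensor Hs He} (hW₂ : ∀ Ω, W₂ Ω = W (W₁ Ω))
    {Up : P₁ ≃ₗᵢ[ℂ] P₁} {Usc : HilbertTensor Hs E ≃ₗᵢ[ℂ] HilbertTensor Hs E} {Uf : F₂ ≃ₗᵢ[ℂ] F₂}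
    (hW : ∀ p f y, W (embF Hs J₂ f (embE Hs jp p y))
      = embF Hs J₂ (Uf f) (embE Hs jp (Up p) (Usc y)))
    {V : HilbertTensor Hs P₁ →L[ℂ] HilbertTensor Hs P₁} {X : E →L[ℂ] E} {Y : F₂ →L[ℂ] F₂}
    (hX : ∀ c, ‖X c‖ = ‖c‖) (hY : ∀ f, ‖Y f‖ = ‖f‖)
    (h₁ : ∀ c f ω, W₁ (embF Hs J₁ (jf (htmul c f)) ω) = embF Hs J₁ (jf (htmul (X c) (Y f))) (V ω))
    {α β γ : Type*} {p : α → P₁} {v : β → E} {y : γ → F₂}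
    (hp : ∑' i, ‖p i‖ₑ ^ 2 = 1) (hv : ∑' i, ‖v i‖ₑ ^ 2 = 1) (hy : ∑' i, ‖y i‖ₑ ^ 2 = 1)
    (ψ : Hs) {κ : Type*} (s : κ → Hs)
    (hs : ∀ x, ∑' k, ‖⟪x, s k⟫_ℂ‖ₑ ^ 2
      = ∑' i, ‖ctrL He x (W₁ (htmul ψ (prepVec J₁ jf p v y i)))‖ₑ ^ 2) (x : Hs) :
    ∑' k, ∑' i, ‖ctrL He x (W (htmul (s k)
        (prepVec J₁ jf p (fun i => X (v i)) (fun i => Y (y i)) i)))‖ₑ ^ 2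
      = ∑' i, ‖ctrL He x (W₂ (htmul ψ (prepVec J₁ jf p v y i)))‖ₑ ^ 2 := by
  have hX' : ∀ c, ‖X c‖ₑ = ‖c‖ₑ := fun c => by rw [← ofReal_norm, hX, ofReal_norm]
  have hY' : ∀ c, ‖Y c‖ₑ = ‖c‖ₑ := fun c => by rw [← ofReal_norm, hY, ofReal_norm]
  let K : β → Hs →L[ℂ] E := fun c => ctrL E x ∘L
    (Usc : HilbertTensor Hs E →L[ℂ] HilbertTensor Hs E) ∘L tmulRight Hs (X (v c))
  have hK : ∀ c s, K c s = ctrL E x (Usc (htmul s (X (v c)))) := fun c s => rfl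
  let ω : α → HilbertTensor Hs P₁ := fun i => V (htmul ψ (p i))
  have hω : ∀ i, W₁ (htmul ψ (prepVec J₁ jf p v y i))
      = embF Hs J₁ (jf (htmul (X (v i.1.2)) (Y (y i.2)))) (ω i.1.1) := fun i => by
    rw [prepVec, ← embF_htmul, h₁]
  -- the left-hand side
  have h2 : ∀ k i, ‖ctrL He x (W (htmul (s k)
        (prepVec J₁ jf p (fun i => X (v i)) (fun i => Y (y i)) i)))‖ₑ ^ 2
      = ‖p i.1.1‖ₑ ^ 2 * ‖K i.1.2 (s k)‖ₑ ^ 2 * ‖y i.2‖ₑ ^ 2 := fun k i => by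
    rw [prepVec, ← coh, ← embF_htmul, ← embE_htmul, hW, ctrL_embF, ctrL_embE, ← ofReal_norm,
      LinearIsometryEquiv.norm_map, ofReal_norm, enorm_htmul, ← ofReal_norm (jp _),
      LinearIsometryEquiv.norm_map, ofReal_norm, enorm_htmul, ← ofReal_norm (Up _),
      ← ofReal_norm (Uf _), LinearIsometryEquiv.norm_map, LinearIsometryEquiv.norm_map,
      ofReal_norm, ofReal_norm, hY', hK]
    ring
  simp only [h2]
  have h3 : ∀ k, ∑' i : (α × β) × γ, ‖p i.1.1‖ₑ ^ 2 * ‖K i.1.2 (s k)‖ₑ ^ 2 * ‖y i.2‖ₑ ^ 2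
      = ∑' c, ‖K c (s k)‖ₑ ^ 2 := fun k => by
    rw [tsum_triple (fun i => ‖p i‖ₑ ^ 2) (fun c => ‖K c (s k)‖ₑ ^ 2) (fun i => ‖y i‖ₑ ^ 2), hp, hy,
      one_mul, mul_one]
  simp only [h3]
  rw [ENNReal.tsum_comm]
  -- the right-hand side
  have h4 : ∀ i, ‖ctrL He x (W₂ (htmul ψ (prepVec J₁ jf p v y i)))‖ₑ ^ 2
      = (∑' j, ‖K i.1.2 (ctrR Hs (basis P₁ j) (ω i.1.1))‖ₑ ^ 2) * ‖y i.2‖ₑ ^ 2 := fun i => by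
    rw [hW₂, hω, enorm_ctrL_evol coh hW (basis P₁), hY', mul_comm]
    rfl
  simp only [h4]
  rw [tsum_prod_eq]
  simp only [ENNReal.tsum_mul_left, hy, mul_one]
  rw [tsum_prod_eq, ENNReal.tsum_comm (α := α)]
  refine tsum_congr fun c => ?_
  rw [← tsum_prod_eq (fun q : α × basisSet P₁ => ‖K c (ctrR Hs (basis P₁ q.2) (ω q.1))‖ₑ ^ 2)]
  refine tsum_enorm_map_eq (fun x' => ?_) (K c)
  have h5 : ∀ i, ‖ctrL He x' (W₁ (htmul ψ (prepVec J₁ jf p v y i)))‖ₑ ^ 2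
      = ‖ctrL P₁ x' (ω i.1.1)‖ₑ ^ 2 * ‖v i.1.2‖ₑ ^ 2 * ‖y i.2‖ₑ ^ 2 := fun i => by
    rw [hω, ctrL_embF, ← ofReal_norm, LinearIsometryEquiv.norm_map, ofReal_norm, enorm_htmul,
      ← ofReal_norm (jf _), LinearIsometryEquiv.norm_map, ofReal_norm, enorm_htmul, hX', hY']
    ring
  rw [hs]
  simp only [h5]
  rw [tsum_triple (fun i => ‖ctrL P₁ x' (ω i)‖ₑ ^ 2) (fun i => ‖v i‖ₑ ^ 2) (fun i => ‖y i‖ₑ ^ 2), hv,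
    hy, mul_one, mul_one, tsum_prod_eq]
  simp only [inner_ctrR, tsum_enorm_inner_htmul_basis]

end Prep

section PFI

attribute [instance] OpenSystem.PastFutureDecomposition.normP
  OpenSystem.PastFutureDecomposition.innerP OpenSystem.PastFutureDecomposition.completeP
  OpenSystem.PastFutureDecomposition.normE OpenSystem.PastFutureDecomposition.innerE
  OpenSystem.PastFutureDecomposition.completeE OpenSystem.PastFutureDecomposition.normF
  OpenSystem.PastFutureDecomposition.innerF OpenSystem.PastFutureDecomposition.completeF

variable {Hs : Type u} [NormedAddCommGroup Hs] [InnerProductSpace ℂ Hs] [CompleteSpace Hs]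
  {He : Type v} [NormedAddCommGroup He] [InnerProductSpace ℂ He] [CompleteSpace He]
  {T : Type w} [LinearOrder T] [OrderBot T] {D : OpenSystem T Hs He}

/-- The factorization of the evolution in terms of the embeddings `embF` and `embE`. -/
theorem exists_evol_factors (Q : D.PastFutureDecomposition) {τ τ' : T} (h : τ ≤ τ') :
    ∃ (Up : Q.P τ ≃ₗᵢ[ℂ] Q.P τ)
      (Usc : HilbertTensor Hs (Q.E τ τ') ≃ₗᵢ[ℂ] HilbertTensor Hs (Q.E τ τ'))
      (Uf : Q.F τ' ≃ₗᵢ[ℂ] Q.F τ'), ∀ p f y,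
        D.evol τ τ' (embF Hs (Q.join τ') f (embE Hs (Q.joinPast τ τ' h) p y))
          = embF Hs (Q.join τ') (Uf f) (embE Hs (Q.joinPast τ τ' h) (Up p) (Usc y)) := by
  obtain ⟨Up, Usc, Uf, hU⟩ := Q.evol_factorizes τ τ' h
  refine ⟨Up, Usc, Uf, fun p f y => ?_⟩
  have h1 : ∀ p f y, tensorOp (ContinuousLinearMap.id ℂ Hs)
      ((Q.join τ' : HilbertTensor (Q.P τ') (Q.F τ') →L[ℂ] He) ∘L tmulRight (Q.P τ') f ∘L
        (Q.joinPast τ τ' h : HilbertTensor (Q.P τ) (Q.E τ τ') →L[ℂ] Q.P τ') ∘L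
          tmulLeft (Q.E τ τ') p) y
      = embF Hs (Q.join τ') f (embE Hs (Q.joinPast τ τ' h) p y) := fun p f y => by
    rw [embF, embE, ← comp_apply, tensorOp_comp]
    rfl
  have h2 := hU p f y
  simp only [h1] at h2
  exact h2

/-- The properties of an ensemble of environment vectors that make it a suitable preparation
at `τ`, for the evolution up to `τ'`. -/
def IsPrepFor (Q : D.PastFutureDecomposition) (τ τ' : T) {ι : Type v} (z : ι → He) : Prop :=
  ∑' c, ‖z c‖ₑ ^ 2 = 1 ∧ (τ = ⊥ → IsEnsemble D.ρe z) ∧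
  (∀ c, ∃ (f : Q.F τ') (M : Hs → HilbertTensor Hs (Q.P τ')), ∀ s,
    D.evol τ τ' (htmul s (z c)) = embF Hs (Q.join τ') f (M s)) ∧
  ∀ ψ : Hs, ‖ψ‖ = 1 → ∀ {κ : Type v} (s : κ → Hs), IsEnsemble (D.dynMap τ (ketbra ψ)) s →
    ∀ x, ∑' k, ∑' c, ‖ctrL He x (D.evol τ τ' (htmul (s k) (z c)))‖ₑ ^ 2
      = ‖⟪x, D.dynMap τ' (ketbra ψ) x⟫_ℂ‖ₑ

/-- The preparations for one step, made of square roots of the states of the past, current and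
future subsystems in arbitrary bases. The operators `Sc` and `Sf` also contain the evolution `X`, `Y`
of the current and future subsystems up to the time `τ`; the past subsystem has no influence after
`τ`, so that its evolution need not be included in `Sp`. -/
theorem exists_prepVec (Q : D.PastFutureDecomposition) {τ τ' : T} (h : τ ≤ τ') {s₀ : Hs}
    (hs₀ : ‖s₀‖ = 1) :
    ∃ (Up : Q.P τ ≃ₗᵢ[ℂ] Q.P τ)
      (Usc : HilbertTensor Hs (Q.E τ τ') ≃ₗᵢ[ℂ] HilbertTensor Hs (Q.E τ τ'))
      (Uf : Q.F τ' ≃ₗᵢ[ℂ] Q.F τ') (Sp : Q.P τ →L[ℂ] Q.P τ) (Sc : Q.E τ τ' →L[ℂ] Q.E τ τ')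
      (Sf : Q.F τ' →L[ℂ] Q.F τ'),
      (∀ p f y, D.evol τ τ' (embF Hs (Q.join τ') f (embE Hs (Q.joinPast τ τ' h) p y))
          = embF Hs (Q.join τ') (Uf f) (embE Hs (Q.joinPast τ τ' h) (Up p) (Usc y))) ∧
      ∀ {α β γ : Type v} (a : HilbertBasis α ℂ (Q.P τ)) (b : HilbertBasis β ℂ (Q.E τ τ'))
        (g : HilbertBasis γ ℂ (Q.F τ')),
        ∑' i, ‖Sp (a i)‖ₑ ^ 2 = 1 ∧ ∑' i, ‖Sc (b i)‖ₑ ^ 2 = 1 ∧ ∑' i, ‖Sf (g i)‖ₑ ^ 2 = 1 ∧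
        IsPrepFor Q τ τ' (prepVec (Q.join τ) (Q.joinFuture τ τ' h) (fun i => Sp (a i))
          (fun i => Sc (b i)) (fun i => Sf (g i))) := by
  obtain ⟨Up, Usc, Uf, hU⟩ := exists_evol_factors Q h
  obtain ⟨ρp, ρc, ρf, hρp, hρc, hρf, hρ⟩ := Q.state_factorizes τ τ' h
  obtain ⟨Rp, hRp, hRp'⟩ := hρp.exists_sqrt
  obtain ⟨Rc, hRc, hRc'⟩ := hρc.exists_sqrt
  obtain ⟨Rf, hRf, hRf'⟩ := hρf.exists_sqrt
  have coh := Q.coherent τ τ' h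
  -- `U(⊥,τ)` acts on `F_τ = E ⊗ F_τ'` as `X ⊗ Y`; for `τ = ⊥` the factors `X` and `Y` are chosen
  -- to be `1` (and not merely scalars), so that the preparation represents the initial state
  have hXY : ∃ (X : Q.E τ τ' →L[ℂ] Q.E τ τ') (Y : Q.F τ' →L[ℂ] Q.F τ')
      (V : HilbertTensor Hs (Q.P τ) →L[ℂ] HilbertTensor Hs (Q.P τ)),
      (∀ c, ‖X c‖ = ‖c‖) ∧ (∀ f, ‖Y f‖ = ‖f‖) ∧
      (∀ c f ω, D.U τ (embF Hs (Q.join τ) (Q.joinFuture τ τ' h (htmul c f)) ω)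
        = embF Hs (Q.join τ) (Q.joinFuture τ τ' h (htmul (X c) (Y f))) (V ω)) ∧
      (τ = ⊥ → (∀ c, X c = c) ∧ ∀ f, Y f = f) := by
    by_cases hτ : τ = ⊥
    · subst hτ
      refine ⟨ContinuousLinearMap.id ℂ _, ContinuousLinearMap.id ℂ _, ContinuousLinearMap.id ℂ _,
        fun _ => rfl, fun _ => rfl, fun c f ω => ?_, fun _ => ⟨fun _ => rfl, fun _ => rfl⟩⟩
      rw [D.U_bot]
      rfl
    · have hevol : ∀ σ Ω, D.evol ⊥ σ Ω = D.U σ Ω := fun σ Ω => by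
        simp only [OpenSystem.evol, D.U_bot]
        rfl
      obtain ⟨p₀, hp₀⟩ := hρp.exists_norm_eq_one
      obtain ⟨f₀, hf₀⟩ := hρf.exists_norm_eq_one
      obtain ⟨-, -, ρ₁, -, -, hρ₁, -⟩ := Q.state_factorizes ⊥ τ bot_le
      obtain ⟨f₁, hf₁⟩ := hρ₁.exists_norm_eq_one
      obtain ⟨Up₁, Usc₁, Uf₁, hU₁⟩ := exists_evol_factors Q (bot_le : ⊥ ≤ τ)
      obtain ⟨Up₂, Usc₂, Uf₂, hU₂⟩ := exists_evol_factors Q (bot_le : ⊥ ≤ τ')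
      obtain ⟨V₁, hV₁⟩ := exists_coarse _ _ _ _ hU₁ hf₁
      obtain ⟨V₂, hV₂⟩ := exists_coarse _ _ _ _ hU₂ hf₀
      obtain ⟨V₃, hV₃⟩ := exists_coarse (D.evol τ τ').symm Up.symm Usc.symm Uf.symm
        (fun p f y => by
          rw [LinearIsometryEquiv.symm_apply_eq, hU]
          simp) hf₀
      simp only [hevol] at hV₁ hV₂
      obtain ⟨X, hX, hXY⟩ := exists_future_product coh (W₁ := D.U τ) (W₂ := D.U τ')
        (W := (D.evol τ τ').symm) (fun Ω => by
          simp [OpenSystem.evol]) hV₁ hV₂ hV₃ hs₀ hp₀ hf₀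
      refine ⟨X, ((Uf₂.trans Uf.symm : Q.F τ' ≃ₗᵢ[ℂ] Q.F τ') : Q.F τ' →L[ℂ] Q.F τ'), V₁, hX,
        fun f => LinearIsometryEquiv.norm_map _ _, fun c f ω => ?_, fun h => absurd h hτ⟩
      rw [hV₁, hXY]
      rfl
  obtain ⟨X, Y, V, hX, hY, hV, hbot⟩ := hXY
  have hX' : ∀ c, ‖X c‖ₑ = ‖c‖ₑ := fun c => by rw [← ofReal_norm, hX, ofReal_norm]
  have hY' : ∀ c, ‖Y c‖ₑ = ‖c‖ₑ := fun c => by rw [← ofReal_norm, hY, ofReal_norm]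
  refine ⟨Up, Usc, Uf, Rp, X ∘L Rc, Y ∘L Rf, hU, fun a b g => ?_⟩
  have h1 := (hρp.isEnsemble_sqrt hRp hRp' a).2
  have h2 := (hρc.isEnsemble_sqrt hRc hRc' b).2
  have h3 := (hρf.isEnsemble_sqrt hRf hRf' g).2
  have h2' : ∑' i, ‖(X ∘L Rc) (b i)‖ₑ ^ 2 = 1 := by simpa only [comp_apply, hX'] using h2
  have h3' : ∑' i, ‖(Y ∘L Rf) (g i)‖ₑ ^ 2 = 1 := by simpa only [comp_apply, hY'] using h3
  have hens := isEnsemble_prepVec coh D.isState hρ hRp hRp' hRc hRc' hRf hRf' a b g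
  refine ⟨h1, h2', h3', tsum_prepVec h1 h2' h3', fun hτ => ?_, fun i => ?_,
    fun ψ hψ κ s hs x => ?_⟩
  · obtain ⟨hXc, hYf⟩ := hbot hτ
    simpa only [comp_apply, hXc, hYf] using hens
  · refine ⟨Uf ((Y ∘L Rf) (g i.2)), fun s => embE Hs (Q.joinPast τ τ' h) (Up (Rp (a i.1.1)))
      (Usc (htmul s ((X ∘L Rc) (b i.1.2)))), fun s => ?_⟩
    rw [← hU, embE_htmul, embF_htmul, coh]
    rfl
  · rw [enorm_inner_dynMap hens]
    refine average_prepVec coh (W₁ := D.U τ) (W₂ := D.U τ') (W := D.evol τ τ')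
      (fun Ω => by simp [OpenSystem.evol]) hU hX hY hV h1 h2 h3 ψ s (fun y => ?_) x
    rw [hs.enorm_inner_eq, enorm_inner_dynMap hens]

/-- The repreparation family of a past–future decomposition: product bases of past and future are
read out, and only the result for the past is recorded. -/
def pfiFamily (Q : D.PastFutureDecomposition) {s₀ : Hs} (hs₀ : ‖s₀‖ = 1) :
    RepreparationFamily D where
  IsReadout τ _ B := ∃ (a : _ → Q.P τ) (g : HilbertBasis B.G ℂ (Q.F τ)),
    ∀ i k, B.b i k = Q.join τ (htmul (a i) (g k))
  IsPrep τ τ' _ z := IsPrepFor Q τ τ' z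
  exists_readout τ := ⟨_, basisReadout (Q.join τ) (basis (Q.P τ)) (basis (Q.F τ)),
    fun i => basis (Q.P τ) i, basis (Q.F τ), fun _ _ => rfl⟩
  exists_prep τ τ' h := by
    obtain ⟨Up, Usc, Uf, Sp, Sc, Sf, -, h1⟩ := exists_prepVec Q h hs₀
    exact ⟨_, _, (h1 (basis _) (basis _) (basis _)).2.2.2⟩
  tsum_eq h := h.1
  init h := h.2.1 rfl
  pure {τ τ'} hle ι A z B hz hB c a := by
    obtain ⟨f, M, hM⟩ := hz.2.2.1 c
    obtain ⟨a', g, hag⟩ := hB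
    refine ⟨fun s => ((‖f‖ : ℝ) : ℂ) • ctrR Hs (a' a) (M s), fun s x => ?_⟩
    simp only [hM, hag, ← embF_htmul, inner_embF, enorm_mul, mul_pow, ENNReal.tsum_mul_right,
      tsum_enorm_inner_basis, inner_smul_right, inner_ctrR, enorm_ofReal_norm]
  average _ _ _ hz := hz.2.2.2

theorem pu_of_pfi (h : D.PFI) : D.PU := by
  obtain ⟨Q⟩ := h
  intro ψ hψ
  exact (pfiFamily Q hψ).pu ψ hψ

end PFI

/-! ### Many pure unravellings from past–future independence -/

/-- A sesquilinear function whose values are not all multiples of one vector takes all the values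
on some affine (real) line that avoids the origin, with linearly independent `u₁` and `u₂`: if
the first argument or the second argument can be held fixed, this is immediate, and otherwise
`f w₁ v₁` and `f w₂ v₂` independent would force `f w₁ v₂ = f w₂ v₁ = 0`, so that `w₁ + w₂` can be held
fixed. -/
theorem exists_line_of_not_collinear {V W S : Type*} [AddCommGroup V] [Module ℂ V]
    [AddCommGroup W] [Module ℂ W] [AddCommGroup S] [Module ℂ S] {f : W → V → S}
    (hv : ∀ w v v' (c : ℂ), f w (v + c • v') = f w v + c • f w v')
    (hw : ∀ w w' v (c : ℂ), f (w + c • w') v = f w v + (starRingEnd ℂ) c • f w' v)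
    (h : ¬∃ u, ∀ w v, ∃ c : ℂ, f w v = c • u) :
    ∃ u₁ u₂, LinearIndependent ℂ ![u₁, u₂] ∧ ∀ θ : ℝ, ∃ w v, f w v = u₁ + (θ : ℂ) • u₂ := by
  by_contra hcon
  have hA : ∀ w v v', ¬LinearIndependent ℂ ![f w v, f w v'] := fun w v v' hli =>
    hcon ⟨_, _, hli, fun θ => ⟨w, v + (θ : ℂ) • v', hv _ _ _ _⟩⟩
  have hB : ∀ w w' v, ¬LinearIndependent ℂ ![f w v, f w' v] := fun w w' v hli =>
    hcon ⟨_, _, hli, fun θ => ⟨w + (θ : ℂ) • w', v, by rw [hw, Complex.conj_ofReal]⟩⟩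
  have hzero : ∀ {x y z : S}, LinearIndependent ℂ ![x, y] → ¬LinearIndependent ℂ ![z, x] →
      ¬LinearIndependent ℂ ![z, y] → z = 0 := by
    intro x y z hxy hzx hzy
    by_contra hz
    rw [LinearIndependent.pair_iff' hz] at hzx hzy
    push Not at hzx hzy
    obtain ⟨a, ha⟩ := hzx
    obtain ⟨b, hb⟩ := hzy
    have hx : x ≠ 0 := hxy.ne_zero 0
    have ha0 : a ≠ 0 := fun h0 => hx (by rw [← ha, h0, zero_smul])
    refine (LinearIndependent.pair_iff' hx).1 hxy (b * a⁻¹) ?_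
    rw [← ha, ← hb, smul_smul, mul_assoc, inv_mul_cancel₀ ha0, mul_one]
  have hall : ∀ w₁ v₁ w₂ v₂, ¬LinearIndependent ℂ ![f w₁ v₁, f w₂ v₂] := by
    intro w₁ v₁ w₂ v₂ hli
    have h1 : f w₁ v₂ = 0 := hzero hli (hA _ _ _) (hB _ _ _)
    have h2 : f w₂ v₁ = 0 := hzero hli (hB _ _ _) (hA _ _ _)
    refine hA (w₁ + (1 : ℂ) • w₂) v₁ v₂ ?_
    rw [hw, hw, h1, h2]
    simpa using hli
  refine h ?_
  by_cases h0 : ∀ w v, f w v = 0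
  · exact ⟨0, fun w v => ⟨0, by rw [h0, smul_zero]⟩⟩
  · push Not at h0
    obtain ⟨w, v, hne⟩ := h0
    refine ⟨f w v, fun w' v' => ?_⟩
    have := hall w v w' v'
    rw [LinearIndependent.pair_iff' hne] at this
    push Not at this
    exact this.imp fun c hc => hc.symm

section PFI

variable {Hs : Type u} [NormedAddCommGroup Hs] [InnerProductSpace ℂ Hs] [CompleteSpace Hs]
  {He : Type v} [NormedAddCommGroup He] [InnerProductSpace ℂ He] [CompleteSpace He]
  {T : Type w} [LinearOrder T] [OrderBot T] {D : OpenSystem T Hs He}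

theorem exists_ne_zero_of_tsum {ι V : Type*} [NormedAddCommGroup V] {v : ι → V}
    (h : ∑' i, ‖v i‖ₑ ^ 2 = 1) : ∃ i, v i ≠ 0 := by
  by_contra hcon
  push Not at hcon
  simp [hcon] at h

/-- Under past–future independence, if the state is pure at `τ` but mixed at `τ'`, then suitable
product bases of the environment realise all the conditional states on a line of vectors. -/
theorem pfiFamily_line (Q : D.PastFutureDecomposition) {s₀ : Hs} (hs₀ : ‖s₀‖ = 1) {ψ : Hs}
    (hψ : ‖ψ‖ = 1) {τ τ' : T} (h : τ ≤ τ') {s : Hs} (hs : D.dynMap τ (ketbra ψ) = ketbra s)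
    (hmix : ¬IsPure (D.dynMap τ' (ketbra ψ))) :
    ∃ u₁ u₂, LinearIndependent ℂ ![u₁, u₂] ∧ ∀ θ : ℝ, ∃ (A ι : Type v) (B : Readout He A)
      (z : ι → He) (a : A) (c : ι) (κ : ℂ), (pfiFamily Q hs₀).IsReadout τ' B ∧
      (pfiFamily Q hs₀).IsPrep τ τ' z ∧ κ ≠ 0 ∧
      ∀ x, ∑' g, ‖⟪htmul x (B.b a g), D.evol τ τ' (htmul s (z c))⟫_ℂ‖ₑ ^ 2
        = ‖⟪x, κ • (u₁ + (θ : ℂ) • u₂)⟫_ℂ‖ₑ ^ 2 := by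
  obtain ⟨Up, Usc, Uf, Sp, Sc, Sf, hU, hprep⟩ := exists_prepVec Q h hs₀
  have coh := Q.coherent τ τ' h
  obtain ⟨hSp, hSc, hSf, hP⟩ := hprep (basis _) (basis _) (basis _)
  obtain ⟨i₀, hi₀⟩ := exists_ne_zero_of_tsum hSp
  obtain ⟨f₀, hf₀⟩ := exists_ne_zero_of_tsum hSf
  set p := Sp (basis (Q.P τ) i₀)
  set y := Sf (basis (Q.F τ') f₀)
  have hevol : ∀ p v y, D.evol τ τ' (htmul s (Q.join τ (htmul p (Q.joinFuture τ τ' h (htmul v y)))))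
      = embF Hs (Q.join τ') (Uf y) (embE Hs (Q.joinPast τ τ' h) (Up p) (Usc (htmul s v))) :=
    fun p v y => by rw [← hU, embE_htmul, embF_htmul, coh]
  -- up to a factor, the conditional state if `v` is the basis vector of `E` used in the preparation
  -- and `w` is the basis vector of `P_τ'` found in the read-out
  let f : Q.P τ' → Q.E τ τ' → Hs := fun w v =>
    ctrR Hs w (embE Hs (Q.joinPast τ τ' h) (Up p) (Usc (htmul s (Sc v))))
  have hv : ∀ w v v' (c : ℂ), f w (v + c • v') = f w v + c • f w v' := fun w v v' c => by
    simp only [f, map_add, map_smul, htmul_add, htmul_smul]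
  have hw : ∀ w w' v (c : ℂ), f (w + c • w') v = f w v + (starRingEnd ℂ) c • f w' v :=
    fun w w' v c => ctrR_add_smul _ _ _ _
  by_cases hcol : ∃ u, ∀ w v, ∃ c : ℂ, f w v = c • u
  · -- all conditional states agree, so that the average state is pure
    exfalso
    obtain ⟨u, hu⟩ := hcol
    choose c hc using hu
    refine hmix ?_
    obtain ⟨R, hR, hR'⟩ := D.isState.exists_sqrt
    obtain ⟨hz, hz1⟩ := D.isState.isEnsemble_sqrt hR hR' (basis He)
    have hens : IsEnsemble (D.dynMap τ' (ketbra ψ))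
        (fun q : basisSet (Q.P τ') × basisSet (Q.E τ τ') =>
        ((‖p‖⁻¹ : ℝ) : ℂ) • f (basis _ q.1) (basis _ q.2)) := by
      refine (isEnsemble_dynMap hz τ' ψ).of_moments fun x => ?_
      rw [(isEnsemble_dynMap hz τ' ψ).enorm_inner_eq,
        ← hP.2.2.2 ψ hψ (fun _ : PUnit => s) (by rw [hs]; exact IsEnsemble.single s) x]
      have h1 : ∀ i, ‖ctrL He x (D.evol τ τ' (htmul s (prepVec (Q.join τ) (Q.joinFuture τ τ' h)
          (fun i => Sp (basis _ i)) (fun i => Sc (basis _ i)) (fun i => Sf (basis _ i)) i)))‖ₑ ^ 2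
          = ‖Sp (basis _ i.1.1)‖ₑ ^ 2 * ‖ctrL _ x (Usc (htmul s (Sc (basis _ i.1.2))))‖ₑ ^ 2
            * ‖Sf (basis _ i.2)‖ₑ ^ 2 := fun i => by
        rw [prepVec, hevol, ctrL_embF, ctrL_embE, ← ofReal_norm, LinearIsometryEquiv.norm_map,
          ofReal_norm, enorm_htmul, ← ofReal_norm (Q.joinPast τ τ' h _),
          LinearIsometryEquiv.norm_map, ofReal_norm, enorm_htmul, ← ofReal_norm (Up _),
          ← ofReal_norm (Uf _), LinearIsometryEquiv.norm_map, LinearIsometryEquiv.norm_map,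
          ofReal_norm, ofReal_norm]
        ring
      simp only [h1]
      rw [tsum_eq_single PUnit.unit fun k hk => absurd rfl hk]
      rw [tsum_triple (fun i => ‖Sp (basis _ i)‖ₑ ^ 2)
        (fun i => ‖ctrL _ x (Usc (htmul s (Sc (basis _ i))))‖ₑ ^ 2)
        (fun i => ‖Sf (basis _ i)‖ₑ ^ 2), hSp, hSf, one_mul, mul_one, tsum_prod_eq,
        ENNReal.tsum_comm]
      refine tsum_congr fun j => ?_
      simp only [f, inner_smul_right, enorm_mul, mul_pow, ENNReal.tsum_mul_left, inner_ctrR,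
        tsum_enorm_inner_htmul_basis, ctrL_embE]
      rw [← ofReal_norm (Q.joinPast τ τ' h _), LinearIsometryEquiv.norm_map, ofReal_norm,
        enorm_htmul, ← ofReal_norm (Up _), LinearIsometryEquiv.norm_map, ofReal_norm, mul_pow,
        ← mul_assoc, ← mul_pow, ← enorm_ofReal_norm p, ← enorm_mul, ← Complex.ofReal_mul,
        inv_mul_cancel₀ (norm_ne_zero_iff.2 hi₀)]
      simp
    exact hens.isPure (tsum_isEnsemble_dynMap hz hz1 hψ hens) (x := u)
      (c := fun q => ((‖p‖⁻¹ : ℝ) : ℂ) * c (basis _ q.1) (basis _ q.2)) fun q => by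
        rw [hc, smul_smul]
  · obtain ⟨u₁, u₂, hli, hline⟩ := exists_line_of_not_collinear hv hw hcol
    refine ⟨u₁, u₂, hli, fun θ => ?_⟩
    obtain ⟨w, v, hwv⟩ := hline θ
    have hne : f w v ≠ 0 := by
      rw [hwv]
      intro h0
      have := (LinearIndependent.pair_iff.1 hli 1 θ (by rwa [one_smul])).1
      exact one_ne_zero this
    have hw0 : w ≠ 0 := by
      rintro rfl
      have := hw 0 0 v 1
      simp only [smul_zero, add_zero, map_one, one_smul, left_eq_add] at this
      exact hne this
    have hv0 : v ≠ 0 := by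
      rintro rfl
      have := hv w 0 0 1
      simp only [smul_zero, add_zero, one_smul, left_eq_add] at this
      exact hne this
    have hnorm : ∀ {V : Type v} [NormedAddCommGroup V] [InnerProductSpace ℂ V] {x : V}, x ≠ 0 →
        ‖((‖x‖⁻¹ : ℝ) : ℂ) • x‖ = 1 := fun {V} _ _ {x} hx => by
      rw [norm_smul, Complex.norm_real, norm_inv, norm_norm, inv_mul_cancel₀ (norm_ne_zero_iff.2 hx)]
    -- bases that contain the normalized vectors `w` and `v`
    obtain ⟨α, A, iw, hiw⟩ := exists_basis_mem (hnorm hw0)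
    obtain ⟨β, b, iv, hiv⟩ := exists_basis_mem (hnorm hv0)
    refine ⟨_, _, basisReadout (Q.join τ') A (basis (Q.F τ')), _, iw, ((i₀, iv), f₀),
      ((‖y‖ : ℝ) : ℂ) * (((‖w‖⁻¹ : ℝ) : ℂ) * ((‖v‖⁻¹ : ℝ) : ℂ)),
      ⟨fun i => A i, basis _, fun _ _ => rfl⟩, (hprep (basis _) b (basis _)).2.2.2, ?_, fun x => ?_⟩
    · refine mul_ne_zero ?_ (mul_ne_zero ?_ ?_) <;> simp [hw0, hv0, hf₀, y]
    · have h2 : ∀ g, ⟪htmul x ((basisReadout (Q.join τ') A (basis (Q.F τ'))).b iw g),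
          D.evol τ τ' (htmul s (prepVec (Q.join τ) (Q.joinFuture τ τ' h)
            (fun i => Sp (basis _ i)) (fun i => Sc (b i)) (fun i => Sf (basis _ i))
              ((i₀, iv), f₀)))⟫_ℂ = ⟪basis _ g, Uf y⟫_ℂ
            * ⟪x, f (((‖w‖⁻¹ : ℝ) : ℂ) • w) (((‖v‖⁻¹ : ℝ) : ℂ) • v)⟫_ℂ := fun g => by
        rw [prepVec, hevol]
        simp only [basisReadout, f, ← embF_htmul, inner_embF, inner_ctrR, hiw, hiv]
        rfl
      have h3 : f (((‖w‖⁻¹ : ℝ) : ℂ) • w) (((‖v‖⁻¹ : ℝ) : ℂ) • v)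
          = (((‖w‖⁻¹ : ℝ) : ℂ) * ((‖v‖⁻¹ : ℝ) : ℂ)) • f w v := by
        simp only [f, map_smul, htmul_smul, ctrR_smul, Complex.conj_ofReal, smul_smul]
      simp only [h2, enorm_mul, mul_pow, ENNReal.tsum_mul_right]
      have h4 : ∑' g : (basisReadout (Q.join τ') A (basis (Q.F τ'))).G,
          ‖⟪basis (Q.F τ') g, Uf y⟫_ℂ‖ₑ ^ 2 = ‖Uf y‖ₑ ^ 2 := tsum_enorm_inner_basis _ _
      rw [h4, h3, hwv, ← ofReal_norm (Uf _), LinearIsometryEquiv.norm_map, ofReal_norm,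
        mul_smul ((‖y‖ : ℝ) : ℂ),
        inner_smul_right _ _ ((‖y‖ : ℝ) : ℂ), enorm_mul, enorm_ofReal_norm, mul_pow]

theorem mpu_of_pfi (h : D.PFI) (hnt : D.NonTrivial) : D.MPU := by
  obtain ⟨Q⟩ := h
  obtain ⟨ψ, hψ, hmix⟩ := hnt
  exact (pfiFamily Q hψ).mpu hψ hmix fun τ τ' hle s _ hs hp => pfiFamily_line Q hψ hψ hle hs hp

end PFI

/-! ### Subsystems of dimension at most one -/

/-- A Hilbert space of dimension at most one: it does not contain two orthogonal nonzero vectors. -/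
def AtMostOneDim (H : Type*) [NormedAddCommGroup H] [InnerProductSpace ℂ H] : Prop :=
  ∀ x y : H, ⟪x, y⟫_ℂ = 0 → x = 0 ∨ y = 0

section AtMostOneDim

variable {A : Type u} {B : Type v} {H : Type*} [NormedAddCommGroup A] [InnerProductSpace ℂ A]
  [NormedAddCommGroup B] [InnerProductSpace ℂ B] [NormedAddCommGroup H] [InnerProductSpace ℂ H]

theorem AtMostOneDim.eq_smul (h : AtMostOneDim A) {e : A} (he : ‖e‖ = 1) (x : A) :
    x = ⟪e, x⟫_ℂ • e := by
  have h1 : ⟪e, x - ⟪e, x⟫_ℂ • e⟫_ℂ = 0 := by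
    rw [inner_sub_right, inner_smul_right, inner_self_eq_norm_sq_to_K, he]
    simp
  rcases h _ _ h1 with h2 | h2
  · rw [h2, norm_zero] at he
    exact absurd he zero_ne_one
  · exact sub_eq_zero.1 h2

theorem htmul_ne_zero {a : A} {b : B} (ha : a ≠ 0) (hb : b ≠ 0) : htmul a b ≠ 0 := by
  rw [← norm_ne_zero_iff, norm_htmul]
  exact mul_ne_zero (norm_ne_zero_iff.2 ha) (norm_ne_zero_iff.2 hb)

theorem AtMostOneDim.left (h : AtMostOneDim H) (J : HilbertTensor A B ≃ₗᵢ[ℂ] H) {b : B}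
    (hb : b ≠ 0) : AtMostOneDim A := by
  intro x y hxy
  by_contra! hne
  have h1 := h (J (htmul x b)) (J (htmul y b)) (by
    rw [LinearIsometryEquiv.inner_map_map, inner_htmul, hxy, zero_mul])
  simp only [map_eq_zero_iff J J.injective] at h1
  exact h1.elim (htmul_ne_zero hne.1 hb) (htmul_ne_zero hne.2 hb)

theorem AtMostOneDim.right (h : AtMostOneDim H) (J : HilbertTensor A B ≃ₗᵢ[ℂ] H) {a : A}
    (ha : a ≠ 0) : AtMostOneDim B := by
  intro x y hxy
  by_contra! hne
  have h1 := h (J (htmul a x)) (J (htmul a y)) (by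
    rw [LinearIsometryEquiv.inner_map_map, inner_htmul, hxy, mul_zero])
  simp only [map_eq_zero_iff J J.injective] at h1
  exact h1.elim (htmul_ne_zero ha hne.1) (htmul_ne_zero ha hne.2)

/-- A qubit has no non-trivial tensor factorization. -/
theorem atMostOneDim_or [FiniteDimensional ℂ H] (hH : Module.finrank ℂ H = 2)
    (J : HilbertTensor A B ≃ₗᵢ[ℂ] H) : AtMostOneDim A ∨ AtMostOneDim B := by
  by_contra! hcon
  obtain ⟨hA, hB⟩ := hcon
  unfold AtMostOneDim at hA hB
  push Not at hA hB
  obtain ⟨a, a', haa, ha, ha'⟩ := hA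
  obtain ⟨b, b', hbb, hb, hb'⟩ := hB
  have haa' : ⟪a', a⟫_ℂ = 0 := inner_eq_zero_symm.1 haa
  have hbb' : ⟪b', b⟫_ℂ = 0 := inner_eq_zero_symm.1 hbb
  -- three mutually orthogonal vectors
  have hli : LinearIndependent ℂ ![J (htmul a b), J (htmul a' b), J (htmul a b')] := by
    refine linearIndependent_of_ne_zero_of_inner_eq_zero (fun i => ?_) fun i j hij => ?_
    · fin_cases i <;>
        simp [map_eq_zero_iff J J.injective, htmul_ne_zero, ha, hb, ha', hb']
    · fin_cases i <;> fin_cases j <;>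
        simp_all [LinearIsometryEquiv.inner_map_map, inner_htmul]
  have := hli.fintype_card_le_finrank
  simp [hH] at this

/-- If one of the factors is one-dimensional, then every vector is a product. -/
theorem exists_eq_htmul [CompleteSpace A] [CompleteSpace B] (h : AtMostOneDim A ∨ AtMostOneDim B)
    {a : A} (ha : ‖a‖ = 1) {b : B} (hb : ‖b‖ = 1) (Ω : HilbertTensor A B) :
    ∃ x y, Ω = htmul x y := by
  rcases h with h | h
  · refine ⟨a, ctrL B a Ω, ?_⟩
    have h1 : ContinuousLinearMap.id ℂ (HilbertTensor A B) = tmulLeft B a ∘L ctrL B a :=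
      ext_htmul fun x y => by
        rw [comp_apply, ctrL_htmul, tmulLeft_apply, htmul_smul, ← smul_htmul, ← h.eq_smul ha]
        rfl
    exact congrArg (fun k => k Ω) h1
  · refine ⟨ctrR A b Ω, b, ?_⟩
    have h1 : ContinuousLinearMap.id ℂ (HilbertTensor A B) = tmulRight A b ∘L ctrR A b :=
      ext_htmul fun x y => by
        rw [comp_apply, ctrR_htmul, tmulRight_apply, smul_htmul, ← htmul_smul, ← h.eq_smul hb]
        rfl
    exact congrArg (fun k => k Ω) h1

end AtMostOneDim

section PFI

variable {Hs : Type u} [NormedAddCommGroup Hs] [InnerProductSpace ℂ Hs] [CompleteSpace Hs]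
  {He : Type v} [NormedAddCommGroup He] [InnerProductSpace ℂ He] [CompleteSpace He]
  {T : Type w} [LinearOrder T] [OrderBot T] {D : OpenSystem T Hs He}

/-- If the current part of the environment is trivial, and the past or the future is trivial, too,
then the evolution creates no entanglement. -/
theorem evol_product (Q : D.PastFutureDecomposition) {τ τ' : T} (h : τ ≤ τ')
    (hE : AtMostOneDim (Q.E τ τ')) (hPF : AtMostOneDim (Q.P τ') ∨ AtMostOneDim (Q.F τ'))
    {s₀ : Hs} (hs₀ : ‖s₀‖ = 1) (s : Hs) (y : He) :
    ∃ s' y', D.evol τ τ' (htmul s y) = htmul s' y' := by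
  obtain ⟨Up, Usc, Uf, hU⟩ := exists_evol_factors Q h
  obtain ⟨ρp, ρc, ρf, hρp, hρc, hρf, -⟩ := Q.state_factorizes τ τ' h
  obtain ⟨p₀, hp₀⟩ := hρp.exists_norm_eq_one
  obtain ⟨c₀, hc₀⟩ := hρc.exists_norm_eq_one
  obtain ⟨f₀, hf₀⟩ := hρf.exists_norm_eq_one
  have hr₀ : ‖Q.joinPast τ τ' h (htmul p₀ c₀)‖ = 1 := by
    rw [LinearIsometryEquiv.norm_map, norm_htmul, hp₀, hc₀, one_mul]
  obtain ⟨r, f, hrf⟩ := exists_eq_htmul hPF hr₀ hf₀ ((Q.join τ').symm y)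
  obtain ⟨p, c, hpc⟩ := exists_eq_htmul (Or.inr hE) hp₀ hc₀ ((Q.joinPast τ τ' h).symm r)
  obtain ⟨s', c', hsc⟩ := exists_eq_htmul (Or.inr hE) hs₀ hc₀ (Usc (htmul s c))
  refine ⟨s', Q.join τ' (htmul (Q.joinPast τ τ' h (htmul (Up p) c')) (Uf f)), ?_⟩
  rw [LinearIsometryEquiv.symm_apply_eq] at hrf hpc
  rw [hrf, hpc, ← embF_htmul, ← embE_htmul, hU, hsc, embE_htmul, embF_htmul]

/-- For a qubit environment, one of two successive evolutions creates no entanglement if the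
dynamics is past–future independent. -/
theorem evol_product_or (Q : D.PastFutureDecomposition) [FiniteDimensional ℂ He]
    (hHe : Module.finrank ℂ He = 2) {a b : T} (hab : a ≤ b) {s₀ : Hs} (hs₀ : ‖s₀‖ = 1) :
    (∀ s y, ∃ s' y', D.evol ⊥ a (htmul s y) = htmul s' y') ∨
      ∀ s y, ∃ s' y', D.evol a b (htmul s y) = htmul s' y' := by
  have hne : ∀ {V : Type v} [NormedAddCommGroup V] {x : V}, ‖x‖ = 1 → x ≠ 0 := fun {V} _ {x} hx =>
    norm_ne_zero_iff.1 (by rw [hx]; exact one_ne_zero)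
  rcases atMostOneDim_or hHe (Q.join a) with h | h
  · obtain ⟨ρp, -, -, hρp, -⟩ := Q.state_factorizes ⊥ a bot_le
    obtain ⟨p₀, hp₀⟩ := hρp.exists_norm_eq_one
    exact Or.inl (evol_product Q bot_le (h.right (Q.joinPast ⊥ a bot_le) (hne hp₀)) (Or.inl h) hs₀)
  · obtain ⟨-, ρc, ρf, -, hρc, hρf, -⟩ := Q.state_factorizes a b hab
    obtain ⟨c₀, hc₀⟩ := hρc.exists_norm_eq_one
    obtain ⟨f₀, hf₀⟩ := hρf.exists_norm_eq_one
    exact Or.inr (evol_product Q hab (h.left (Q.joinFuture a b hab) (hne hf₀))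
      (Or.inr (h.right (Q.joinFuture a b hab) (hne hc₀))) hs₀)

end PFI

/-! ### Controlled gates -/

/-- The state space of a qubit. -/
abbrev Qubit : Type := EuclideanSpace ℂ (Fin 2)

/-- The computational basis vectors of a qubit. -/
abbrev qubitVec (i : Fin 2) : Qubit := EuclideanSpace.single i 1

theorem inner_qubitVec (i : Fin 2) (x : Qubit) : ⟪qubitVec i, x⟫_ℂ = x i := by
  simp [EuclideanSpace.inner_single_left]

theorem qubit_eq (x : Qubit) : x = x 0 • qubitVec 0 + x 1 • qubitVec 1 := by
  ext i
  fin_cases i <;> simp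

theorem inner_qubit (x y : Qubit) :
    ⟪x, y⟫_ℂ = (starRingEnd ℂ) (x 0) * y 0 + (starRingEnd ℂ) (x 1) * y 1 := by
  simp [PiLp.inner_apply, Fin.sum_univ_two, mul_comm]

/-- The operator that applies `u` to the second factor if the first qubit is in the state `1`. -/
def ctrlOp (u : Qubit ≃ₗᵢ[ℂ] Qubit) : HilbertTensor Qubit Qubit →L[ℂ] HilbertTensor Qubit Qubit :=
  tensorOp (ketbra (qubitVec 0)) (ContinuousLinearMap.id ℂ Qubit)
    + tensorOp (ketbra (qubitVec 1)) (u : Qubit →L[ℂ] Qubit)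

theorem ctrlOp_htmul (u : Qubit ≃ₗᵢ[ℂ] Qubit) (s y : Qubit) :
    ctrlOp u (htmul s y) = s 0 • htmul (qubitVec 0) y + s 1 • htmul (qubitVec 1) (u y) := by
  rw [ctrlOp, add_apply, tensorOp_htmul, tensorOp_htmul, ketbra_apply, ketbra_apply,
    inner_qubitVec, inner_qubitVec, smul_htmul, smul_htmul]
  rfl

theorem ctrlOp_ctrlOp (u u' : Qubit ≃ₗᵢ[ℂ] Qubit) (Ω : HilbertTensor Qubit Qubit) :
    ctrlOp u (ctrlOp u' Ω) = ctrlOp (u'.trans u) Ω := by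
  have h : ctrlOp u ∘L ctrlOp u' = ctrlOp (u'.trans u) := ext_htmul fun s y => by
    rw [comp_apply, ctrlOp_htmul, map_add, map_smul, map_smul, ctrlOp_htmul, ctrlOp_htmul,
      ctrlOp_htmul]
    simp
  exact congrArg (fun k => k Ω) h

theorem ctrlOp_refl (Ω : HilbertTensor Qubit Qubit) :
    ctrlOp (LinearIsometryEquiv.refl ℂ Qubit) Ω = Ω := by
  have h : ctrlOp (LinearIsometryEquiv.refl ℂ Qubit) = ContinuousLinearMap.id ℂ _ :=
    ext_htmul fun s y => by
      rw [ctrlOp_htmul, ← smul_htmul, ← smul_htmul, LinearIsometryEquiv.coe_refl, id, ← add_htmul,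
        ← qubit_eq]
      rfl
  exact congrArg (fun k => k Ω) h

theorem adjoint_ctrlOp (u : Qubit ≃ₗᵢ[ℂ] Qubit) : adjoint (ctrlOp u) = ctrlOp u.symm :=
  ext_htmul fun s y => eq_of_inner_htmul fun s' y' => by
    have h : ⟪u y', y⟫_ℂ = ⟪y', u.symm y⟫_ℂ := by
      rw [← LinearIsometryEquiv.inner_map_map u y', LinearIsometryEquiv.apply_symm_apply]
    rw [adjoint_inner_right, ctrlOp_htmul, ctrlOp_htmul]
    simp only [inner_add_left, inner_add_right, inner_smul_left, inner_smul_right, inner_htmul, h]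
    simp only [inner_qubit]
    simp
    ring

theorem norm_ctrlOp (u : Qubit ≃ₗᵢ[ℂ] Qubit) (Ω : HilbertTensor Qubit Qubit) :
    ‖ctrlOp u Ω‖ = ‖Ω‖ := by
  have h : ⟪ctrlOp u Ω, ctrlOp u Ω⟫_ℂ = ⟪Ω, Ω⟫_ℂ := by
    rw [← adjoint_inner_right, adjoint_ctrlOp, ctrlOp_ctrlOp, LinearIsometryEquiv.self_trans_symm,
      ctrlOp_refl]
  simp only [inner_self_eq_norm_sq_to_K] at h
  norm_cast at h
  exact (sq_eq_sq₀ (norm_nonneg _) (norm_nonneg _)).1 h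

/-- The controlled gate as a unitary. -/
def ctrlGate (u : Qubit ≃ₗᵢ[ℂ] Qubit) :
    HilbertTensor Qubit Qubit ≃ₗᵢ[ℂ] HilbertTensor Qubit Qubit where
  toLinearEquiv := LinearEquiv.ofLinearMap (ctrlOp u).toLinearMap (ctrlOp u.symm).toLinearMap
    (LinearMap.ext fun Ω => by
      change ctrlOp u (ctrlOp u.symm Ω) = Ω
      rw [ctrlOp_ctrlOp, LinearIsometryEquiv.symm_trans_self, ctrlOp_refl])
    (LinearMap.ext fun Ω => by
      change ctrlOp u.symm (ctrlOp u Ω) = Ω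
      rw [ctrlOp_ctrlOp, LinearIsometryEquiv.self_trans_symm, ctrlOp_refl])
  norm_map' := norm_ctrlOp u

theorem ctrlGate_htmul (u : Qubit ≃ₗᵢ[ℂ] Qubit) (s y : Qubit) :
    ctrlGate u (htmul s y) = s 0 • htmul (qubitVec 0) y + s 1 • htmul (qubitVec 1) (u y) :=
  ctrlOp_htmul u s y

theorem ctrlGate_symm_trans (u u' : Qubit ≃ₗᵢ[ℂ] Qubit) :
    (ctrlGate u).symm.trans (ctrlGate u') = ctrlGate (u.symm.trans u') :=
  LinearIsometryEquiv.ext fun Ω => ctrlOp_ctrlOp u' u.symm Ω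

/-- A controlled gate that creates no entanglement acts as a multiple of the identity. -/
theorem exists_eq_smul_of_ctrlGate {u : Qubit ≃ₗᵢ[ℂ] Qubit}
    (h : ∀ s y, ∃ s' y', ctrlGate u (htmul s y) = htmul s' y') (y : Qubit) :
    ∃ c : ℂ, u y = c • y := by
  obtain ⟨s', y', hsy⟩ := h (qubitVec 0 + qubitVec 1) y
  rw [ctrlGate_htmul] at hsy
  have h0 := congrArg (ctrL Qubit (qubitVec 0)) hsy
  have h1 := congrArg (ctrL Qubit (qubitVec 1)) hsy
  simp [ctrL_htmul, inner_qubit] at h0 h1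
  by_cases hs : s' 0 = 0
  · refine ⟨0, ?_⟩
    rw [hs, zero_smul] at h0
    simp [h0]
  · refine ⟨s' 1 * (s' 0)⁻¹, ?_⟩
    rw [h0, smul_smul, mul_assoc, inv_mul_cancel₀ hs, mul_one]
    rw [← h0, h1]

/-! ### Many pure unravellings without past–future independence -/

/-- The Pauli matrix `X`. -/
def flipGate : Qubit ≃ₗᵢ[ℂ] Qubit := LinearIsometryEquiv.piLpCongrLeft 2 ℂ ℂ (Equiv.swap 0 1)

/-- The Pauli matrix `Z`. -/
def signGate : Qubit ≃ₗᵢ[ℂ] Qubit :=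
  LinearIsometryEquiv.piLpCongrRight 2 fun i : Fin 2 =>
    if i = 0 then LinearIsometryEquiv.refl ℂ ℂ else LinearIsometryEquiv.neg ℂ

theorem flipGate_zero : flipGate (qubitVec 0) = qubitVec 1 := by
  simp [flipGate, LinearIsometryEquiv.piLpCongrLeft_single]

theorem signGate_zero : signGate (qubitVec 0) = qubitVec 0 := by
  ext i
  fin_cases i <;> simp [signGate]

theorem signGate_one : signGate (qubitVec 1) = -qubitVec 1 := by
  ext i
  fin_cases i <;> simp [signGate]

theorem tsum_punit (f : PUnit → ENNReal) : ∑' i, f i = f PUnit.unit :=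
  tsum_eq_single PUnit.unit fun _ h => absurd rfl h

theorem isState_ketbra {H : Type u} [NormedAddCommGroup H] [InnerProductSpace ℂ H]
    [CompleteSpace H] {x : H} (hx : ‖x‖ = 1) : IsState (ketbra x) := by
  refine ⟨InnerProductSpace.isPositive_rankOne_self x, ?_⟩
  rw [(IsEnsemble.single.{0, u} x).trace_eq, tsum_punit,
    ← ofReal_norm, hx]
  simp

theorem norm_qubitVec (i : Fin 2) : ‖qubitVec i‖ = 1 := by simp

section Model

variable {T : Type w} [LinearOrder T] [OrderBot T]

/-- The gate that is controlled up to the time `t`: nothing before the time `a`, a flip at `a`, and a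
phase gate (`Z`) at `b`. -/
def gate (a b t : T) : Qubit ≃ₗᵢ[ℂ] Qubit :=
  if t < a then LinearIsometryEquiv.refl ℂ Qubit
  else if t < b then flipGate else flipGate.trans signGate

/-- From the time `a` on, the environment distinguishes the two basis states of the system. -/
theorem inner_gate {a t : T} (b : T) (h : a ≤ t) :
    ⟪qubitVec 0, gate a b t (qubitVec 0)⟫_ℂ = 0 := by
  rw [gate, if_neg h.not_gt]
  split_ifs <;> simp [flipGate_zero, signGate_one, inner_qubit]

theorem gate_symm_gate {a b t t' : T} (h : a ≤ t) (h' : t ≤ t') :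
    gate a b t' ((gate a b t).symm (qubitVec 0)) = qubitVec 0 := by
  have hf : flipGate (qubitVec 1) = qubitVec 0 := by
    simp [flipGate, LinearIsometryEquiv.piLpCongrLeft_single]
  by_cases h1 : t' < b
  · rw [gate, gate, if_neg (h.trans h').not_gt, if_neg h.not_gt, if_pos h1,
      if_pos (h'.trans_lt h1), LinearIsometryEquiv.apply_symm_apply]
  · by_cases h2 : t < b
    · rw [gate, gate, if_neg (h.trans h').not_gt, if_neg h.not_gt, if_neg h1, if_pos h2,
        ← hf, LinearIsometryEquiv.symm_apply_apply, LinearIsometryEquiv.trans_apply, hf,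
        signGate_zero]
    · rw [gate, gate, if_neg (h.trans h').not_gt, if_neg h.not_gt, if_neg h1, if_neg h2,
        LinearIsometryEquiv.apply_symm_apply]

/-- A qubit that is coupled to a qubit environment by controlled gates: a controlled flip at the time
`a` and a controlled phase gate at the time `b`. -/
def twoGates {a : T} (b : T) (ha : ⊥ < a) : OpenSystem T Qubit Qubit where
  U t := ctrlGate (gate a b t)
  U_bot := by
    rw [gate, if_pos ha]
    exact LinearIsometryEquiv.ext ctrlOp_refl
  ρe := ketbra (qubitVec 0)
  isState := isState_ketbra (norm_qubitVec 0)

variable {a b : T} (ha : ⊥ < a)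

theorem evol_twoGates (τ τ' : T) :
    (twoGates b ha).evol τ τ' = ctrlGate ((gate a b τ).symm.trans (gate a b τ')) :=
  ctrlGate_symm_trans _ _

/-- A controlled flip and a controlled phase gate are both entangling. -/
theorem not_pfi_twoGates (hab : a < b) : ¬(twoGates b ha).PFI := by
  rintro ⟨Q⟩
  have hne : ∀ {c : ℂ}, qubitVec 1 = c • qubitVec 0 → False := fun {c} h => by
    have := congrArg (fun x : Qubit => x 1) h
    simp at this
  rcases evol_product_or Q (by simp) hab.le (norm_qubitVec 0) with h | h
  · simp only [evol_twoGates] at h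
    obtain ⟨c, hc⟩ := exists_eq_smul_of_ctrlGate h (qubitVec 0)
    refine hne (c := c) ?_
    rw [← hc, gate, gate, if_pos ha, if_neg (lt_irrefl a), if_pos hab]
    exact flipGate_zero.symm
  · simp only [evol_twoGates] at h
    have hg : (gate a b a).symm.trans (gate a b b) = signGate := by
      rw [gate, gate, if_neg hab.le.not_gt, if_neg (lt_irrefl b), if_neg (lt_irrefl a), if_pos hab]
      exact LinearIsometryEquiv.ext fun x => by simp
    rw [hg] at h
    obtain ⟨c, hc⟩ := exists_eq_smul_of_ctrlGate h (qubitVec 0 + qubitVec 1)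
    rw [map_add, signGate_zero, signGate_one] at hc
    have h0 := congrArg (fun x : Qubit => x 0) hc
    have h1 := congrArg (fun x : Qubit => x 1) hc
    simp at h0 h1
    rw [← h0] at h1
    norm_num at h1

/-- If the environment distinguishes the two basis states, then only the diagonal of the reduced state
remains. -/
theorem enorm_ctrL_ctrlGate (u : Qubit ≃ₗᵢ[ℂ] Qubit) (x s : Qubit)
    (h : ⟪qubitVec 0, u (qubitVec 0)⟫_ℂ = 0) :
    ‖ctrL Qubit x (ctrlGate u (htmul s (qubitVec 0)))‖ₑ ^ 2
      = ENNReal.ofReal (‖x 0‖ ^ 2 * ‖s 0‖ ^ 2 + ‖x 1‖ ^ 2 * ‖s 1‖ ^ 2) := by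
  rw [ctrlGate_htmul, map_add, map_smul, map_smul, ctrL_htmul, ctrL_htmul, enorm_sq, smul_smul,
    smul_smul, @norm_add_sq ℂ, inner_smul_left, inner_smul_right, h, norm_smul, norm_smul,
    LinearIsometryEquiv.norm_map, norm_qubitVec, norm_mul, norm_mul]
  congr 1
  simp [inner_qubit]
  ring

theorem enorm_inner_twoGates (τ : T) (ψ x : Qubit) :
    ‖⟪x, (twoGates b ha).dynMap τ (ketbra ψ) x⟫_ℂ‖ₑ
      = ‖ctrL Qubit x (ctrlGate (gate a b τ) (htmul ψ (qubitVec 0)))‖ₑ ^ 2 := by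
  rw [enorm_inner_dynMap (D := twoGates b ha) (IsEnsemble.single.{0, 0} (qubitVec 0)),
    tsum_punit]
  rfl

theorem dynMap_twoGates {τ : T} (h : τ < a) (ψ : Qubit) :
    (twoGates b ha).dynMap τ (ketbra ψ) = ketbra ψ := by
  have h1 := isEnsemble_dynMap (D := twoGates b ha) (IsEnsemble.single.{0, 0} (qubitVec 0)) τ ψ
  refine (h1.of_moments (w := fun _ : PUnit.{1} => ψ) fun x => ?_).unique (IsEnsemble.single ψ)
  rw [h1.enorm_inner_eq, enorm_inner_twoGates, gate, if_pos h,
    tsum_punit]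
  change _ = ‖ctrL Qubit x (ctrlOp _ _)‖ₑ ^ 2
  rw [ctrlOp_refl, ctrL_htmul, enorm_smul, ← ofReal_norm (qubitVec 0), norm_qubitVec,
    ENNReal.ofReal_one, mul_one]

/-- Dephasing destroys superpositions. -/
theorem not_isPure_twoGates {τ : T} (h : a ≤ τ) {ψ : Qubit} (h0 : ψ 0 ≠ 0) (h1 : ψ 1 ≠ 0) :
    ¬IsPure ((twoGates b ha).dynMap τ (ketbra ψ)) := by
  rintro ⟨χ, hχ, hχ'⟩
  have h2 := enorm_inner_twoGates (b := b) ha τ ψ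
    -- a vector orthogonal to `χ`
    (WithLp.toLp 2 ![(starRingEnd ℂ) (χ 1), -(starRingEnd ℂ) (χ 0)])
  rw [hχ', enorm_ctrL_ctrlGate _ _ _ (inner_gate b h), inner_ketbra] at h2
  simp [inner_qubit, mul_comm (χ 1)] at h2
  have h3 : 0 ≤ ‖χ 1‖ ^ 2 * ‖ψ 0‖ ^ 2 := by positivity
  have h4 : 0 ≤ ‖χ 0‖ ^ 2 * ‖ψ 1‖ ^ 2 := by positivity
  have h5 : χ 1 = 0 := by
    have : ‖χ 1‖ ^ 2 * ‖ψ 0‖ ^ 2 = 0 := by linarith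
    simpa [h0] using this
  have h6 : χ 0 = 0 := by
    have : ‖χ 0‖ ^ 2 * ‖ψ 1‖ ^ 2 = 0 := by linarith
    simpa [h1] using this
  rw [qubit_eq χ, h5, h6] at hχ
  simp at hχ

/-- The read-out of an orthonormal basis. -/
def vectorReadout {H : Type v} [NormedAddCommGroup H] [InnerProductSpace ℂ H] {α : Type v}
    (e : HilbertBasis α ℂ H) : Readout H α where
  G := PUnit
  b i _ := e i
  parseval x := by
    rw [tsum_prod_eq, ← tsum_enorm_inner_basis e x]
    exact tsum_congr fun i => tsum_punit _

/-- The environment is prepared in its initial state before each step and read out in any basis after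
it; the whole result is recorded. From the time `a` on the controlled gates leave the prepared vector
invariant, so that the system vectors do not change; this is correct on average because the actual
reduced state is diagonal from then on and does not change either. -/
def twoGatesFamily : RepreparationFamily (twoGates b ha) where
  IsReadout _ _ B := Nonempty (Unique B.G)
  IsPrep _ _ _ z := Nonempty (Unique _) ∧ ∀ c, z c = qubitVec 0
  exists_readout _ := ⟨_, vectorReadout (basis Qubit), ⟨inferInstanceAs (Unique PUnit)⟩⟩
  exists_prep _ _ _ := ⟨PUnit, fun _ => qubitVec 0, ⟨inferInstance⟩, fun _ => rfl⟩
  tsum_eq {_ _ _ z} h := by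
    obtain ⟨⟨hu⟩, hz⟩ := h
    rw [tsum_eq_single default fun k hk => absurd (hu.uniq k) hk, hz, ← ofReal_norm, norm_qubitVec]
    simp
  init {_ _ z} h := by
    obtain ⟨⟨hu⟩, hz⟩ := h
    refine (IsEnsemble.single.{0, 0} (qubitVec 0)).of_moments fun x => ?_
    rw [tsum_eq_single default fun k hk => absurd (hu.uniq k) hk, hz,
      tsum_punit]
  pure {τ τ'} _ _ _ z B _ hB c a := by
    obtain ⟨hu⟩ := hB
    refine ⟨fun s => ctrR Qubit (B.b a default) ((twoGates b ha).evol τ τ' (htmul s (z c))),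
      fun s x => ?_⟩
    rw [tsum_eq_single default fun k hk => absurd (hu.uniq k) hk, inner_ctrR]
  average {τ τ'} hle _ z hz ψ _ _ s hs x := by
    obtain ⟨⟨hu⟩, hz⟩ := hz
    have h1 : ∀ k, ∑' c, ‖ctrL Qubit x ((twoGates b ha).evol τ τ' (htmul (s k) (z c)))‖ₑ ^ 2
        = ‖ctrL Qubit x ((twoGates b ha).evol τ τ' (htmul (s k) (qubitVec 0)))‖ₑ ^ 2 := fun k => by
      rw [tsum_eq_single default fun k hk => absurd (hu.uniq k) hk, hz]
    simp only [h1]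
    simp only [evol_twoGates]
    rw [enorm_inner_twoGates]
    rcases lt_or_ge τ a with h | h
    · rw [dynMap_twoGates ha h] at hs
      have h2 := tsum_enorm_map_eq ((IsEnsemble.single.{0, 0} ψ).moments_eq hs) (ctrL Qubit x ∘L
        ctrlOp ((gate a b τ).symm.trans (gate a b τ')) ∘L tmulRight Qubit (qubitVec 0))
      rw [tsum_punit] at h2
      refine h2.trans ?_
      have h3 : (gate a b τ).symm.trans (gate a b τ') = gate a b τ' := by
        rw [gate, if_pos h]
        rfl
      rw [h3]
      rfl
    · have h2 : ∀ k, ctrlGate ((gate a b τ).symm.trans (gate a b τ')) (htmul (s k) (qubitVec 0))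
          = htmul (s k) (qubitVec 0) := fun k => by
        rw [ctrlGate_htmul, LinearIsometryEquiv.trans_apply, gate_symm_gate h hle, ← smul_htmul,
          ← smul_htmul, ← add_htmul, ← qubit_eq]
      have h3 : ‖qubitVec 0‖ₑ = 1 := by
        rw [← ofReal_norm, norm_qubitVec, ENNReal.ofReal_one]
      simp only [h2, ctrL_htmul, enorm_smul, h3, mul_one]
      rw [hs.enorm_inner_eq, enorm_inner_twoGates, enorm_ctrL_ctrlGate _ _ _ (inner_gate b h),
        enorm_ctrL_ctrlGate _ _ _ (inner_gate b (h.trans hle))]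

/-- The choice of the basis in which the environment is read out after the controlled flip determines
the conditional states. -/
theorem mpu_twoGates : (twoGates b ha).MPU := by
  let ψ : Qubit := WithLp.toLp 2 ![3 / 5, 4 / 5]
  have hψ : ‖ψ‖ = 1 := by
    rw [EuclideanSpace.norm_eq, Real.sqrt_eq_one, Fin.sum_univ_two]
    simp [ψ]
    norm_num
  have hψ0 : ψ 0 ≠ 0 := by simp [ψ]
  have hψ1 : ψ 1 ≠ 0 := by simp [ψ]
  refine (twoGatesFamily ha).mpu hψ ⟨a, not_isPure_twoGates ha le_rfl hψ0 hψ1⟩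
    fun τ τ' hle s hs1 hs hmix => ?_
  have hτ : τ < a := by
    by_contra h
    exact not_isPure_twoGates ha (not_lt.1 h) hψ0 hψ1 ⟨s, hs1, hs⟩
  have hτ' : a ≤ τ' := by
    by_contra h
    exact hmix ⟨ψ, hψ, dynMap_twoGates ha (not_le.1 h) ψ⟩
  have hsψ : s = ⟪ψ, s⟫_ℂ • ψ := by
    rw [dynMap_twoGates ha hτ] at hs
    have h := IsEnsemble.single.{0, 0} s
    rw [← hs] at h
    exact h.mem_span_of_ketbra hψ PUnit.unit
  have hc : ⟪ψ, s⟫_ℂ ≠ 0 := fun h => by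
    rw [hsψ, h, zero_smul, norm_zero] at hs1
    exact zero_ne_one hs1
  have hs0 : s 0 ≠ 0 := by
    rw [hsψ]
    exact mul_ne_zero hc hψ0
  have hs1' : s 1 ≠ 0 := by
    rw [hsψ]
    exact mul_ne_zero hc hψ1
  set f := gate a b τ' (qubitVec 0) with hf
  have hf1 : ‖f‖ = 1 := by rw [hf, LinearIsometryEquiv.norm_map, norm_qubitVec]
  have hf0 : ⟪qubitVec 0, f⟫_ℂ = 0 := inner_gate b hτ'
  have hevol : (twoGates b ha).evol τ τ' (htmul s (qubitVec 0))
      = s 0 • htmul (qubitVec 0) (qubitVec 0) + s 1 • htmul (qubitVec 1) f := by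
    rw [evol_twoGates, ctrlGate_htmul, LinearIsometryEquiv.trans_apply]
    nth_rw 2 [gate]
    rw [if_pos hτ]
    rfl
  refine ⟨s 0 • qubitVec 0, s 1 • qubitVec 1, ?_, fun θ => ?_⟩
  · rw [LinearIndependent.pair_iff]
    intro c d hcd
    have h0 := congrArg (fun x : Qubit => x 0) hcd
    have h1 := congrArg (fun x : Qubit => x 1) hcd
    simp [hs0, hs1'] at h0 h1
    exact ⟨h0, h1⟩
  · -- finding the environment in the direction of `w` leaves the system in the state given by `θ`
    set w := qubitVec 0 + (θ : ℂ) • f with hw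
    have hw0 : w ≠ 0 := fun h => by
      have := congrArg (fun x => ⟪qubitVec 0, x⟫_ℂ) h
      simp only [hw, inner_add_right, inner_smul_right, hf0, inner_zero_right] at this
      simp at this
    have hnorm : ‖((‖w‖⁻¹ : ℝ) : ℂ) • w‖ = 1 := by
      rw [norm_smul, Complex.norm_real, norm_inv, norm_norm,
        inv_mul_cancel₀ (norm_ne_zero_iff.2 hw0)]
    obtain ⟨α, A, i, hi⟩ := exists_basis_mem hnorm
    refine ⟨_, PUnit, vectorReadout A, fun _ => qubitVec 0, i, PUnit.unit, ((‖w‖⁻¹ : ℝ) : ℂ),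
      ⟨inferInstanceAs (Unique PUnit)⟩, ⟨⟨inferInstance⟩, fun _ => rfl⟩, ?_, fun x => ?_⟩
    · simp [hw0]
    · have h1 : ctrR Qubit w (s 0 • htmul (qubitVec 0) (qubitVec 0) + s 1 • htmul (qubitVec 1) f)
          = s 0 • qubitVec 0 + (θ : ℂ) • s 1 • qubitVec 1 := by
        have h2 : ⟪w, qubitVec 0⟫_ℂ = 1 := by
          rw [hw, inner_add_left, inner_smul_left, inner_eq_zero_symm.1 hf0,
            inner_self_eq_norm_sq_to_K, norm_qubitVec]
          simp
        have h3 : ⟪w, f⟫_ℂ = θ := by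
          rw [hw, inner_add_left, inner_smul_left, hf0, inner_self_eq_norm_sq_to_K, hf1]
          simp
        rw [map_add, map_smul, map_smul, ctrR_htmul, ctrR_htmul, h2, h3, one_smul,
          smul_comm (s 1)]
      rw [← h1, hevol, ← Complex.conj_ofReal, ← ctrR_smul, inner_ctrR, ← hi]
      exact tsum_punit _

end Model

end OQS

end

theorem mainTheorem2 :
    (∀ (T : Type*) [LinearOrder T] [OrderBot T]
      (Hs : Type*) [NormedAddCommGroup Hs] [InnerProductSpace ℂ Hs] [CompleteSpace Hs]
      (He : Type*) [NormedAddCommGroup He] [InnerProductSpace ℂ He] [CompleteSpace He]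
      (D : OQS.OpenSystem T Hs He), D.PFI → D.PU ∧ (D.NonTrivial → D.MPU)) ∧
    (∀ (T : Type*) [LinearOrder T] [OrderBot T] [NoMaxOrder T],
      ∃ (Hs : Type) (_ : NormedAddCommGroup Hs) (_ : InnerProductSpace ℂ Hs)
        (_ : CompleteSpace Hs)
        (He : Type) (_ : NormedAddCommGroup He) (_ : InnerProductSpace ℂ He)
        (_ : CompleteSpace He)
        (D : OQS.OpenSystem T Hs He), D.MPU ∧ ¬ D.PFI) := by
  refine ⟨fun T _ _ Hs _ _ _ He _ _ _ D h => ⟨OQS.pu_of_pfi h, OQS.mpu_of_pfi h⟩,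
    fun T _ _ _ => ?_⟩
  obtain ⟨a, ha⟩ := exists_gt (⊥ : T)
  obtain ⟨b, hb⟩ := exists_gt a
  exact ⟨OQS.Qubit, inferInstance, inferInstance, inferInstance, OQS.Qubit, inferInstance,
    inferInstance, inferInstance, OQS.twoGates b ha, OQS.mpu_twoGates ha, OQS.not_pfi_twoGates ha hb⟩
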